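/- For an integer $k\ge 0$ let $d_k(n)$ be the number of ordered ways of writing $n\in\mathbb N=\{1,2,\dots\}$ as a product of $k$ positive integers (so $d_0(1)=1$ and $d_0(n)=0$ for $n\ge2$), and for $k\ge1$ and $A\in(0,1]$ let $$d_k(n,A)=\sum_{d\mid n,\ d\le n^A} d_{k-1}(d).$$ Call a real number $\theta\in(0,1]$ an exponent of distribution for $d_k$ if for every $g\in\mathbb N$ and every $\epsilon>0$ there is a $\delta>0$ such that, for all real $x\ge1$, all integers $1\le q\le x^{\theta-\epsilon}$ and all residue classes $a\not\equiv0\pmod q$ with $(a,q)=g$, $$\sum_{n\le x,\ n\equiv a\ (\mathrm{mod}\ q)} d_k(n)=\frac1{\phi(q/g)}\,\mathrm{Res}\Big(\frac{x^s}{s}\sum_{(n,q)=g}\frac{d_k(n)}{n^s},\,s=1\Big)+O_{g,k,\epsilon,\delta}\Big(\frac{x^{1-\delta}}{\phi(q/g)}\Big),$$ where the Dirichlet series is continued meromorphically from $\Re s>1$ to a neighbourhood of $s=1$. For integers $k,l\ge1$ put $$C_{k,l}=\prod_p\Big(\big(1-p^{-1}\big)^{l-1}+\big(1-p^{-1}\big)^{k-1}-\big(1-p^{-1}\big)^{k+l-2}\Big)$$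 and, for $h\in\mathbb N$ with factorization $h=\prod p^{\gamma}$ (where $\gamma=\gamma_p$), $$f_{k,l}(h)=\prod_{p\mid h}\frac{(1-p^{-1})\sum_{\alpha=0}^{\gamma}d_{l-1}(p^\alpha)\sum_{\beta=\alpha}^\infty d_k(p^\beta)p^{-\beta}+d_k(p^\gamma)\sum_{\alpha=\gamma+1}^\infty d_{l-1}(p^\alpha)p^{-\alpha}}{(1-p^{-1})^{1-k}+(1-p^{-1})^{1-l}-1}.$$ **Theorem.** Let $h,k,l\in\mathbb N$ be fixed, let $\theta_k$ and $\theta_{k-1}$ be exponents of distribution for $d_k$ and $d_{k-1}$ respectively, and let $0<A\le1$ and $0<B<\min(\theta_k,A\theta_{k-1})$ be fixed. Then, as $x\to\infty$, $$\sum_{n\le x}d_k(n+h,A)\,d_l(n,B)=\frac{A^{k-1}B^{l-1}C_{k,l}f_{k,l}(h)}{(k-1)!\,(l-1)!}\,x\log^{k+l-2}x+O\big(x\log^{k+l-3}x\big),$$ where the implied constant depends only on $A,B,h,k,l$ (and on the constants in the distribution estimates for $\theta_k,\theta_{k-1}$). -/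

import Mathlib

open Filter Topology Asymptotics

/-- `d_k(n)`: the number of ordered ways of writing `n` as a product of `k` positive integers
(so `d_0(1) = 1` and `d_0(n) = 0` for `n ≥ 2`). -/
def divisorFun (k n : ℕ) : ℕ := (Nat.finMulAntidiag k n).card

open Classical in
/-- The partial divisor function `d_k(n, A) = ∑_{d ∣ n, d ≤ n^A} d_{k-1}(d)`, for `k ≥ 1`. -/
noncomputable def partialDivisorFun (k n : ℕ) (A : ℝ) : ℕ :=
  ∑ d ∈ n.divisors.filter (fun d : ℕ => (d : ℝ) ≤ (n : ℝ) ^ A), divisorFun (k - 1) d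

/-- `F`, a function on (part of) the half-plane to the right of `z`, extends meromorphically to a
neighbourhood of `z`, and the coefficient of `(s - z)⁻¹` in the Laurent expansion of the extension
at `z` is `R`. The expansion is written as principal part plus analytic part. -/
def HasResidue (F : ℂ → ℂ) (z R : ℂ) : Prop :=
  ∃ (G : ℂ → ℂ) (m : ℕ) (a : ℕ → ℂ), AnalyticAt ℂ G z ∧ a 0 = R ∧
    ∀ᶠ s in 𝓝[{s : ℂ | z.re < s.re}] z,
      F s = G s + ∑ j ∈ Finset.range (m + 1), a j / (s - z) ^ (j + 1)

/-- The residue is unique. -/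
theorem HasResidue.unique {F : ℂ → ℂ} {z R R' : ℂ} (h : HasResidue F z R)
    (h' : HasResidue F z R') : R = R' := by
  obtain ⟨G, m, a, hG, rfl, ha⟩ := h
  obtain ⟨G', m', a', hG', rfl, ha'⟩ := h'
  have key : ∀ (m : ℕ) (a : ℕ → ℂ), MeromorphicAt
      (fun s => ∑ j ∈ Finset.range (m + 1), a j / (s - z) ^ (j + 1)) z := by
    intro m a; fun_prop
  have h1 : MeromorphicAt (fun s => (G s + ∑ j ∈ Finset.range (m + 1), a j / (s - z) ^ (j + 1))
      - (G' s + ∑ j ∈ Finset.range (m' + 1), a' j / (s - z) ^ (j + 1))) z :=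
    (hG.meromorphicAt.add (key m a)).sub (hG'.meromorphicAt.add (key m' a'))
  have hne : (𝓝[{s : ℂ | z.re < s.re}] z).NeBot := by
    rw [← mem_closure_iff_nhdsWithin_neBot, Complex.closure_setOfPred_lt_re]
    simp
  have hz : ∀ᶠ s in 𝓝[≠] z, (G s + ∑ j ∈ Finset.range (m + 1), a j / (s - z) ^ (j + 1))
      - (G' s + ∑ j ∈ Finset.range (m' + 1), a' j / (s - z) ^ (j + 1)) = 0 := by
    rcases h1.eventually_eq_zero_or_eventually_ne_zero with h2 | h2
    · exact h2
    · exfalso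
      have h3 : 𝓝[{s : ℂ | z.re < s.re}] z ≤ 𝓝[≠] z := by
        apply nhdsWithin_mono
        rintro s hs rfl
        exact lt_irrefl s.re hs
      obtain ⟨s, hs1, hs2, hs3⟩ := ((h2.filter_mono h3).and (ha.and ha')).exists
      exact hs1 (by rw [← hs2, ← hs3, sub_self])
  have hGa : ∀ᶠ s in 𝓝 z, AnalyticAt ℂ (fun s => G s - G' s) s :=
    (hG.sub hG').eventually_analyticAt
  rw [eventually_nhdsWithin_iff] at hz
  obtain ⟨r, hr, hball⟩ := Metric.eventually_nhds_iff_ball.1 (hz.and hGa)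
  obtain ⟨t, hr2, htr⟩ := exists_between hr
  have hsub : ∀ s ∈ Metric.closedBall z t, s ∈ Metric.ball z r := fun s hs =>
    Metric.closedBall_subset_ball htr hs
  have hH : (∮ s in C(z, t), (G s - G' s)) = 0 := by
    apply Complex.circleIntegral_eq_zero_of_differentiable_on_off_countable hr2.le
      Set.countable_empty
    · intro s hs
      exact (hball s (hsub s hs)).2.continuousAt.continuousWithinAt
    · intro s hs
      exact (hball s (hsub s (Metric.ball_subset_closedBall hs.1))).2.differentiableAt
  have hP : ∀ (m : ℕ) (a : ℕ → ℂ), (∮ s in C(z, t),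
      ∑ j ∈ Finset.range (m + 1), a j / (s - z) ^ (j + 1)) = a 0 * (2 * Real.pi * Complex.I) ∧
      CircleIntegrable (fun s => ∑ j ∈ Finset.range (m + 1), a j / (s - z) ^ (j + 1)) z t := by
    intro m a
    have hi : ∀ j : ℕ, CircleIntegrable (fun s => a j / (s - z) ^ (j + 1)) z t := by
      intro j
      apply ContinuousOn.circleIntegrable hr2.le
      apply ContinuousOn.div (by fun_prop) (by fun_prop)
      intro s hs
      apply pow_ne_zero
      rw [sub_ne_zero]
      rintro rfl
      simp at hs
      linarith
    constructor
    · rw [circleIntegral.integral_fun_sum (fun j _ => hi j), Finset.sum_range_succ']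
      rw [Finset.sum_eq_zero, zero_add]
      · simp only [zero_add, pow_one, div_eq_mul_inv]
        rw [circleIntegral.integral_const_mul, circleIntegral.integral_sub_center_inv _ hr2.ne']
      · intro j _
        simp only [div_eq_mul_inv]
        rw [circleIntegral.integral_const_mul]
        have := circleIntegral.integral_sub_zpow_of_ne (n := -((j : ℤ) + 1 + 1)) (by omega) z z t
        have h5 : ∀ s : ℂ, ((s - z) ^ (j + 1 + 1))⁻¹ = (s - z) ^ (-((j : ℤ) + 1 + 1)) := by
          intro s
          rw [zpow_neg]
          norm_cast
        simp only [h5, this, mul_zero]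
    · exact CircleIntegrable.fun_sum _ (fun j _ => hi j)
  have hcong : (∮ s in C(z, t), (G s - G' s)) = ∮ s in C(z, t),
      ((∑ j ∈ Finset.range (m' + 1), a' j / (s - z) ^ (j + 1)) -
        ∑ j ∈ Finset.range (m + 1), a j / (s - z) ^ (j + 1)) := by
    apply circleIntegral.integral_congr hr2.le
    intro s hs
    have hne : s ≠ z := by
      rintro rfl
      simp at hs
      linarith
    have := (hball s (hsub s (Metric.sphere_subset_closedBall hs))).1 hne
    simp only
    linear_combination this
  rw [hH, circleIntegral.integral_sub (hP m' a').2 (hP m a).2, (hP m' a').1, (hP m a).1] at hcong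
  have hpi := Complex.two_pi_I_ne_zero
  have : (a' 0 - a 0) * (2 * Real.pi * Complex.I) = 0 := by rw [sub_mul]; exact hcong.symm
  rcases mul_eq_zero.1 this with h | h
  · exact (sub_eq_zero.1 h).symm
  · exact absurd h hpi

open Classical in
/-- `Res(F(s), s = z)` (and `0` if `F` has no meromorphic extension to `z`). -/
noncomputable def residue (F : ℂ → ℂ) (z : ℂ) : ℂ :=
  if hF : ∃ R, HasResidue F z R then hF.choose else 0

theorem residue_eq {F : ℂ → ℂ} {z R : ℂ} (h : HasResidue F z R) : residue F z = R := by
  have hF : ∃ R, HasResidue F z R := ⟨R, h⟩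
  unfold residue
  rw [dif_pos hF]
  exact hF.choose_spec.unique h

/-- The residue at `s = 1` of `(x^s / s) ∑_{(n,q) = g} d_k(n) n^{-s}`. -/
noncomputable def residueTerm (k q g : ℕ) (x : ℝ) : ℂ :=
  residue (fun s : ℂ => (x : ℂ) ^ s / s *
    LSeries (fun n : ℕ => if n.gcd q = g then (divisorFun k n : ℂ) else 0) s) 1

/-- `θ` is an exponent of distribution for `d_k` in the residue classes `h (mod q)` with
`(h, q) = g` and `h ≢ 0 (mod q)`: for every `ε > 0` there is a `δ > 0` such that, uniformly for
`q ≤ x^(θ - ε)`, the sum of `d_k(n)` over `n ≤ x`, `n ≡ h (mod q)`, equals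
`Res((x^s / s) ∑_{(n,q) = g} d_k(n) n^{-s}, s = 1) / φ(q/g) + O(x^(1 - δ) / φ(q/g))`. -/
def IsExponentOfDistributionAt (g k : ℕ) (θ : ℝ) : Prop :=
  0 < θ ∧ θ ≤ 1 ∧
    ∀ ε : ℝ, 0 < ε → ∃ δ : ℝ, 0 < δ ∧ ∃ C : ℝ, ∀ (x : ℝ) (q h : ℕ),
      1 ≤ x → 1 ≤ q → (q : ℝ) ≤ x ^ (θ - ε) → h.gcd q = g → ¬ h ≡ 0 [MOD q] →
        ‖(∑ n ∈ Finset.Icc 1 ⌊x⌋₊ with n ≡ h [MOD q], (divisorFun k n : ℂ))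
            - residueTerm k q g x / (Nat.totient (q / g) : ℂ)‖
          ≤ C * (x ^ (1 - δ) / (Nat.totient (q / g) : ℝ))

/-- `θ` is an exponent of distribution for `d_k` for every value of `g = (h, q)`. -/
def IsExponentOfDistribution (k : ℕ) (θ : ℝ) : Prop :=
  ∀ g : ℕ, 1 ≤ g → IsExponentOfDistributionAt g k θ

/-- `C_{k,l} = ∏_p ((1-p⁻¹)^(l-1) + (1-p⁻¹)^(k-1) - (1-p⁻¹)^(k+l-2))`, for `k, l ≥ 1`. -/
noncomputable def singularConst (k l : ℕ) : ℝ :=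
  ∏' p : Nat.Primes, ((1 - (p : ℝ)⁻¹) ^ (l - 1) + (1 - (p : ℝ)⁻¹) ^ (k - 1)
    - (1 - (p : ℝ)⁻¹) ^ (k + l - 2))

/-- The factor of `f_{k,l}(h)` at the prime `p`, where `p^γ` is the exact power of `p` in `h`. -/
noncomputable def singularFactor (k l p γ : ℕ) : ℝ :=
  ((1 - (p : ℝ)⁻¹) *
      (∑ α ∈ Finset.range (γ + 1), (divisorFun (l - 1) (p ^ α) : ℝ) *
        ∑' j : ℕ, (divisorFun k (p ^ (α + j)) : ℝ) / (p : ℝ) ^ (α + j))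
    + (divisorFun k (p ^ γ) : ℝ) *
        ∑' j : ℕ, (divisorFun (l - 1) (p ^ (γ + 1 + j)) : ℝ) / (p : ℝ) ^ (γ + 1 + j))
  / ((1 - (p : ℝ)⁻¹) ^ (1 - (k : ℤ)) + (1 - (p : ℝ)⁻¹) ^ (1 - (l : ℤ)) - 1)

/-- `f_{k,l}(h) = ∏_{p ∣ h} (factor at p)`. -/
noncomputable def singularFun (k l h : ℕ) : ℝ :=
  ∏ p ∈ h.primeFactors, singularFactor k l p (h.factorization p)

/-! Write i = k - 1, j = l - 1 and X = ⌊x⌋ + h. Opening d_l(n, B) turns the correlation into a sum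
over q ≤ x^B of d_j(q) times the sum of d_k(m, A) over m ≡ h (mod q), with m running from about
q^(1/B) to X. Since q stays below the level of distribution, the inner sum may be replaced by its
mean over all classes b with (b, q) = (h, q). For this only differences between two classes with the
same gcd matter. The residue term depends on the class through that gcd alone, so it cancels and is
never evaluated.

To see that such differences are small, pass to complementary divisors: d_k(m, A) is d_k(m) minus
the sum of d_i(m/e) over e ∣ m with m^A e < m (`partialDivisorFun_eq_sub`). The exponent θ_k handles
d_k(m). For fixed e the variable m/e has length X/e > X^A, so q ≤ X^B ≤ (X/e)^(B/A), which is
admissible when B/A < θ_(k-1). This explains the condition B < min(θ_k, A θ_(k-1)); the outcome is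
`exists_abs_sum_partialDivisorFun_sub_le`.

The mean is elementary. Opening d_k(m, A) over d ≤ m^A leaves the count of multiples m of d with (m,
q) = (h, q). Divided by φ(q/(h, q)), it has density 1/lcm(d, q) if (d, q) ∣ h and 0 otherwise. The
main term is therefore X times a double sum over d ≤ X^A and q ≤ N^B, where N = ⌊x⌋
(`exists_abs_sum_sub_pairSum_le`).

In the double sum, g ↦ g·1_{g ∣ h} is the divisor sum of a bounded multiplicative function c. This
separates the variables into ∑_e c(e) M_i(e) M_j(e), where M_j(e) is the sum of d_j(n)/n over
multiples of e and is asymptotic to κ_j(e) (log y)^j / j! with an error decaying in e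
(`multipleSum_asymptotic`). The constant ∑ c κ_i κ_j is an Euler product, and Abel summation along
the powers of each prime identifies it with C_{k,l} f_{k,l}(h) (`pairConst_eq`). -/

/-! ### Recursions for d_k and rearrangement of sums over factorisations -/

theorem divisorFun_one_right (k : ℕ) : divisorFun k 1 = 1 := by
  simp [divisorFun, Nat.finMulAntidiag_one]

theorem divisorFun_zero_left (n : ℕ) : divisorFun 0 n = if n = 1 then 1 else 0 := by
  split_ifs with h
  · rw [h, divisorFun_one_right]
  · simp [divisorFun, Nat.finMulAntidiag_zero_left h]

theorem divisorFun_succ (k n : ℕ) :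
    divisorFun (k + 1) n = ∑ p ∈ n.divisorsAntidiagonal, divisorFun k p.2 := by
  unfold divisorFun
  rw [← Finset.card_sigma]
  refine Finset.card_bij' (fun f _ => ⟨(f 0, ∏ i, f (Fin.succ i)), fun i => f i.succ⟩)
    (fun s _ => Fin.cons s.1.1 s.2) ?_ ?_ ?_ ?_
  · intro f hf
    rw [Nat.mem_finMulAntidiag, Fin.prod_univ_succ] at hf
    simp only [Finset.mem_sigma, Nat.mem_divisorsAntidiagonal, Nat.mem_finMulAntidiag]
    refine ⟨hf, trivial, ?_⟩
    intro h0
    exact hf.2 (by rw [← hf.1, h0, mul_zero])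
  · rintro ⟨⟨a, b⟩, f⟩ hf
    simp only [Finset.mem_sigma, Nat.mem_divisorsAntidiagonal, Nat.mem_finMulAntidiag] at hf
    rw [Nat.mem_finMulAntidiag, Fin.prod_univ_succ]
    simpa [hf.2.1] using hf.1
  · intro f hf
    exact Fin.cons_self_tail f
  · rintro ⟨⟨a, b⟩, f⟩ hf
    simp only [Finset.mem_sigma, Nat.mem_divisorsAntidiagonal, Nat.mem_finMulAntidiag] at hf
    obtain ⟨⟨h1, h2⟩, h3, h4⟩ := hf
    subst h3
    simp

theorem divisorFun_succ_divisors (k n : ℕ) :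
    divisorFun (k + 1) n = ∑ e ∈ n.divisors, divisorFun k e := by
  rw [divisorFun_succ, Nat.sum_divisorsAntidiagonal' (fun _ b => divisorFun k b)]

/-- Summation over factorisations, ordered by the first factor. -/
theorem sum_Icc_divisorsAntidiagonal {M : Type*} [AddCommMonoid M] (F : ℕ → ℕ → M) (N : ℕ) :
    ∑ m ∈ Finset.Icc 1 N, ∑ p ∈ m.divisorsAntidiagonal, F p.1 p.2
      = ∑ a ∈ Finset.Icc 1 N, ∑ b ∈ Finset.Icc 1 (N / a), F a b := by
  rw [Finset.sum_sigma', Finset.sum_sigma']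
  refine Finset.sum_bij' (fun s _ => ⟨s.2.1, s.2.2⟩) (fun s _ => ⟨s.1 * s.2, (s.1, s.2)⟩)
    ?_ ?_ ?_ ?_ ?_
  · rintro ⟨m, a, b⟩ hs
    simp only [Finset.mem_sigma, Finset.mem_Icc, Nat.mem_divisorsAntidiagonal] at hs ⊢
    obtain ⟨⟨h1, h2⟩, rfl, h4⟩ := hs
    have ha : 0 < a := Nat.pos_of_ne_zero (left_ne_zero_of_mul h4)
    have hb : 0 < b := Nat.pos_of_ne_zero (right_ne_zero_of_mul h4)
    exact ⟨⟨ha, le_trans (Nat.le_mul_of_pos_right _ hb) h2⟩, hb,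
      (Nat.le_div_iff_mul_le ha).2 (by rwa [mul_comm])⟩
  · rintro ⟨a, b⟩ hs
    simp only [Finset.mem_sigma, Finset.mem_Icc, Nat.mem_divisorsAntidiagonal] at hs ⊢
    obtain ⟨⟨h1, h2⟩, h3, h4⟩ := hs
    have := (Nat.le_div_iff_mul_le h1).1 h4
    exact ⟨⟨Nat.mul_pos h1 h3, by rwa [mul_comm]⟩, trivial, (Nat.mul_pos h1 h3).ne'⟩
  · rintro ⟨m, a, b⟩ hs
    simp only [Finset.mem_sigma, Finset.mem_Icc, Nat.mem_divisorsAntidiagonal] at hs ⊢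
    obtain ⟨_, rfl, h4⟩ := hs
    rfl
  · rintro ⟨a, b⟩ hs
    rfl
  · rintro ⟨m, a, b⟩ hs
    rfl

theorem sum_Icc_floor_divisorsAntidiagonal {M : Type*} [AddCommMonoid M] (F : ℕ → ℕ → M)
    (y : ℝ) :
    ∑ m ∈ Finset.Icc 1 ⌊y⌋₊, ∑ p ∈ m.divisorsAntidiagonal, F p.1 p.2
      = ∑ a ∈ Finset.Icc 1 ⌊y⌋₊, ∑ b ∈ Finset.Icc 1 ⌊y / a⌋₊, F a b := by
  rw [sum_Icc_divisorsAntidiagonal]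
  simp_rw [Nat.floor_div_natCast]

/-- Restricting a sum to the multiples of `a`. -/
theorem sum_Icc_filter_dvd {M : Type*} [AddCommMonoid M] (f : ℕ → M) (N a : ℕ) (ha : 0 < a) :
    ∑ n ∈ Finset.Icc 1 N with a ∣ n, f n = ∑ b ∈ Finset.Icc 1 (N / a), f (a * b) := by
  symm
  refine Finset.sum_bij' (fun b _ => a * b) (fun n _ => n / a) ?_ ?_ ?_ ?_ ?_
  · intro b hb
    simp only [Finset.mem_Icc, Finset.mem_filter] at hb ⊢
    have := (Nat.le_div_iff_mul_le ha).1 hb.2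
    exact ⟨⟨Nat.mul_pos ha hb.1, by rwa [mul_comm]⟩, dvd_mul_right _ _⟩
  · intro n hn
    simp only [Finset.mem_Icc, Finset.mem_filter] at hn ⊢
    exact ⟨(Nat.le_div_iff_mul_le ha).2 (by simpa using Nat.le_of_dvd hn.1.1 hn.2),
      Nat.div_le_div_right hn.1.2⟩
  · intro b _
    exact Nat.mul_div_cancel_left _ ha
  · intro n hn
    exact Nat.mul_div_cancel' (Finset.mem_filter.1 hn).2
  · intro b _
    rfl

/-! ### Pointwise and average upper bounds for d_k -/

/-- Compare a + 1 with p^(aε) prime by prime. Once p^ε ≥ 2 there is no loss, since a + 1 ≤ 2^a; each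
of the finitely many smaller primes loses at most a constant factor. -/
theorem card_divisors_le_rpow {ε : ℝ} (hε : 0 < ε) :
    ∃ C : ℝ, 1 ≤ C ∧ ∀ n : ℕ, 1 ≤ n → (n.divisors.card : ℝ) ≤ C * (n : ℝ) ^ ε := by
  have hl2 : 0 < Real.log 2 := Real.log_pos one_lt_two
  -- This bounds (a + 1) / 2^(aε) for every a, because 2^(aε) ≥ 1 + aε log 2.
  set D : ℝ := 1 + 1 / (ε * Real.log 2) with hD
  have hD1 : 1 ≤ D := by
    have : 0 < 1 / (ε * Real.log 2) := by positivity
    linarith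
  set P : ℕ := ⌈(2 : ℝ) ^ (1 / ε)⌉₊ with hP
  refine ⟨D ^ P, one_le_pow₀ hD1, ?_⟩
  intro n hn
  have hn0 : n ≠ 0 := by omega
  rw [Nat.card_divisors hn0]
  have hprod : (n : ℝ) ^ ε = ∏ p ∈ n.primeFactors, ((p : ℝ) ^ ((n.factorization p : ℝ) * ε)) := by
    conv_lhs => rw [← Nat.prod_factorization_pow_eq_self hn0]
    rw [Finsupp.prod, Nat.support_factorization, Nat.cast_prod, ← Real.finsetProd_rpow]
    · refine Finset.prod_congr rfl fun p _ => ?_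
      rw [Real.rpow_mul (by positivity), Real.rpow_natCast, Nat.cast_pow]
    · intro i _
      positivity
  have hle : ∀ p ∈ n.primeFactors, ((n.factorization p + 1 : ℕ) : ℝ)
      ≤ (if p < P then D else 1) * (p : ℝ) ^ ((n.factorization p : ℝ) * ε) := by
    intro p hp
    have hp2 : (2 : ℝ) ≤ p := by exact_mod_cast (Nat.prime_of_mem_primeFactors hp).two_le
    set a := n.factorization p
    split_ifs with h
    · have h1 : 1 + (a : ℝ) * ε * Real.log 2 ≤ (2 : ℝ) ^ ((a : ℝ) * ε) := by
        rw [Real.rpow_def_of_pos two_pos]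
        have := Real.add_one_le_exp (Real.log 2 * ((a : ℝ) * ε))
        linarith
      have h2 : (2 : ℝ) ^ ((a : ℝ) * ε) ≤ (p : ℝ) ^ ((a : ℝ) * ε) :=
        Real.rpow_le_rpow (by norm_num) hp2 (by positivity)
      calc ((a + 1 : ℕ) : ℝ) ≤ D * (1 + (a : ℝ) * ε * Real.log 2) := by
            have : D * (1 + (a : ℝ) * ε * Real.log 2)
              = (1 + 1 / (ε * Real.log 2)) + a * ε * Real.log 2 + a := by
                rw [hD]; field_simp; ring
            rw [this]
            push_cast
            have h5 : 0 < 1 / (ε * Real.log 2) := by positivity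
            have h6 : 0 ≤ a * ε * Real.log 2 := by positivity
            linarith
        _ ≤ _ := by gcongr; linarith
    · rw [one_mul]
      push Not at h
      have h1 : (2 : ℝ) ≤ (p : ℝ) ^ ε := by
        have : (2 : ℝ) ^ (1 / ε) ≤ p := (Nat.le_ceil _).trans (by exact_mod_cast h)
        calc (2 : ℝ) = ((2 : ℝ) ^ (1 / ε)) ^ ε := by
              rw [← Real.rpow_mul (by norm_num), one_div, inv_mul_cancel₀ hε.ne', Real.rpow_one]
          _ ≤ _ := Real.rpow_le_rpow (by positivity) this hε.le
      calc ((a + 1 : ℕ) : ℝ) ≤ (2 : ℝ) ^ a := by exact_mod_cast Nat.lt_two_pow_self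
        _ ≤ ((p : ℝ) ^ ε) ^ a := by gcongr
        _ = _ := by rw [← Real.rpow_natCast, ← Real.rpow_mul (by positivity), mul_comm]
  rw [Nat.cast_prod]
  calc ∏ p ∈ n.primeFactors, ((n.factorization p + 1 : ℕ) : ℝ)
      ≤ ∏ p ∈ n.primeFactors,
        ((if p < P then D else 1) * (p : ℝ) ^ ((n.factorization p : ℝ) * ε)) :=
        Finset.prod_le_prod (fun _ _ => by positivity) hle
    _ = (∏ p ∈ n.primeFactors, (if p < P then D else 1)) * (n : ℝ) ^ ε := by
        rw [Finset.prod_mul_distrib, hprod]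
    _ ≤ D ^ P * (n : ℝ) ^ ε := by
        gcongr
        rw [← Finset.prod_filter, Finset.prod_const]
        apply pow_le_pow_right₀ hD1
        calc _ ≤ (Finset.range P).card := by
              apply Finset.card_le_card
              intro p hp
              simpa using (Finset.mem_filter.1 hp).2
          _ = P := Finset.card_range P

theorem divisorFun_le_rpow (k : ℕ) {ε : ℝ} (hε : 0 < ε) :
    ∃ C : ℝ, 1 ≤ C ∧ ∀ n : ℕ, 1 ≤ n → (divisorFun k n : ℝ) ≤ C * (n : ℝ) ^ ε := by
  induction k generalizing ε with
  | zero =>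
    refine ⟨1, le_rfl, fun n hn => ?_⟩
    have h1 : (1 : ℝ) ≤ (n : ℝ) ^ ε := Real.one_le_rpow (by exact_mod_cast hn) hε.le
    rw [divisorFun_zero_left]
    split_ifs <;> simp <;> linarith
  | succ k ih =>
    obtain ⟨C, hC, h⟩ := ih (half_pos hε)
    obtain ⟨D, hD, h'⟩ := card_divisors_le_rpow (half_pos hε)
    refine ⟨D * C, one_le_mul_of_one_le_of_one_le hD hC, fun n hn => ?_⟩
    have hn0 : (0 : ℝ) < n := by exact_mod_cast hn
    rw [divisorFun_succ_divisors, Nat.cast_sum]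
    calc ∑ e ∈ n.divisors, (divisorFun k e : ℝ) ≤ ∑ e ∈ n.divisors, C * (n : ℝ) ^ (ε / 2) := by
          refine Finset.sum_le_sum fun e he => (h e (Nat.pos_of_mem_divisors he)).trans ?_
          have : e ≤ n := Nat.divisor_le he
          gcongr
      _ = n.divisors.card * (C * (n : ℝ) ^ (ε / 2)) := by rw [Finset.sum_const, nsmul_eq_mul]
      _ ≤ (D * (n : ℝ) ^ (ε / 2)) * (C * (n : ℝ) ^ (ε / 2)) := by
          gcongr
          exact h' n hn
      _ = D * C * (n : ℝ) ^ ε := by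
          rw [mul_mul_mul_comm, ← Real.rpow_add hn0, add_halves]

theorem sum_inv_le_one_add_log {y : ℝ} (hy : 1 ≤ y) :
    ∑ n ∈ Finset.Icc 1 ⌊y⌋₊, (1 : ℝ) / n ≤ 1 + Real.log y := by
  have := harmonic_floor_le_one_add_log y hy
  rw [harmonic_eq_sum_Icc] at this
  push_cast at this
  simpa [one_div] using this

theorem natCast_le_of_mem_Icc_floor {y : ℝ} {n : ℕ} (hn : n ∈ Finset.Icc 1 ⌊y⌋₊) :
    (1 : ℝ) ≤ n ∧ (n : ℝ) ≤ y := by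
  rw [Finset.mem_Icc] at hn
  exact ⟨by exact_mod_cast hn.1, (Nat.le_floor_iff' (by omega)).1 hn.2⟩

theorem one_le_div_of_mem_Icc_floor {y : ℝ} {n : ℕ} (hn : n ∈ Finset.Icc 1 ⌊y⌋₊) :
    1 ≤ y / n := by
  obtain ⟨h1, h2⟩ := natCast_le_of_mem_Icc_floor hn
  rwa [le_div_iff₀ (by linarith), one_mul]

theorem one_le_one_add_log {y : ℝ} (hy : 1 ≤ y) : 1 ≤ 1 + Real.log y := by
  linarith [Real.log_nonneg hy]

theorem one_add_log_div_le {y : ℝ} {n : ℕ} (hn : n ∈ Finset.Icc 1 ⌊y⌋₊) :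
    1 + Real.log (y / n) ≤ 1 + Real.log y := by
  obtain ⟨h1, h2⟩ := natCast_le_of_mem_Icc_floor hn
  have : y / n ≤ y := div_le_self (by linarith) h1
  have h0 := one_le_div_of_mem_Icc_floor hn
  gcongr

theorem sum_divisorFun_succ (k : ℕ) (f : ℕ → ℝ) (y : ℝ) :
    ∑ n ∈ Finset.Icc 1 ⌊y⌋₊, (divisorFun (k + 1) n : ℝ) * f n
      = ∑ a ∈ Finset.Icc 1 ⌊y⌋₊, ∑ b ∈ Finset.Icc 1 ⌊y / a⌋₊,
          (divisorFun k b : ℝ) * f (a * b) := by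
  rw [← sum_Icc_floor_divisorsAntidiagonal fun a b => (divisorFun k b : ℝ) * f (a * b)]
  refine Finset.sum_congr rfl fun n _ => ?_
  rw [divisorFun_succ, Nat.cast_sum, Finset.sum_mul]
  refine Finset.sum_congr rfl fun p hp => ?_
  rw [(Nat.mem_divisorsAntidiagonal.1 hp).1]

theorem sum_divisorFun_div_le (k : ℕ) {y : ℝ} (hy : 1 ≤ y) :
    ∑ n ∈ Finset.Icc 1 ⌊y⌋₊, (divisorFun k n : ℝ) / n ≤ (1 + Real.log y) ^ k := by
  induction k generalizing y with
  | zero =>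
    rw [Finset.sum_eq_single 1]
    · simp [divisorFun_zero_left]
    · intro n _ hn
      simp [divisorFun_zero_left, hn]
    · intro h
      exact absurd (Finset.mem_Icc.2 ⟨le_rfl, (Nat.one_le_floor_iff y).2 hy⟩) h
  | succ k ih =>
    simp_rw [div_eq_mul_inv]
    rw [sum_divisorFun_succ k (fun n => (n : ℝ)⁻¹)]
    calc _ ≤ ∑ a ∈ Finset.Icc 1 ⌊y⌋₊, (1 / (a : ℝ)) * (1 + Real.log y) ^ k := by
          refine Finset.sum_le_sum fun a ha => ?_
          have h1 := ih (one_le_div_of_mem_Icc_floor ha)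
          have h2 := one_add_log_div_le ha
          have h3 := one_le_one_add_log (one_le_div_of_mem_Icc_floor ha)
          calc _ = (1 / (a : ℝ)) * ∑ b ∈ Finset.Icc 1 ⌊y / a⌋₊, (divisorFun k b : ℝ) / b := by
                rw [Finset.mul_sum]
                refine Finset.sum_congr rfl fun b _ => ?_
                push_cast
                rw [mul_inv]; ring
            _ ≤ (1 / (a : ℝ)) * (1 + Real.log (y / a)) ^ k := by gcongr
            _ ≤ _ := by gcongr
      _ ≤ (1 + Real.log y) ^ (k + 1) := by
          rw [← Finset.sum_mul, pow_succ, mul_comm]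
          have := one_le_one_add_log hy
          gcongr
          exact sum_inv_le_one_add_log hy

/-- Induction on the upper limit. The step is Bernoulli's inequality (1 - 1/(N+1))^κ ≤ 1 - κ/(N+1),
valid for κ ≤ 1. -/
theorem sum_rpow_sub_one_le {κ : ℝ} (hκ : 0 < κ) (hκ1 : κ ≤ 1) {y : ℝ} (hy : 0 ≤ y) :
    ∑ n ∈ Finset.Icc 1 ⌊y⌋₊, (n : ℝ) ^ (κ - 1) ≤ κ⁻¹ * y ^ κ := by
  have key : ∀ N : ℕ, ∑ n ∈ Finset.Icc 1 N, (n : ℝ) ^ (κ - 1) ≤ κ⁻¹ * (N : ℝ) ^ κ := by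
    intro N
    induction N with
    | zero => simp [Real.zero_rpow hκ.ne']
    | succ N ih =>
      rw [Finset.sum_Icc_succ_top (by omega)]
      have hN : (0 : ℝ) < ((N + 1 : ℕ) : ℝ) := by positivity
      have hb := rpow_one_add_le_one_add_mul_self (s := -(1 / ((N + 1 : ℕ) : ℝ)))
        (p := κ) (by
          rw [neg_le_neg_iff, div_le_one hN]
          push_cast; linarith [Nat.cast_nonneg (α := ℝ) N]) hκ.le hκ1
      have h1 : (1 + -(1 / ((N + 1 : ℕ) : ℝ))) = (N : ℝ) / ((N + 1 : ℕ) : ℝ) := by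
        field_simp; push_cast; ring
      rw [h1, Real.div_rpow (by positivity) hN.le, div_le_iff₀ (by positivity)] at hb
      have h2 : ((N + 1 : ℕ) : ℝ) ^ (κ - 1) = ((N + 1 : ℕ) : ℝ) ^ κ / ((N + 1 : ℕ) : ℝ) := by
        rw [Real.rpow_sub_one hN.ne']
      rw [h2]
      have h3 : κ⁻¹ * (N : ℝ) ^ κ ≤ κ⁻¹ * ((1 + κ * -(1 / ((N + 1 : ℕ) : ℝ)))
        * ((N + 1 : ℕ) : ℝ) ^ κ) := by gcongr
      calc _ ≤ _ := add_le_add_left (ih.trans h3) _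
        _ = _ := by field_simp; ring
  calc _ ≤ κ⁻¹ * (⌊y⌋₊ : ℝ) ^ κ := key _
    _ ≤ _ := by
      gcongr
      exact Nat.floor_le hy

theorem one_add_log_le_rpow {κ : ℝ} (hκ : 0 < κ) (hκ1 : κ ≤ 1) {y : ℝ} (hy : 1 ≤ y) :
    1 + Real.log y ≤ κ⁻¹ * y ^ κ := by
  have h := Real.add_one_le_exp (Real.log y * κ)
  rw [← Real.rpow_def_of_pos (by linarith)] at h
  rw [← div_eq_inv_mul, le_div_iff₀ hκ]
  nlinarith [Real.log_nonneg hy]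

/-- With κ > 0 the weight is concentrated near n = y, so one logarithm is saved against the sum of
d_k(n)/n. Every error term of the theorem gains its logarithm from this kind of saving or from a
power of x. The exponent is an integer so that k = 0 is included: there the sum is 1, and the bound
says that 1 + log y is at most y^κ/κ. -/
theorem sum_divisorFun_mul_rpow_le (k : ℕ) {κ : ℝ} (hκ : 0 < κ) (hκ1 : κ ≤ 1) {y : ℝ}
    (hy : 1 ≤ y) :
    ∑ n ∈ Finset.Icc 1 ⌊y⌋₊, (divisorFun k n : ℝ) * (n : ℝ) ^ (κ - 1)
      ≤ κ⁻¹ * y ^ κ * (1 + Real.log y) ^ ((k : ℤ) - 1) := by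
  have hL := one_le_one_add_log hy
  rcases k with _ | k
  · rw [Finset.sum_eq_single 1]
    · have := one_add_log_le_rpow hκ hκ1 hy
      simp only [divisorFun_one_right, Nat.cast_one, Real.one_rpow, mul_one, CharP.cast_eq_zero,
        zero_sub, zpow_neg, zpow_one]
      rwa [← div_eq_mul_inv, one_le_div (by linarith)]
    · intro n _ hn
      simp [divisorFun_zero_left, hn]
    · intro h
      exact absurd (Finset.mem_Icc.2 ⟨le_rfl, (Nat.one_le_floor_iff y).2 hy⟩) h
  · have hz : ((k + 1 : ℕ) : ℤ) - 1 = (k : ℤ) := by push_cast; ring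
    rw [hz, zpow_natCast]
    induction k generalizing y with
    | zero =>
      rw [pow_zero, mul_one]
      refine le_trans (le_of_eq ?_) (sum_rpow_sub_one_le hκ hκ1 (by linarith))
      refine Finset.sum_congr rfl fun n hn => ?_
      have : divisorFun (0 + 1) n = 1 := by
        rw [divisorFun_succ_divisors]
        simp only [divisorFun_zero_left]
        rw [Finset.sum_ite_eq' n.divisors 1]
        rw [Finset.mem_Icc] at hn
        simp; omega
      rw [this]; simp
    | succ k ih =>
      rw [sum_divisorFun_succ (k + 1) (fun n => (n : ℝ) ^ (κ - 1))]
      calc _ ≤ ∑ a ∈ Finset.Icc 1 ⌊y⌋₊, (1 / (a : ℝ)) * (κ⁻¹ * y ^ κ * (1 + Real.log y) ^ k) := by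
            refine Finset.sum_le_sum fun a ha => ?_
            have h0 := one_le_div_of_mem_Icc_floor ha
            have h1 := ih h0 (one_le_one_add_log h0) (by push_cast; ring)
            have h2 := one_add_log_div_le ha
            have h3 := one_le_one_add_log h0
            have ha1 := (natCast_le_of_mem_Icc_floor ha).1
            have ha0 : (0 : ℝ) < a := by linarith
            calc _ = (a : ℝ) ^ (κ - 1) * ∑ b ∈ Finset.Icc 1 ⌊y / a⌋₊,
                      (divisorFun (k + 1) b : ℝ) * (b : ℝ) ^ (κ - 1) := by
                  rw [Finset.mul_sum]
                  refine Finset.sum_congr rfl fun b _ => ?_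
                  push_cast
                  rw [Real.mul_rpow (by positivity) (by positivity)]; ring
              _ ≤ (a : ℝ) ^ (κ - 1) * (κ⁻¹ * (y / a) ^ κ * (1 + Real.log (y / a)) ^ k) := by
                  gcongr
              _ ≤ (a : ℝ) ^ (κ - 1) * (κ⁻¹ * (y / a) ^ κ * (1 + Real.log y) ^ k) := by
                  gcongr
              _ = _ := by
                  rw [Real.rpow_sub_one ha0.ne', Real.div_rpow (by linarith) ha0.le]
                  have : (a : ℝ) ^ κ ≠ 0 := by positivity
                  field_simp
        _ ≤ (1 + Real.log y) * (κ⁻¹ * y ^ κ * (1 + Real.log y) ^ k) := by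
            rw [← Finset.sum_mul]
            gcongr
            exact sum_inv_le_one_add_log hy
        _ = _ := by ring

/-! ### Gcd conditions by Möbius inversion, and harmonic sums under them -/

/-- Summation over the integers with a given gcd with `q`, reduced to a coprimality condition. -/
theorem sum_Icc_filter_gcd_eq {M : Type*} [AddCommMonoid M] (f : ℕ → M) (N : ℕ) {q g : ℕ}
    (hg : g ∣ q) (hg0 : 0 < g) :
    ∑ n ∈ Finset.Icc 1 N with n.gcd q = g, f n
      = ∑ n ∈ Finset.Icc 1 (N / g) with n.Coprime (q / g), f (g * n) := by
  have h1 : ∑ n ∈ Finset.Icc 1 N with n.gcd q = g, f n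
      = ∑ n ∈ Finset.Icc 1 N with g ∣ n, (if n.gcd q = g then f n else 0) := by
    rw [← Finset.sum_filter, Finset.filter_filter]
    refine Finset.sum_congr (Finset.filter_congr fun n _ => ?_) fun _ _ => rfl
    exact ⟨fun h => ⟨h ▸ Nat.gcd_dvd_left _ _, h⟩, fun h => h.2⟩
  rw [h1, sum_Icc_filter_dvd _ _ _ hg0, ← Finset.sum_filter]
  refine Finset.sum_congr (Finset.filter_congr fun n _ => ?_) fun _ _ => rfl
  conv_lhs => rw [← Nat.mul_div_cancel' hg, Nat.gcd_mul_left]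
  rw [Nat.coprime_iff_gcd_eq_one]
  constructor
  · intro h
    exact Nat.eq_of_mul_eq_mul_left hg0 (by rw [h, mul_one])
  · intro h
    rw [h, mul_one]

theorem sum_moebius_divisors_gcd {n s : ℕ} (hs : 0 < s) :
    ∑ δ ∈ s.divisors, (if δ ∣ n then (ArithmeticFunction.moebius δ : ℝ) else 0)
      = if n.Coprime s then 1 else 0 := by
  have h : ∑ δ ∈ (n.gcd s).divisors, (ArithmeticFunction.moebius δ : ℝ)
      = if n.gcd s = 1 then 1 else 0 := by
    have := congrArg (fun F : ArithmeticFunction ℤ => (F (n.gcd s) : ℝ))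
      ArithmeticFunction.moebius_mul_coe_zeta
    simp only [ArithmeticFunction.coe_mul_zeta_apply, ArithmeticFunction.one_apply] at this
    push_cast at this
    exact this
  rw [← Finset.sum_filter]
  have h' : (if n.Coprime s then (1 : ℝ) else 0) = if n.gcd s = 1 then 1 else 0 := by
    simp only [Nat.coprime_iff_gcd_eq_one]
  rw [h', ← h]
  refine Finset.sum_congr ?_ fun _ _ => rfl
  ext δ
  simp only [Finset.mem_filter, Nat.mem_divisors, Nat.dvd_gcd_iff]
  have : n.gcd s ≠ 0 := (Nat.gcd_pos_of_pos_right _ hs).ne'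
  constructor
  · rintro ⟨⟨h1, _⟩, h2⟩
    exact ⟨⟨h2, h1⟩, this⟩
  · rintro ⟨⟨h1, h2⟩, _⟩
    exact ⟨⟨h2, hs.ne'⟩, h1⟩

/-- Möbius inversion of a coprimality condition in a sum. -/
theorem sum_Icc_filter_coprime (f : ℕ → ℝ) (N : ℕ) {s : ℕ} (hs : 0 < s) :
    ∑ n ∈ Finset.Icc 1 N with n.Coprime s, f n
      = ∑ δ ∈ s.divisors, (ArithmeticFunction.moebius δ : ℝ) *
          ∑ b ∈ Finset.Icc 1 (N / δ), f (δ * b) := by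
  calc _ = ∑ n ∈ Finset.Icc 1 N, ∑ δ ∈ s.divisors,
        (if δ ∣ n then (ArithmeticFunction.moebius δ : ℝ) else 0) * f n := by
        rw [Finset.sum_filter]
        refine Finset.sum_congr rfl fun n _ => ?_
        rw [← Finset.sum_mul, sum_moebius_divisors_gcd hs]
        split_ifs <;> simp
    _ = _ := by
        rw [Finset.sum_comm]
        refine Finset.sum_congr rfl fun δ hδ => ?_
        rw [← sum_Icc_filter_dvd f N δ (Nat.pos_of_mem_divisors hδ), Finset.mul_sum,
          Finset.sum_filter]
        refine Finset.sum_congr rfl fun n _ => ?_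
        split_ifs <;> simp

theorem sum_moebius_div (s : ℕ) (hs : 0 < s) :
    ∑ δ ∈ s.divisors, (ArithmeticFunction.moebius δ : ℝ) / δ = (s.totient : ℝ) / s := by
  have h := (ArithmeticFunction.sum_eq_iff_sum_mul_moebius_eq
    (f := fun n => (n.totient : ℝ)) (g := fun n => (n : ℝ))).1
    (fun n _ => by exact_mod_cast Nat.sum_totient n) s hs
  rw [← h, Nat.sum_divisorsAntidiagonal (fun a b => (ArithmeticFunction.moebius a : ℝ) * (b : ℝ)),
    Finset.sum_div]
  refine Finset.sum_congr rfl fun δ hδ => ?_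
  have h1 := Nat.pos_of_mem_divisors hδ
  have hs0 : (s : ℝ) ≠ 0 := by positivity
  have h2 : (δ : ℝ) ≠ 0 := by positivity
  rw [Nat.cast_div (Nat.dvd_of_mem_divisors hδ) h2]
  field_simp

theorem abs_moebius_cast_le_one (n : ℕ) : |(ArithmeticFunction.moebius n : ℝ)| ≤ 1 := by
  exact_mod_cast ArithmeticFunction.abs_moebius_le_one

/-- The case t > y is included: the sum is then empty and log y ≤ log t. This frees the next
estimate of any condition relating e and y. -/
theorem abs_sum_inv_sub_log_le {y t : ℝ} (hy : 1 ≤ y) (ht : 1 ≤ t) :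
    |∑ n ∈ Finset.Icc 1 ⌊y / t⌋₊, (1 : ℝ) / n - Real.log y| ≤ 1 + Real.log t := by
  have hl := Real.log_div (x := y) (y := t) (by linarith) (by linarith)
  have hlt := Real.log_nonneg ht
  have hly := Real.log_nonneg hy
  have hyt : 0 ≤ y / t := by positivity
  rcases le_or_gt 1 (y / t) with h | h
  · have h1 := sum_inv_le_one_add_log h
    have h2 := log_le_harmonic_floor (y / t) hyt
    rw [harmonic_eq_sum_Icc] at h2
    push_cast at h2
    simp only [one_div] at h1 ⊢
    rw [abs_le]
    constructor <;> linarith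
  · rw [Nat.floor_eq_zero.2 h]
    have : Real.log (y / t) ≤ 0 := Real.log_nonpos hyt h.le
    simp only [zero_lt_one, Finset.Icc_eq_empty_of_lt, Finset.sum_empty, zero_sub, abs_neg]
    rw [abs_of_nonneg hly]
    linarith

/-- Put g = e/r. The n in question are g times the integers prime to r, and Möbius inversion over δ
∣ r gives harmonic sums up to y/(gδ) with weight 1/(gδ). Replacing each by log y costs at most 1 +
log(gδ). The factor 1/g = r/e is kept in the error, since it provides the decay in e. -/
theorem abs_sum_inv_gcd_sub_le {e r : ℕ} (he : 0 < e) (hr : r ∣ e) {y : ℝ} (hy : 1 ≤ y) :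
    |∑ n ∈ Finset.Icc 1 ⌊y⌋₊ with n.gcd e = e / r, (1 : ℝ) / n
        - (r.totient : ℝ) / e * Real.log y|
      ≤ (r : ℝ) / e * (e.divisors.card * (1 + Real.log e)) := by
  obtain ⟨g, rfl⟩ := hr
  have hr0 : 0 < r := Nat.pos_of_mul_pos_right he
  have hg0 : 0 < g := Nat.pos_of_mul_pos_left he
  have hr' : (0 : ℝ) < r := by exact_mod_cast hr0
  have hg' : (0 : ℝ) < g := by exact_mod_cast hg0
  rw [Nat.mul_div_cancel_left _ hr0, sum_Icc_filter_gcd_eq _ _ (dvd_mul_left _ _) hg0,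
    Nat.mul_div_cancel _ hg0, sum_Icc_filter_coprime _ _ hr0]
  have hmain : ((r.totient : ℝ) / (r * g : ℕ)) * Real.log y
      = ∑ δ ∈ r.divisors, (ArithmeticFunction.moebius δ : ℝ) * (1 / (g * δ) * Real.log y) := by
    have := sum_moebius_div r hr0
    calc _ = (1 / g) * ((r.totient : ℝ) / r) * Real.log y := by push_cast; field_simp
      _ = _ := by
        rw [← this, Finset.mul_sum, Finset.sum_mul]
        refine Finset.sum_congr rfl fun δ hδ => ?_
        have := Nat.pos_of_mem_divisors hδ
        field_simp
  rw [hmain, ← Finset.sum_sub_distrib]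
  have hterm : ∀ δ ∈ r.divisors, |(ArithmeticFunction.moebius δ : ℝ) *
      ∑ b ∈ Finset.Icc 1 (⌊y⌋₊ / g / δ), 1 / ((g * (δ * b) : ℕ) : ℝ)
        - (ArithmeticFunction.moebius δ : ℝ) * (1 / (g * δ) * Real.log y)|
      ≤ 1 / g * (1 + Real.log (r * g : ℕ)) := by
    intro δ hδ
    have hδ0 := Nat.pos_of_mem_divisors hδ
    have hδ' : (1 : ℝ) ≤ δ := by exact_mod_cast hδ0
    have hg1 : (1 : ℝ) ≤ g := by exact_mod_cast hg0
    have hδr : (δ : ℝ) ≤ r := by exact_mod_cast Nat.le_of_dvd hr0 (Nat.dvd_of_mem_divisors hδ)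
    have hfl : ⌊y⌋₊ / g / δ = ⌊y / ((g : ℝ) * δ)⌋₊ := by
      rw [← Nat.floor_div_natCast, ← Nat.floor_div_natCast, div_div]
    have h1 : (1 : ℝ) ≤ (g : ℝ) * δ := one_le_mul_of_one_le_of_one_le hg1 hδ'
    have h2 := abs_sum_inv_sub_log_le hy h1
    have h3 : Real.log ((g : ℝ) * δ) ≤ Real.log (r * g : ℕ) := by
      apply Real.log_le_log (by positivity)
      push_cast
      rw [mul_comm (r : ℝ)]
      gcongr
    rw [hfl, ← mul_sub, abs_mul]
    have h4 : ∑ b ∈ Finset.Icc 1 ⌊y / ((g : ℝ) * δ)⌋₊, 1 / ((g * (δ * b) : ℕ) : ℝ)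
        - 1 / (g * δ) * Real.log y = 1 / (g * δ) *
          (∑ b ∈ Finset.Icc 1 ⌊y / ((g : ℝ) * δ)⌋₊, (1 : ℝ) / b - Real.log y) := by
      rw [mul_sub, Finset.mul_sum]
      congr 1
      refine Finset.sum_congr rfl fun b _ => ?_
      push_cast
      rw [← mul_assoc, ← one_div_mul_one_div]
    rw [h4, abs_mul (1 / ((g : ℝ) * δ)), abs_of_nonneg (a := 1 / ((g : ℝ) * δ)) (by positivity)]
    have h5 : 1 / ((g : ℝ) * δ) ≤ 1 / g := by
      apply one_div_le_one_div_of_le hg'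
      nlinarith
    calc _ ≤ 1 * (1 / g * (1 + Real.log (r * g : ℕ))) := by
          gcongr
          · exact abs_moebius_cast_le_one _
          · linarith
      _ = _ := one_mul _
  refine (Finset.abs_sum_le_sum_abs _ _).trans ((Finset.sum_le_sum hterm).trans ?_)
  rw [Finset.sum_const, nsmul_eq_mul]
  have h6 : (r.divisors.card : ℝ) ≤ (r * g).divisors.card := by
    exact_mod_cast Finset.card_le_card (Nat.divisors_subset_of_dvd he.ne' (dvd_mul_right _ _))
  have h7 : 0 ≤ 1 + Real.log (r * g : ℕ) := by
    have := Real.log_natCast_nonneg (r * g)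
    linarith
  have h8 : (r : ℝ) / (r * g : ℕ) = 1 / g := by push_cast; field_simp
  rw [h8]
  calc _ = 1 / (g : ℝ) * (r.divisors.card * (1 + Real.log (r * g : ℕ))) := by ring
    _ ≤ _ := by gcongr

/-! ### Partial summation against powers of a logarithm -/

theorem hasDerivAt_log_const_div {y t : ℝ} (hy : y ≠ 0) (ht : t ≠ 0) :
    HasDerivAt (fun t => Real.log (y / t)) (-(1 / t)) t := by
  have h2 : HasDerivAt (fun t : ℝ => y / t) (-y / t ^ 2) t := by
    simpa using (hasDerivAt_const t y).fun_div (hasDerivAt_id' t) ht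
  convert h2.log (div_ne_zero hy ht) using 1
  field_simp

/-- Partial summation against a power of `log (y / n)`. -/
theorem abs_sum_mul_log_pow_sub_le {a : ℕ → ℝ} {α F : ℝ}
    (h : ∀ t : ℝ, 1 ≤ t → |∑ n ∈ Finset.Icc 1 ⌊t⌋₊, a n - α * Real.log t| ≤ F) (m : ℕ) {y : ℝ}
    (hy : 1 ≤ y) :
    |∑ n ∈ Finset.Icc 1 ⌊y⌋₊, a n * Real.log (y / n) ^ m
        - α * Real.log y ^ (m + 1) / (m + 1)| ≤ F * Real.log y ^ m := by
  rcases m with _ | m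
  · simpa using h y hy
  have hy0 : 0 < y := by linarith
  have hly := Real.log_nonneg hy
  -- As f(y) = 0, Abel summation leaves only the integral of -f' times the partial sums. As f
  -- decreases, an error F in the partial sums costs F times the integral of -f', that is F·f(1),
  -- with no extra logarithm.
  set f : ℝ → ℝ := fun t => Real.log (y / t) ^ (m + 1) with hf
  set f' : ℝ → ℝ := fun t => -((m + 1) * Real.log (y / t) ^ m / t) with hf'
  have hder : ∀ t ∈ Set.Icc (1 : ℝ) y, HasDerivAt f (f' t) t := by
    intro t ht
    have ht0 : t ≠ 0 := by linarith [ht.1]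
    have h1 := hasDerivAt_log_const_div hy0.ne' ht0
    refine (h1.fun_pow (m + 1)).congr_deriv ?_
    simp only [hf', Nat.add_sub_cancel]
    push_cast
    ring
  have hcont : ContinuousOn f' (Set.Icc 1 y) := by
    have hne : ∀ t ∈ Set.Icc (1 : ℝ) y, t ≠ 0 := fun t ht => by linarith [ht.1]
    have : ContinuousOn (fun t : ℝ => Real.log (y / t)) (Set.Icc 1 y) := by
      apply ContinuousOn.log
      · exact continuousOn_const.div continuousOn_id hne
      · intro t ht
        exact div_ne_zero hy0.ne' (hne t ht)
    exact (((continuousOn_const.mul (this.pow m)).div continuousOn_id hne)).neg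
  have hderiv : ∀ t ∈ Set.Icc (1 : ℝ) y, deriv f t = f' t := fun t ht => (hder t ht).deriv
  have hint' : MeasureTheory.IntegrableOn f' (Set.Icc 1 y) :=
    hcont.integrableOn_compact isCompact_Icc
  have hint : MeasureTheory.IntegrableOn (deriv f) (Set.Icc 1 y) :=
    hint'.congr_fun (fun t ht => (hderiv t ht).symm) measurableSet_Icc
  set c : ℕ → ℝ := fun n => if n = 0 then 0 else a n with hc
  have hcsum : ∀ N : ℕ, ∑ k ∈ Finset.Icc 0 N, c k = ∑ k ∈ Finset.Icc 1 N, a k := by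
    intro N
    rw [← Finset.add_sum_Ioc_eq_sum_Icc (Nat.zero_le N)]
    simp only [hc, if_true, zero_add]
    refine Finset.sum_congr rfl fun n hn => ?_
    rw [if_neg]
    have := (Finset.mem_Ioc.1 hn).1
    omega
  have habel := sum_mul_eq_sub_integral_mul₀ (f := f) c (by simp [hc]) y
    (fun t ht => (hder t ht).differentiableAt) hint
  have hfy : f y = 0 := by simp [hf, div_self hy0.ne']
  have hlhs : ∑ k ∈ Finset.Icc 0 ⌊y⌋₊, f k * c k
      = ∑ n ∈ Finset.Icc 1 ⌊y⌋₊, a n * Real.log (y / n) ^ (m + 1) := by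
    rw [← Finset.add_sum_Ioc_eq_sum_Icc (Nat.zero_le _)]
    simp only [hc, if_true, mul_zero, zero_add, hf]
    refine Finset.sum_congr rfl fun n hn => ?_
    rw [if_neg, mul_comm]
    have := (Finset.mem_Ioc.1 hn).1
    omega
  rw [hlhs, hfy, zero_mul, zero_sub] at habel
  simp only [hcsum] at habel
  have hcongr : ∫ t in Set.Ioc 1 y, deriv f t * ∑ k ∈ Finset.Icc 1 ⌊t⌋₊, a k
      = ∫ t in Set.Ioc 1 y, f' t * ∑ k ∈ Finset.Icc 1 ⌊t⌋₊, a k := by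
    apply MeasureTheory.setIntegral_congr_fun measurableSet_Ioc
    intro t ht
    simp only
    rw [hderiv t (Set.Ioc_subset_Icc_self ht)]
  rw [hcongr] at habel
  have hI1 : MeasureTheory.IntegrableOn (fun t => f' t * ∑ k ∈ Finset.Icc 1 ⌊t⌋₊, a k)
      (Set.Ioc 1 y) :=
    (integrableOn_mul_sum_Icc a zero_le_one hint').mono_set Set.Ioc_subset_Icc_self
  have hcont2 : ContinuousOn (fun t => f' t * (α * Real.log t)) (Set.Icc 1 y) := by
    apply hcont.mul
    apply continuousOn_const.mul
    apply Real.continuousOn_log.mono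
    intro t ht
    simp only [Set.mem_compl_iff, Set.mem_singleton_iff]
    linarith [ht.1]
  have hI2 : MeasureTheory.IntegrableOn (fun t => f' t * (α * Real.log t)) (Set.Ioc 1 y) :=
    (hcont2.integrableOn_compact isCompact_Icc).mono_set Set.Ioc_subset_Icc_self
  have hftc : ∫ t in Set.Ioc 1 y, f' t * (α * Real.log t)
      = -(α * Real.log y ^ (m + 2) / (m + 2)) := by
    rw [← intervalIntegral.integral_of_le hy]
    -- The antiderivative comes from writing log t = log y - log(y/t), after which the integrand is
    -- a polynomial in log(y/t) divided by t.
    have := intervalIntegral.integral_eq_sub_of_hasDerivAt (a := 1) (b := y)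
      (f := fun t => α * (Real.log y * Real.log (y / t) ^ (m + 1)
        - (m + 1) * Real.log (y / t) ^ (m + 2) / (m + 2)))
      (f' := fun t => f' t * (α * Real.log t)) ?_ ?_
    · rw [this]
      simp only [div_self hy0.ne', Real.log_one, div_one]
      have : ((m : ℝ) + 2) ≠ 0 := by positivity
      simp
      field_simp
      ring
    · intro t ht
      rw [Set.uIcc_of_le hy] at ht
      have ht0 : t ≠ 0 := by linarith [ht.1]
      have hl : Real.log t = Real.log y - Real.log (y / t) := by
        rw [Real.log_div hy0.ne' ht0]; ring
      have h1 := hasDerivAt_log_const_div hy0.ne' ht0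
      refine ((((h1.fun_pow (m + 1)).const_mul (Real.log y)).fun_sub
        (((h1.fun_pow (m + 2)).const_mul ((m : ℝ) + 1)).div_const ((m : ℝ) + 2))).const_mul α).congr_deriv ?_
      simp only [hf', hl]
      have : ((m : ℝ) + 2) ≠ 0 := by positivity
      push_cast
      field_simp
      ring
    · apply ContinuousOn.intervalIntegrable
      rwa [Set.uIcc_of_le hy]
  have hftc2 : ∫ t in Set.Ioc 1 y, F * -f' t = F * Real.log y ^ (m + 1) := by
    rw [← intervalIntegral.integral_of_le hy, intervalIntegral.integral_const_mul,
      intervalIntegral.integral_neg,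
      intervalIntegral.integral_eq_sub_of_hasDerivAt (f := f) (by
        intro t ht
        rw [Set.uIcc_of_le hy] at ht
        exact hder t ht) (by
        apply ContinuousOn.intervalIntegrable
        rwa [Set.uIcc_of_le hy]), hfy]
    simp [hf]
  rw [habel]
  have hcast : ((m + 1 : ℕ) : ℝ) + 1 = (m : ℝ) + 2 := by push_cast; ring
  have hexp : m + 1 + 1 = m + 2 := rfl
  rw [hcast, hexp]
  have hsub : -(∫ t in Set.Ioc 1 y, f' t * ∑ k ∈ Finset.Icc 1 ⌊t⌋₊, a k)
      - α * Real.log y ^ (m + 2) / (m + 2)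
      = -(∫ t in Set.Ioc 1 y, (f' t * ∑ k ∈ Finset.Icc 1 ⌊t⌋₊, a k
          - f' t * (α * Real.log t))) := by
    rw [MeasureTheory.integral_sub hI1 hI2, hftc]
    ring
  rw [hsub, abs_neg, ← hftc2, ← Real.norm_eq_abs]
  apply MeasureTheory.norm_integral_le_of_norm_le
  · exact ((hint'.neg).const_mul F).mono_measure
      (MeasureTheory.Measure.restrict_mono Set.Ioc_subset_Icc_self le_rfl)
  · rw [MeasureTheory.ae_restrict_iff' measurableSet_Ioc]
    filter_upwards with t ht
    have ht0 : 0 < t := by linarith [ht.1]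
    have hlt : 0 ≤ Real.log (y / t) :=
      Real.log_nonneg (by rw [le_div_iff₀ ht0]; linarith [ht.2])
    have hfn : 0 ≤ -f' t := by
      simp only [hf', neg_neg]
      positivity
    rw [← mul_sub, norm_mul, Real.norm_eq_abs, Real.norm_eq_abs, abs_of_nonpos (by linarith),
      mul_comm F]
    gcongr
    exact h t ht.1.le

/-! ### The weight d_j(n)/n on the multiples of e -/

/-- `∑ d_j(n)/n` over the multiples `n ≤ y` of `e`. -/
noncomputable def multipleSum (j : ℕ) (y : ℝ) (e : ℕ) : ℝ :=
  ∑ n ∈ Finset.Icc 1 ⌊y⌋₊, (divisorFun j n : ℝ) * (if e ∣ n then (n : ℝ)⁻¹ else 0)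

/-- The density of the multiples of `e` for the weight `d_j(n)/n`. -/
noncomputable def multipleDensity : ℕ → ℕ → ℝ
  | 0, e => if e = 1 then 1 else 0
  | j + 1, e => (∑ r ∈ e.divisors, (r.totient : ℝ) * multipleDensity j r) / e

theorem multipleDensity_nonneg (j e : ℕ) : 0 ≤ multipleDensity j e := by
  induction j generalizing e with
  | zero => simp only [multipleDensity]; split_ifs <;> norm_num
  | succ j ih =>
    simp only [multipleDensity]
    exact div_nonneg (Finset.sum_nonneg fun r _ => mul_nonneg (by positivity) (ih r))
      (by positivity)

theorem dvd_mul_iff_div_gcd_dvd {e a b : ℕ} (he : 0 < e) :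
    e ∣ a * b ↔ e / a.gcd e ∣ b := by
  have hg : 0 < a.gcd e := Nat.gcd_pos_of_pos_right _ he
  have h1 : e = a.gcd e * (e / a.gcd e) := (Nat.mul_div_cancel' (Nat.gcd_dvd_right a e)).symm
  have h2 : a = a.gcd e * (a / a.gcd e) := (Nat.mul_div_cancel' (Nat.gcd_dvd_left a e)).symm
  have hco : Nat.Coprime (e / a.gcd e) (a / a.gcd e) :=
    (Nat.coprime_div_gcd_div_gcd hg).symm
  constructor
  · intro h
    rw [h2] at h
    conv at h => lhs; rw [h1]
    rw [mul_assoc] at h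
    exact hco.dvd_of_dvd_mul_left (Nat.dvd_of_mul_dvd_mul_left hg h)
  · intro h
    calc e = a.gcd e * (e / a.gcd e) := h1
      _ ∣ a * b := mul_dvd_mul (Nat.gcd_dvd_left a e) h

/-- Split n = ab with weight d_j(b): the condition e ∣ ab amounts to r ∣ b for r = e/(a, e). Sorting
by r isolates a sum over (a, e) = e/r, of density φ(r)/e, which is where the recursion for
`multipleDensity` comes from. -/
theorem multipleSum_succ (j : ℕ) (y : ℝ) {e : ℕ} (he : 0 < e) :
    multipleSum (j + 1) y e = ∑ r ∈ e.divisors,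
      ∑ n ∈ Finset.Icc 1 ⌊y⌋₊, (if n.gcd e = e / r then (1 : ℝ) / n else 0)
        * multipleSum j (y / n) r := by
  have h1 : multipleSum (j + 1) y e
      = ∑ n ∈ Finset.Icc 1 ⌊y⌋₊, (1 : ℝ) / n * multipleSum j (y / n) (e / n.gcd e) := by
    unfold multipleSum
    rw [sum_divisorFun_succ j (fun n => if e ∣ n then (n : ℝ)⁻¹ else 0)]
    refine Finset.sum_congr rfl fun a _ => ?_
    rw [Finset.mul_sum]
    refine Finset.sum_congr rfl fun b _ => ?_
    simp only [dvd_mul_iff_div_gcd_dvd he]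
    split_ifs
    · push_cast; rw [mul_inv]; ring
    · simp
  rw [h1, Finset.sum_comm]
  refine Finset.sum_congr rfl fun n _ => ?_
  have hd : n.gcd e ∣ e := Nat.gcd_dvd_right n e
  rw [Finset.sum_eq_single (e / n.gcd e)]
  · rw [if_pos (Nat.div_div_self hd he.ne').symm]
  · intro r hr hne
    rw [if_neg, zero_mul]
    intro h
    apply hne
    rw [h, Nat.div_div_self (Nat.dvd_of_mem_divisors hr) he.ne']
  · intro h
    exact absurd (Nat.mem_divisors.2 ⟨Nat.div_dvd_of_dvd hd, he.ne'⟩) h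

theorem multipleSum_nonneg (j : ℕ) (y : ℝ) (e : ℕ) : 0 ≤ multipleSum j y e := by
  unfold multipleSum
  refine Finset.sum_nonneg fun n _ => mul_nonneg (by positivity) ?_
  split_ifs <;> positivity

theorem multipleSum_zero {y : ℝ} (hy : 1 ≤ y) (e : ℕ) :
    multipleSum 0 y e = multipleDensity 0 e := by
  unfold multipleSum
  rw [Finset.sum_eq_single 1]
  · simp [divisorFun_one_right, multipleDensity]
  · intro n _ hn
    simp [divisorFun_zero_left, hn]
  · intro h
    exact absurd (Finset.mem_Icc.2 ⟨le_rfl, (Nat.one_le_floor_iff y).2 hy⟩) h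

/-- One step of the recursion for `multipleSum`, with error terms. -/
theorem abs_sum_mul_sub_le_of_log_pow {a : ℕ → ℝ} {B : ℝ → ℝ} {α F κ E : ℝ} {j : ℕ}
    (ha : ∀ n, 0 ≤ a n) (hF : 0 ≤ F) (hαF : α ≤ F) (hκ : 0 ≤ κ) (hκE : κ ≤ E)
    (hA : ∀ t : ℝ, 1 ≤ t → |∑ n ∈ Finset.Icc 1 ⌊t⌋₊, a n - α * Real.log t| ≤ F)
    (hB : ∀ t : ℝ, 1 ≤ t → |B t - κ * Real.log t ^ j / j.factorial|
      ≤ j * E * (1 + Real.log t) ^ (j - 1)) {y : ℝ} (hy : 1 ≤ y) :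
    |∑ n ∈ Finset.Icc 1 ⌊y⌋₊, a n * B (y / n)
        - α * κ * Real.log y ^ (j + 1) / (j + 1).factorial|
      ≤ (j + 1) * (E * F) * (1 + Real.log y) ^ j := by
  have hE : 0 ≤ E := hκ.trans hκE
  have hl := Real.log_nonneg hy
  have hL := one_le_one_add_log hy
  have hjf : (1 : ℝ) ≤ j.factorial := by exact_mod_cast Nat.one_le_iff_ne_zero.2 (Nat.factorial_ne_zero j)
  have h1 := abs_sum_mul_log_pow_sub_le hA j hy
  -- The main term of B is summed against a by partial summation; the remainder of B is bounded
  -- termwise with the total mass of a.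
  have hsplit : ∑ n ∈ Finset.Icc 1 ⌊y⌋₊, a n * B (y / n)
        - α * κ * Real.log y ^ (j + 1) / (j + 1).factorial
      = κ / j.factorial * (∑ n ∈ Finset.Icc 1 ⌊y⌋₊, a n * Real.log (y / n) ^ j
          - α * Real.log y ^ (j + 1) / (j + 1))
        + ∑ n ∈ Finset.Icc 1 ⌊y⌋₊,
            a n * (B (y / n) - κ * Real.log (y / n) ^ j / j.factorial) := by
    simp only [mul_sub, Finset.sum_sub_distrib, Finset.mul_sum]
    rw [Nat.factorial_succ]
    have : ∑ n ∈ Finset.Icc 1 ⌊y⌋₊, a n * (κ * Real.log (y / n) ^ j / j.factorial)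
        = ∑ n ∈ Finset.Icc 1 ⌊y⌋₊, κ / j.factorial * (a n * Real.log (y / n) ^ j) :=
      Finset.sum_congr rfl fun n _ => by ring
    rw [this]
    push_cast
    have h0 : (j : ℝ) + 1 ≠ 0 := by positivity
    have h00 : (j.factorial : ℝ) ≠ 0 := by positivity
    field_simp
    ring
  rw [hsplit]
  have hκj : κ / j.factorial ≤ E := (div_le_self hκ hjf).trans hκE
  have e1 : |κ / j.factorial * (∑ n ∈ Finset.Icc 1 ⌊y⌋₊, a n * Real.log (y / n) ^ j
          - α * Real.log y ^ (j + 1) / (j + 1))| ≤ E * (F * (1 + Real.log y) ^ j) := by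
    rw [abs_mul, abs_of_nonneg (by positivity : 0 ≤ κ / j.factorial)]
    gcongr
    refine h1.trans ?_
    gcongr
    linarith
  have hAy : ∑ n ∈ Finset.Icc 1 ⌊y⌋₊, a n ≤ F * (1 + Real.log y) := by
    have h2 := (abs_le.1 (hA y hy)).2
    have h3 : α * Real.log y ≤ F * Real.log y := by gcongr
    linarith
  have e2 : |∑ n ∈ Finset.Icc 1 ⌊y⌋₊, a n * (B (y / n) - κ * Real.log (y / n) ^ j / j.factorial)|
      ≤ j * E * F * (1 + Real.log y) ^ j := by
    calc _ ≤ ∑ n ∈ Finset.Icc 1 ⌊y⌋₊, a n * (j * E * (1 + Real.log y) ^ (j - 1)) := by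
          refine (Finset.abs_sum_le_sum_abs _ _).trans (Finset.sum_le_sum fun n hn => ?_)
          rw [abs_mul, abs_of_nonneg (ha n)]
          have h2 := one_le_div_of_mem_Icc_floor hn
          have h3 := one_le_one_add_log h2
          have h4 := one_add_log_div_le hn
          gcongr
          · exact ha n
          · exact (hB _ h2).trans (by gcongr)
      _ = (∑ n ∈ Finset.Icc 1 ⌊y⌋₊, a n) * (j * E * (1 + Real.log y) ^ (j - 1)) := by
          rw [Finset.sum_mul]
      _ ≤ F * (1 + Real.log y) * (j * E * (1 + Real.log y) ^ (j - 1)) := by gcongr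
      _ = j * E * F * (1 + Real.log y) ^ j := by
          -- For j = 0 the truncated exponent j - 1 does no harm, because the factor j makes both
          -- sides vanish.
          rcases j with _ | j
          · simp
          · rw [Nat.add_sub_cancel, pow_succ]; ring
  calc _ ≤ _ := abs_add_le _ _
    _ ≤ E * (F * (1 + Real.log y) ^ j) + j * E * F * (1 + Real.log y) ^ j := add_le_add e1 e2
    _ = _ := by ring

/-- Induction on j by `multipleSum_succ`, with one convolution step for each r ∣ e. The decay
e^(η-1), in both the density and the error, makes the later sum over e converge absolutely. The
factor j records that the case j = 0 is exact. -/
theorem multipleSum_asymptotic (j : ℕ) {η : ℝ} (hη : 0 < η) :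
    ∃ C : ℝ, 1 ≤ C ∧ ∀ e : ℕ, 0 < e → multipleDensity j e ≤ C * (e : ℝ) ^ (η - 1) ∧
      ∀ y : ℝ, 1 ≤ y →
        |multipleSum j y e - multipleDensity j e * Real.log y ^ j / j.factorial|
          ≤ j * (C * (e : ℝ) ^ (η - 1)) * (1 + Real.log y) ^ (j - 1) := by
  induction j generalizing η with
  | zero =>
    refine ⟨1, le_rfl, fun e he => ⟨?_, fun y hy => ?_⟩⟩
    · simp only [multipleDensity]
      split_ifs with h
      · simp [h]
      · positivity
    · rw [multipleSum_zero hy]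
      simp
  | succ j ih =>
    -- Four factors e^ε accumulate: one from the induction hypothesis, two from the divisor function
    -- and one from log e.
    set ε := min (η / 4) 1 with hε
    have hε0 : 0 < ε := by positivity
    have hε1 : ε ≤ 1 := min_le_right _ _
    have hεη : 4 * ε ≤ η := by linarith [min_le_left (η / 4) 1]
    obtain ⟨C, hC, hCe⟩ := ih hε0
    obtain ⟨D, hD, hDe⟩ := card_divisors_le_rpow hε0
    have hεi : 1 ≤ ε⁻¹ := (one_le_inv₀ hε0).2 hε1
    refine ⟨C * (D * D * ε⁻¹), one_le_mul_of_one_le_of_one_le hC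
      (one_le_mul_of_one_le_of_one_le (one_le_mul_of_one_le_of_one_le hD hD) hεi),
      fun e he => ?_⟩
    have he1 : (1 : ℝ) ≤ e := by exact_mod_cast he
    have he0 : (0 : ℝ) < e := by linarith
    have hτ := hDe e he
    have hlog := one_add_log_le_rpow hε0 hε1 he1
    have hL1 := one_le_one_add_log he1
    have hrle : ∀ r ∈ e.divisors, (0 : ℝ) < r ∧ (r : ℝ) ^ ε ≤ (e : ℝ) ^ ε := by
      intro r hr
      have h1 := Nat.pos_of_mem_divisors hr
      have h2 := Nat.divisor_le hr
      refine ⟨by exact_mod_cast h1, ?_⟩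
      gcongr
    have htot : (e.divisors.card : ℝ) * (C * (e : ℝ) ^ (ε - 1) *
        (e.divisors.card * (1 + Real.log e))) ≤ C * (D * D * ε⁻¹) * (e : ℝ) ^ (η - 1) := by
      calc _ ≤ (D * (e : ℝ) ^ ε) * (C * (e : ℝ) ^ (ε - 1) *
            ((D * (e : ℝ) ^ ε) * (ε⁻¹ * (e : ℝ) ^ ε))) := by gcongr
        _ = C * (D * D * ε⁻¹) * ((e : ℝ) ^ ε * (e : ℝ) ^ (ε - 1) * (e : ℝ) ^ ε * (e : ℝ) ^ ε) := by
            ring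
        _ = C * (D * D * ε⁻¹) * (e : ℝ) ^ (4 * ε - 1) := by
            rw [← Real.rpow_add he0, ← Real.rpow_add he0, ← Real.rpow_add he0]
            ring_nf
        _ ≤ _ := by
            gcongr
    have hτ1 : (1 : ℝ) ≤ e.divisors.card := by
      exact_mod_cast Finset.card_pos.2 ⟨1, Nat.one_mem_divisors.2 he.ne'⟩
    constructor
    · simp only [multipleDensity]
      rw [div_le_iff₀ he0]
      calc _ ≤ ∑ r ∈ e.divisors, C * (e : ℝ) ^ ε := by
            refine Finset.sum_le_sum fun r hr => ?_
            obtain ⟨hr0, hr1⟩ := hrle r hr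
            calc (r.totient : ℝ) * multipleDensity j r ≤ r * (C * (r : ℝ) ^ (ε - 1)) := by
                  gcongr
                  · exact multipleDensity_nonneg _ _
                  · exact_mod_cast Nat.totient_le r
                  · exact (hCe r (Nat.pos_of_mem_divisors hr)).1
              _ = C * (r : ℝ) ^ ε := by
                  rw [Real.rpow_sub_one hr0.ne']
                  field_simp
              _ ≤ _ := by gcongr
        _ = e.divisors.card * (C * (e : ℝ) ^ (ε - 1) * 1) * e := by
            rw [Finset.sum_const, nsmul_eq_mul, Real.rpow_sub_one he0.ne']
            field_simp
        _ ≤ (e.divisors.card * (C * (e : ℝ) ^ (ε - 1) *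
              (e.divisors.card * (1 + Real.log e)))) * e := by
            gcongr
            exact one_le_mul_of_one_le_of_one_le hτ1 hL1
        _ ≤ _ := by gcongr
    · intro y hy
      rw [multipleSum_succ j y he]
      have hK : multipleDensity (j + 1) e * Real.log y ^ (j + 1) / (j + 1).factorial
          = ∑ r ∈ e.divisors, (r.totient : ℝ) / e * multipleDensity j r
              * Real.log y ^ (j + 1) / (j + 1).factorial := by
        simp only [multipleDensity]
        rw [Finset.sum_div, Finset.sum_mul, Finset.sum_div]
        refine Finset.sum_congr rfl fun r _ => ?_
        ring
      rw [hK, ← Finset.sum_sub_distrib]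
      have hLy := one_le_one_add_log hy
      calc _ ≤ ∑ r ∈ e.divisors, ((j : ℝ) + 1) * (C * (e : ℝ) ^ (ε - 1) *
              (e.divisors.card * (1 + Real.log e))) * (1 + Real.log y) ^ j := by
            refine (Finset.abs_sum_le_sum_abs _ _).trans (Finset.sum_le_sum fun r hr => ?_)
            obtain ⟨hr0, hr1⟩ := hrle r hr
            have hrd := Nat.dvd_of_mem_divisors hr
            obtain ⟨hb1, hb2⟩ := hCe r (Nat.pos_of_mem_divisors hr)
            have := abs_sum_mul_sub_le_of_log_pow
              (a := fun n => if n.gcd e = e / r then (1 : ℝ) / n else 0)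
              (B := fun t => multipleSum j t r) (α := (r.totient : ℝ) / e)
              (F := (r : ℝ) / e * (e.divisors.card * (1 + Real.log e)))
              (κ := multipleDensity j r) (E := C * (r : ℝ) ^ (ε - 1)) (j := j)
              (fun n => by split_ifs <;> positivity) (by positivity) ?_
              (multipleDensity_nonneg _ _) hb1 ?_ hb2 hy
            · refine this.trans ?_
              have hrw : C * (r : ℝ) ^ (ε - 1) * ((r : ℝ) / e * (e.divisors.card *
                  (1 + Real.log e))) = C * (r : ℝ) ^ ε / e * (e.divisors.card *
                  (1 + Real.log e)) := by
                rw [Real.rpow_sub_one hr0.ne']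
                field_simp
              rw [hrw, Real.rpow_sub_one he0.ne', ← mul_div_assoc]
              gcongr
            · calc (r.totient : ℝ) / e ≤ (r : ℝ) / e * 1 := by
                    rw [mul_one]
                    gcongr
                    exact_mod_cast Nat.totient_le r
                _ ≤ _ := by
                    gcongr
                    exact one_le_mul_of_one_le_of_one_le hτ1 hL1
            · intro t ht
              simp only [← Finset.sum_filter]
              exact abs_sum_inv_gcd_sub_le he hrd ht
        _ = ((j : ℝ) + 1) * (e.divisors.card * (C * (e : ℝ) ^ (ε - 1) *
              (e.divisors.card * (1 + Real.log e)))) * (1 + Real.log y) ^ j := by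
            rw [Finset.sum_const, nsmul_eq_mul]
            ring
        _ ≤ _ := by
            push_cast
            gcongr

theorem multipleSum_le (j : ℕ) {η : ℝ} (hη : 0 < η) :
    ∃ C : ℝ, 1 ≤ C ∧ ∀ e : ℕ, 0 < e → ∀ y : ℝ, 1 ≤ y →
      multipleSum j y e ≤ C * (e : ℝ) ^ (η - 1) * (1 + Real.log y) ^ j := by
  obtain ⟨C, hC, h⟩ := multipleSum_asymptotic j hη
  refine ⟨(j + 1) * C, one_le_mul_of_one_le_of_one_le (by simp) hC,
    fun e he y hy => ?_⟩
  obtain ⟨h1, h2⟩ := h e he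
  have h3 := (abs_le.1 (h2 y hy)).2
  have hl := Real.log_nonneg hy
  have hjf : (1 : ℝ) ≤ j.factorial := by
    exact_mod_cast Nat.one_le_iff_ne_zero.2 (Nat.factorial_ne_zero j)
  have h4 : multipleDensity j e * Real.log y ^ j / j.factorial
      ≤ C * (e : ℝ) ^ (η - 1) * (1 + Real.log y) ^ j := by
    have := multipleDensity_nonneg j e
    refine (div_le_self (by positivity) hjf).trans ?_
    gcongr
    linarith
  have h5 : j * (C * (e : ℝ) ^ (η - 1)) * (1 + Real.log y) ^ (j - 1)
      ≤ j * (C * (e : ℝ) ^ (η - 1)) * (1 + Real.log y) ^ j := by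
    gcongr
    · linarith
    · omega
  calc _ ≤ _ := sub_le_iff_le_add.1 h3
    _ ≤ _ := add_le_add h5 h4
    _ = _ := by ring

/-! ### The double sum over d and q, with its variables separated -/

/-- The function `n ↦ n` restricted to the divisors of `h`. -/
noncomputable def divisorIdentity (h : ℕ) : ArithmeticFunction ℝ :=
  ⟨fun n => if n ∣ h then (n : ℝ) else 0, by simp⟩

/-- The Möbius inverse of `divisorIdentity h`. -/
noncomputable def gcdCoeff (h : ℕ) : ArithmeticFunction ℝ :=
  (ArithmeticFunction.moebius : ArithmeticFunction ℝ) * divisorIdentity h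

theorem divisorIdentity_apply (h n : ℕ) :
    divisorIdentity h n = if n ∣ h then (n : ℝ) else 0 := rfl

theorem divisorIdentity_nonneg (h n : ℕ) : 0 ≤ divisorIdentity h n := by
  rw [divisorIdentity_apply]
  split_ifs <;> positivity

theorem isMultiplicative_divisorIdentity (h : ℕ) : (divisorIdentity h).IsMultiplicative := by
  refine ⟨by simp [divisorIdentity_apply], fun {m n} hmn => ?_⟩
  simp only [divisorIdentity_apply]
  have : m * n ∣ h ↔ m ∣ h ∧ n ∣ h :=
    ⟨fun H => ⟨dvd_of_mul_right_dvd H, dvd_of_mul_left_dvd H⟩,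
      fun H => hmn.mul_dvd_of_dvd_of_dvd H.1 H.2⟩
  by_cases h1 : m ∣ h <;> by_cases h2 : n ∣ h <;> simp [this, h1, h2]

theorem isMultiplicative_gcdCoeff (h : ℕ) : (gcdCoeff h).IsMultiplicative :=
  (ArithmeticFunction.isMultiplicative_moebius.intCast).mul (isMultiplicative_divisorIdentity h)

theorem sum_divisors_gcdCoeff (h n : ℕ) :
    ∑ e ∈ n.divisors, gcdCoeff h e = if n ∣ h then (n : ℝ) else 0 := by
  rw [← ArithmeticFunction.coe_mul_zeta_apply, gcdCoeff, mul_right_comm,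
    ArithmeticFunction.coe_moebius_mul_coe_zeta, one_mul, divisorIdentity_apply]

/-- Only divisors of h contribute to the convolution and |μ| ≤ 1. The bound is uniform in e, so
convergence over e rests on the two densities alone. -/
theorem abs_gcdCoeff_le {h : ℕ} (hh : h ≠ 0) (e : ℕ) :
    |gcdCoeff h e| ≤ ∑ b ∈ h.divisors, (b : ℝ) := by
  rw [gcdCoeff, ArithmeticFunction.mul_apply]
  refine (Finset.abs_sum_le_sum_abs _ _).trans ?_
  calc _ ≤ ∑ x ∈ e.divisorsAntidiagonal, divisorIdentity h x.2 := by
        refine Finset.sum_le_sum fun x _ => ?_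
        rw [abs_mul, abs_of_nonneg (divisorIdentity_nonneg _ _)]
        refine mul_le_of_le_one_left (divisorIdentity_nonneg _ _) ?_
        exact abs_moebius_cast_le_one _
    _ = ∑ b ∈ e.divisors, divisorIdentity h b :=
        Nat.sum_divisorsAntidiagonal' (fun _ b => divisorIdentity h b)
    _ = ∑ b ∈ e.divisors with b ∣ h, (b : ℝ) := by
        rw [Finset.sum_filter]
        rfl
    _ ≤ _ := by
        refine Finset.sum_le_sum_of_subset_of_nonneg ?_ fun _ _ _ => by positivity
        intro b hb
        exact Nat.mem_divisors.2 ⟨(Finset.mem_filter.1 hb).2, hh⟩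

theorem gcdCoeff_prime_pow_succ (h : ℕ) {p : ℕ} (hp : p.Prime) (i : ℕ) :
    gcdCoeff h (p ^ (i + 1)) = (if p ^ (i + 1) ∣ h then ((p ^ (i + 1) : ℕ) : ℝ) else 0)
      - (if p ^ i ∣ h then ((p ^ i : ℕ) : ℝ) else 0) := by
  rw [← sum_divisors_gcdCoeff, ← sum_divisors_gcdCoeff, Nat.sum_divisors_prime_pow hp,
    Nat.sum_divisors_prime_pow hp, Finset.sum_range_succ _ (i + 1)]
  ring

/-- `∑ d_i(d) d_j(q) / lcm(d, q)` over `d ≤ D`, `q ≤ Q` with `(d, q) ∣ h`. -/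
noncomputable def pairSum (h i j : ℕ) (D Q : ℝ) : ℝ :=
  ∑ d ∈ Finset.Icc 1 ⌊D⌋₊, ∑ q ∈ Finset.Icc 1 ⌊Q⌋₊, (divisorFun i d : ℝ) * divisorFun j q *
    (if d.gcd q ∣ h then ((d.gcd q : ℕ) : ℝ) else 0) / (d * q)

/-- The leading constant of `pairSum`, as a series. -/
noncomputable def pairConst (h i j : ℕ) : ℝ :=
  ∑' e : ℕ, gcdCoeff h e * multipleDensity i e * multipleDensity j e

theorem multipleSum_eq_zero {j e : ℕ} {y : ℝ} (he : e ∉ Finset.Icc 1 ⌊y⌋₊) :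
    multipleSum j y e = 0 := by
  unfold multipleSum
  refine Finset.sum_eq_zero fun n hn => ?_
  rw [if_neg, mul_zero]
  intro h
  rw [Finset.mem_Icc] at hn he
  have h1 := Nat.le_of_dvd hn.1 h
  have h2 := Nat.pos_of_dvd_of_pos h hn.1
  exact he ⟨h2, h1.trans hn.2⟩

/-- Expanding g·1_{g ∣ h} at g = (d, q) as a sum of `gcdCoeff` over the common divisors e of d and q
decouples d from q. -/
theorem pairSum_eq_sum (h i j : ℕ) (D Q : ℝ) :
    pairSum h i j D Q = ∑ e ∈ Finset.Icc 1 ⌊D⌋₊,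
      gcdCoeff h e * multipleSum i D e * multipleSum j Q e := by
  have key : ∀ d ∈ Finset.Icc 1 ⌊D⌋₊, ∀ q ∈ Finset.Icc 1 ⌊Q⌋₊,
      (if d.gcd q ∣ h then ((d.gcd q : ℕ) : ℝ) else 0)
        = ∑ e ∈ Finset.Icc 1 ⌊D⌋₊, if e ∣ d ∧ e ∣ q then gcdCoeff h e else 0 := by
    intro d hd q hq
    rw [← sum_divisors_gcdCoeff, ← Finset.sum_filter]
    refine Finset.sum_congr ?_ fun _ _ => rfl
    rw [Finset.mem_Icc] at hd hq
    ext e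
    simp only [Nat.mem_divisors, Finset.mem_filter, Finset.mem_Icc, Nat.dvd_gcd_iff]
    constructor
    · rintro ⟨h1, _⟩
      exact ⟨⟨Nat.pos_of_dvd_of_pos h1.1 hd.1, (Nat.le_of_dvd hd.1 h1.1).trans hd.2⟩, h1⟩
    · rintro ⟨_, h1⟩
      exact ⟨h1, (Nat.gcd_pos_of_pos_left _ hd.1).ne'⟩
  unfold pairSum
  calc _ = ∑ d ∈ Finset.Icc 1 ⌊D⌋₊, ∑ q ∈ Finset.Icc 1 ⌊Q⌋₊, ∑ e ∈ Finset.Icc 1 ⌊D⌋₊,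
        gcdCoeff h e * ((divisorFun i d : ℝ) * (if e ∣ d then (d : ℝ)⁻¹ else 0))
          * ((divisorFun j q : ℝ) * (if e ∣ q then (q : ℝ)⁻¹ else 0)) := by
        refine Finset.sum_congr rfl fun d hd => Finset.sum_congr rfl fun q hq => ?_
        rw [key d hd q hq, Finset.mul_sum, Finset.sum_div]
        refine Finset.sum_congr rfl fun e _ => ?_
        by_cases h1 : e ∣ d <;> by_cases h2 : e ∣ q <;> simp [h1, h2]
        rw [div_eq_mul_inv, mul_inv]
        ring
    _ = ∑ e ∈ Finset.Icc 1 ⌊D⌋₊, ∑ d ∈ Finset.Icc 1 ⌊D⌋₊, ∑ q ∈ Finset.Icc 1 ⌊Q⌋₊,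
        gcdCoeff h e * ((divisorFun i d : ℝ) * (if e ∣ d then (d : ℝ)⁻¹ else 0))
          * ((divisorFun j q : ℝ) * (if e ∣ q then (q : ℝ)⁻¹ else 0)) := by
        rw [Finset.sum_comm]
        refine Eq.trans (Finset.sum_congr rfl fun q _ => Finset.sum_comm) ?_
        rw [Finset.sum_comm]
        exact Finset.sum_congr rfl fun e _ => Finset.sum_comm
    _ = _ := by
        refine Finset.sum_congr rfl fun e _ => ?_
        unfold multipleSum
        rw [mul_assoc, Finset.sum_mul_sum, Finset.mul_sum]
        refine Finset.sum_congr rfl fun d _ => ?_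
        rw [Finset.mul_sum]
        exact Finset.sum_congr rfl fun q _ => by ring

theorem gcdCoeff_zero (h : ℕ) : gcdCoeff h 0 = 0 := by simp

theorem summable_rpow_mul_rpow :
    Summable fun e : ℕ => (e : ℝ) ^ ((1 / 4 : ℝ) - 1) * (e : ℝ) ^ ((1 / 4 : ℝ) - 1) := by
  have : Summable fun e : ℕ => (e : ℝ) ^ (-(3 / 2) : ℝ) :=
    Real.summable_nat_rpow.2 (by norm_num)
  refine this.congr fun e => ?_
  rcases Nat.eq_zero_or_pos e with rfl | he
  · norm_num
  · rw [← Real.rpow_add (by exact_mod_cast he)]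
    norm_num

theorem summable_pairConst {h : ℕ} (hh : h ≠ 0) (i j : ℕ) :
    Summable fun e : ℕ => ‖gcdCoeff h e * multipleDensity i e * multipleDensity j e‖ := by
  obtain ⟨C, hC, h1⟩ := multipleSum_asymptotic i (η := 1 / 4) (by norm_num)
  obtain ⟨C', hC', h2⟩ := multipleSum_asymptotic j (η := 1 / 4) (by norm_num)
  refine Summable.of_nonneg_of_le (fun _ => norm_nonneg _) (fun e => ?_)
    (summable_rpow_mul_rpow.mul_left ((∑ b ∈ h.divisors, (b : ℝ)) * (C * C')))
  rcases Nat.eq_zero_or_pos e with rfl | he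
  · rw [gcdCoeff_zero]
    norm_num
  · rw [norm_mul, norm_mul, Real.norm_eq_abs, Real.norm_eq_abs, Real.norm_eq_abs,
      abs_of_nonneg (multipleDensity_nonneg i e), abs_of_nonneg (multipleDensity_nonneg j e)]
    have := multipleDensity_nonneg i e
    have := multipleDensity_nonneg j e
    calc _ ≤ (∑ b ∈ h.divisors, (b : ℝ)) * (C * (e : ℝ) ^ ((1 / 4 : ℝ) - 1))
          * (C' * (e : ℝ) ^ ((1 / 4 : ℝ) - 1)) := by
          gcongr
          · exact abs_gcdCoeff_le hh e
          · exact (h1 e he).1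
          · exact (h2 e he).1
      _ = _ := by ring

/-- Insert the asymptotics of both factors for each e. With η = 1/4 every error carries e^(-3/2),
hence is summable, and the main terms may be summed over all e with no tail to estimate separately.
-/
theorem pairSum_asymptotic {h : ℕ} (hh : h ≠ 0) (i j : ℕ) :
    ∃ C : ℝ, 0 ≤ C ∧ ∀ D Q : ℝ, 1 ≤ D → 1 ≤ Q →
      |pairSum h i j D Q - pairConst h i j * (Real.log D ^ i / i.factorial)
        * (Real.log Q ^ j / j.factorial)|
        ≤ C * (i * (1 + Real.log D) ^ (i - 1) * (1 + Real.log Q) ^ j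
          + j * (1 + Real.log D) ^ i * (1 + Real.log Q) ^ (j - 1)) := by
  obtain ⟨C, hC, h1⟩ := multipleSum_asymptotic i (η := 1 / 4) (by norm_num)
  obtain ⟨C', hC', h2⟩ := multipleSum_asymptotic j (η := 1 / 4) (by norm_num)
  obtain ⟨C'', hC'', h3⟩ := multipleSum_le j (η := 1 / 4) (by norm_num)
  set σ : ℝ := ∑ b ∈ h.divisors, (b : ℝ) with hσ
  have hσ0 : 0 ≤ σ := Finset.sum_nonneg fun _ _ => by positivity
  set S : ℝ := ∑' e : ℕ, (e : ℝ) ^ ((1 / 4 : ℝ) - 1) * (e : ℝ) ^ ((1 / 4 : ℝ) - 1) with hS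
  have hS0 : 0 ≤ S := tsum_nonneg fun _ => by positivity
  refine ⟨σ * (C * C'' + C * C') * S, by positivity, fun D Q hD hQ => ?_⟩
  have hlD := Real.log_nonneg hD
  have hlQ := Real.log_nonneg hQ
  have hLD := one_le_one_add_log hD
  have hLQ := one_le_one_add_log hQ
  set R : ℝ := i * (1 + Real.log D) ^ (i - 1) * (1 + Real.log Q) ^ j
          + j * (1 + Real.log D) ^ i * (1 + Real.log Q) ^ (j - 1) with hR
  -- No e > D has a multiple up to D, so the finite sum is already a series over all e and can be
  -- compared termwise with the main term.
  have hsum : HasSum (fun e : ℕ => gcdCoeff h e * multipleSum i D e * multipleSum j Q e)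
      (pairSum h i j D Q) := by
    rw [pairSum_eq_sum]
    refine hasSum_sum_of_ne_finset_zero fun e he => ?_
    rw [multipleSum_eq_zero he]
    ring
  have hsum2 : HasSum (fun e : ℕ => gcdCoeff h e * multipleDensity i e * multipleDensity j e
      * ((Real.log D ^ i / i.factorial) * (Real.log Q ^ j / j.factorial)))
      (pairConst h i j * ((Real.log D ^ i / i.factorial) * (Real.log Q ^ j / j.factorial))) :=
    (summable_pairConst hh i j).of_norm.hasSum.mul_right _
  have hsub := hsum.sub hsum2
  rw [mul_assoc (pairConst h i j), ← hsub.tsum_eq, ← Real.norm_eq_abs]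
  have hbound := (summable_rpow_mul_rpow.mul_left (σ * (C * C'' + C * C') * R)).hasSum
  rw [tsum_mul_left, ← hS] at hbound
  refine (tsum_of_norm_bounded hbound fun e => ?_).trans (le_of_eq (by ring))
  rcases Nat.eq_zero_or_pos e with rfl | he
  · rw [gcdCoeff_zero]
    norm_num
  obtain ⟨a1, a2⟩ := h1 e he
  obtain ⟨b1, b2⟩ := h2 e he
  have a3 := a2 D hD
  have b3 := b2 Q hQ
  have c3 := h3 e he Q hQ
  have hW := multipleSum_nonneg j Q e
  have hK := multipleDensity_nonneg i e
  set w : ℝ := (e : ℝ) ^ ((1 / 4 : ℝ) - 1) with hw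
  have hw0 : 0 ≤ w := by positivity
  set ℓ := Real.log D ^ i / i.factorial with hℓ
  set ℓ' := Real.log Q ^ j / j.factorial with hℓ'
  have hℓ1 : 0 ≤ ℓ ∧ ℓ ≤ (1 + Real.log D) ^ i := by
    refine ⟨by positivity, ?_⟩
    refine (div_le_self (by positivity) ?_).trans ?_
    · exact_mod_cast Nat.one_le_iff_ne_zero.2 (Nat.factorial_ne_zero i)
    · gcongr
      linarith
  rw [mul_div_assoc, ← hℓ] at a3
  rw [mul_div_assoc, ← hℓ'] at b3
  -- A difference of products, changing one factor at a time.
  have hid : gcdCoeff h e * multipleSum i D e * multipleSum j Q e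
      - gcdCoeff h e * multipleDensity i e * multipleDensity j e * (ℓ * ℓ')
      = gcdCoeff h e * ((multipleSum i D e - multipleDensity i e * ℓ) * multipleSum j Q e
        + multipleDensity i e * ℓ * (multipleSum j Q e - multipleDensity j e * ℓ')) := by ring
  rw [hid, norm_mul, Real.norm_eq_abs, Real.norm_eq_abs]
  have hin : |(multipleSum i D e - multipleDensity i e * ℓ) * multipleSum j Q e
        + multipleDensity i e * ℓ * (multipleSum j Q e - multipleDensity j e * ℓ')|
      ≤ (i * (C * w) * (1 + Real.log D) ^ (i - 1)) * (C'' * w * (1 + Real.log Q) ^ j)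
        + (C * w) * (1 + Real.log D) ^ i * (j * (C' * w) * (1 + Real.log Q) ^ (j - 1)) := by
    refine (abs_add_le _ _).trans ?_
    rw [abs_mul, abs_mul, abs_of_nonneg hW, abs_of_nonneg (mul_nonneg hK hℓ1.1)]
    have := hℓ1.1
    have := hℓ1.2
    gcongr
  have hR1 : i * (1 + Real.log D) ^ (i - 1) * (1 + Real.log Q) ^ j ≤ R := by
    rw [hR]; exact le_add_of_nonneg_right (by positivity)
  have hR2 : j * (1 + Real.log D) ^ i * (1 + Real.log Q) ^ (j - 1) ≤ R := by
    rw [hR]; exact le_add_of_nonneg_left (by positivity)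
  calc _ ≤ σ * ((i * (C * w) * (1 + Real.log D) ^ (i - 1)) * (C'' * w * (1 + Real.log Q) ^ j)
        + (C * w) * (1 + Real.log D) ^ i * (j * (C' * w) * (1 + Real.log Q) ^ (j - 1))) := by
        gcongr
        exact abs_gcdCoeff_le hh e
    _ = σ * (C * C'' * (w * w) * (i * (1 + Real.log D) ^ (i - 1) * (1 + Real.log Q) ^ j)
        + C * C' * (w * w) * (j * (1 + Real.log D) ^ i * (1 + Real.log Q) ^ (j - 1))) := by ring
    _ ≤ σ * (C * C'' * (w * w) * R + C * C' * (w * w) * R) := by gcongr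
    _ = _ := by ring

/-! ### The Euler product of the leading constant -/

theorem multipleDensity_one_right (j : ℕ) : multipleDensity j 1 = 1 := by
  induction j with
  | zero => simp [multipleDensity]
  | succ j ih => simp [multipleDensity, ih]

theorem multipleDensity_mul (j : ℕ) {m n : ℕ} (hmn : m.Coprime n) :
    multipleDensity j (m * n) = multipleDensity j m * multipleDensity j n := by
  induction j generalizing m n with
  | zero =>
    simp only [multipleDensity, mul_eq_one]
    by_cases h1 : m = 1 <;> by_cases h2 : n = 1 <;> simp [h1, h2]
  | succ j ih =>
    -- Up to division by e, the density for j + 1 is the Dirichlet convolution of this F with ζ, so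
    -- multiplicativity is inherited.
    set F : ArithmeticFunction ℝ :=
      ⟨fun r => (r.totient : ℝ) * multipleDensity j r, by simp⟩ with hF
    have hFm : F.IsMultiplicative := by
      refine ⟨by simp [hF, multipleDensity_one_right], fun {a b} hab => ?_⟩
      simp only [hF, ArithmeticFunction.coe_mk]
      rw [ih hab, Nat.totient_mul hab]
      push_cast
      ring
    have hG := hFm.mul (ArithmeticFunction.isMultiplicative_zeta.natCast (R := ℝ))
    have hG2 := hG.2 hmn
    simp only [ArithmeticFunction.coe_mul_zeta_apply] at hG2
    simp only [hF, ArithmeticFunction.coe_mk] at hG2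
    simp only [multipleDensity]
    rw [hG2]
    push_cast
    rw [mul_div_mul_comm]

/-- The summand of `pairConst`, as an arithmetic function. -/
noncomputable def pairCoeff (h i j : ℕ) : ArithmeticFunction ℝ :=
  ⟨fun e => gcdCoeff h e * multipleDensity i e * multipleDensity j e, by simp⟩

theorem isMultiplicative_pairCoeff (h i j : ℕ) : (pairCoeff h i j).IsMultiplicative := by
  have hc := isMultiplicative_gcdCoeff h
  refine ⟨?_, fun {a b} hab => ?_⟩
  · simp [pairCoeff, multipleDensity_one_right, hc.1]
  · simp only [pairCoeff, ArithmeticFunction.coe_mk]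
    rw [hc.2 hab, multipleDensity_mul i hab, multipleDensity_mul j hab]
    ring

theorem hasProd_pairConst {h : ℕ} (hh : h ≠ 0) (i j : ℕ) :
    HasProd (fun p : Nat.Primes => ∑' n : ℕ, pairCoeff h i j ((p : ℕ) ^ n))
      (pairConst h i j) :=
  (isMultiplicative_pairCoeff h i j).eulerProduct_hasProd (summable_pairConst hh i j)

theorem divisorFun_succ_prime_pow_succ (j : ℕ) {p : ℕ} (hp : p.Prime) (n : ℕ) :
    divisorFun (j + 1) (p ^ (n + 1)) = divisorFun (j + 1) (p ^ n) + divisorFun j (p ^ (n + 1)) := by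
  rw [divisorFun_succ_divisors, divisorFun_succ_divisors, Nat.sum_divisors_prime_pow hp,
    Nat.sum_divisors_prime_pow hp, Finset.sum_range_succ]

/-- The tail `∑_{t ≥ i} d_j(p^t) p^{-t}`. -/
noncomputable def primePowTail (j p i : ℕ) : ℝ :=
  ∑' t : ℕ, (divisorFun j (p ^ (i + t)) : ℝ) / (p : ℝ) ^ (i + t)

theorem summable_divisorFun_prime_pow (j : ℕ) {p : ℕ} (hp : p.Prime) :
    Summable fun t : ℕ => (divisorFun j (p ^ t) : ℝ) / (p : ℝ) ^ t := by
  obtain ⟨C, hC, h⟩ := divisorFun_le_rpow j (ε := 1 / 2) (by norm_num)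
  have hp1 : (1 : ℝ) < p := by exact_mod_cast hp.one_lt
  have hp0 : (0 : ℝ) < p := by linarith
  have hr : (p : ℝ) ^ (-(1 / 2) : ℝ) < 1 := Real.rpow_lt_one_of_one_lt_of_neg hp1 (by norm_num)
  refine Summable.of_nonneg_of_le (fun t => by positivity) (fun t => ?_)
    ((summable_geometric_of_lt_one (by positivity) hr).mul_left C)
  have h1 := h (p ^ t) (Nat.one_le_pow _ _ hp.pos)
  rw [div_le_iff₀ (by positivity)]
  refine h1.trans (le_of_eq ?_)
  push_cast
  rw [mul_assoc, ← mul_pow, ← Real.rpow_natCast, ← Real.rpow_natCast, ← Real.rpow_mul hp0.le]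
  have h2 : (p : ℝ) ^ (-(1 / 2) : ℝ) * p = (p : ℝ) ^ (1 / 2 : ℝ) := by
    rw [← Real.rpow_add_one hp0.ne']
    norm_num
  rw [h2, ← Real.rpow_mul hp0.le, mul_comm (1 / 2 : ℝ)]

theorem summable_primePowTail (j : ℕ) {p : ℕ} (hp : p.Prime) (i : ℕ) :
    Summable fun t : ℕ => (divisorFun j (p ^ (i + t)) : ℝ) / (p : ℝ) ^ (i + t) := by
  have := (summable_nat_add_iff i).2 (summable_divisorFun_prime_pow j hp)
  simpa only [add_comm] using this

theorem primePowTail_eq_add (j : ℕ) {p : ℕ} (hp : p.Prime) (i : ℕ) :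
    primePowTail j p i = (divisorFun j (p ^ i) : ℝ) / (p : ℝ) ^ i + primePowTail j p (i + 1) := by
  unfold primePowTail
  rw [(summable_primePowTail j hp i).tsum_eq_zero_add]
  simp only [add_zero]
  congr 1
  refine tsum_congr fun t => ?_
  rw [show i + (t + 1) = i + 1 + t by omega]

/-- On prime powers, multiplying the generating series of d_{j+1} by 1 - p⁻¹ gives that of d_j. For
tails this needs the shift of the starting index, as d_{j+1}(p^(t+1)) - d_{j+1}(p^t) = d_j(p^(t+1)).
-/
theorem primePowTail_succ_sub (j : ℕ) {p : ℕ} (hp : p.Prime) (i : ℕ) :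
    primePowTail (j + 1) p (i + 1) - primePowTail (j + 1) p i / p = primePowTail j p (i + 1) := by
  have hp0 : (p : ℝ) ≠ 0 := by exact_mod_cast hp.ne_zero
  unfold primePowTail
  rw [← tsum_div_const, ← (summable_primePowTail (j + 1) hp (i + 1)).tsum_sub
    ((summable_primePowTail (j + 1) hp i).div_const _)]
  refine tsum_congr fun t => ?_
  have hidx : i + 1 + t = (i + t) + 1 := by omega
  rw [hidx, divisorFun_succ_prime_pow_succ j hp]
  push_cast
  field_simp
  ring

theorem primePowTail_zero_mul (j : ℕ) {p : ℕ} (hp : p.Prime) :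
    (1 - (p : ℝ)⁻¹) * primePowTail (j + 1) p 0 = primePowTail j p 0 := by
  have h1 := primePowTail_eq_add (j + 1) hp 0
  have h2 := primePowTail_succ_sub j hp 0
  have h3 := primePowTail_eq_add j hp 0
  simp only [pow_zero, divisorFun_one_right, Nat.cast_one, div_one] at h1 h3
  rw [div_eq_mul_inv] at h2
  linear_combination h1 + h2 - h3

theorem primePowTail_zero_eq (j : ℕ) {p : ℕ} (hp : p.Prime) :
    (1 - (p : ℝ)⁻¹) ^ j * primePowTail j p 0 = 1 := by
  induction j with
  | zero =>
    unfold primePowTail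
    rw [tsum_eq_single 0]
    · simp [divisorFun_one_right]
    · intro t ht
      have : p ^ (0 + t) ≠ 1 := by
        rw [zero_add]
        exact (Nat.one_lt_pow ht hp.one_lt).ne'
      simp [divisorFun_zero_left, hp.ne_one, ht]
  | succ j ih => rw [pow_succ, mul_assoc, primePowTail_zero_mul j hp, ih]

/-- Both sides satisfy the same recursion in the exponent. For the density, the divisor sums at
p^(i+1) and p^i differ by the single term r = p^(i+1); for the tails this is
`primePowTail_succ_sub`. At exponent 0 both sides equal 1. -/
theorem multipleDensity_prime_pow (j : ℕ) {p : ℕ} (hp : p.Prime) (i : ℕ) :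
    multipleDensity j (p ^ i) = (1 - (p : ℝ)⁻¹) ^ j * primePowTail j p i := by
  have hp0 : (p : ℝ) ≠ 0 := by exact_mod_cast hp.ne_zero
  induction j generalizing i with
  | zero =>
    rcases i with _ | i
    · rw [primePowTail_zero_eq 0 hp]
      simp [multipleDensity]
    · have : ∀ t : ℕ, p ^ (i + 1 + t) ≠ 1 := fun t =>
        (Nat.one_lt_pow (by omega) hp.one_lt).ne'
      unfold primePowTail
      simp [divisorFun_zero_left, multipleDensity, hp.ne_one]
  | succ j ih =>
    induction i with
    | zero => rw [primePowTail_zero_eq (j + 1) hp, pow_zero, multipleDensity_one_right]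
    | succ i ihi =>
      have hpi : ((p : ℝ) ^ i) ≠ 0 := pow_ne_zero _ hp0
      have h1 := primePowTail_succ_sub j hp i
      have h2 : multipleDensity (j + 1) (p ^ (i + 1)) * (p : ℝ) ^ (i + 1)
          = multipleDensity (j + 1) (p ^ i) * (p : ℝ) ^ i
            + ((p ^ (i + 1)).totient : ℝ) * multipleDensity j (p ^ (i + 1)) := by
        simp only [multipleDensity]
        push_cast
        rw [div_mul_cancel₀ _ (pow_ne_zero _ hp0), div_mul_cancel₀ _ hpi,
          Nat.sum_divisors_prime_pow hp, Nat.sum_divisors_prime_pow hp,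
          Finset.sum_range_succ _ (i + 1)]
      rw [ihi, ih, Nat.totient_prime_pow_succ hp, ← h1] at h2
      push_cast [Nat.cast_sub hp.one_le] at h2
      have h3 : multipleDensity (j + 1) (p ^ (i + 1)) * (p : ℝ) ^ (i + 1)
          = ((1 - (p : ℝ)⁻¹) ^ (j + 1) * primePowTail (j + 1) p (i + 1)) * (p : ℝ) ^ (i + 1) := by
        rw [h2]
        have : (p : ℝ) - 1 = (1 - (p : ℝ)⁻¹) * p := by
          field_simp
        rw [this]
        set u := 1 - (p : ℝ)⁻¹
        field_simp
        ring
      exact mul_right_cancel₀ (pow_ne_zero _ hp0) h3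

/-- The Euler factor of `pairConst` at `p`. -/
theorem tsum_pairCoeff_prime_pow (h i j : ℕ) (hh : h ≠ 0) {p : ℕ} (hp : p.Prime) :
    ∑' n : ℕ, pairCoeff h i j (p ^ n) = (1 - (p : ℝ)⁻¹) ^ (i + j) *
      ((1 - (p : ℝ)⁻¹) * (∑ α ∈ Finset.range (h.factorization p + 1),
          (divisorFun j (p ^ α) : ℝ) * primePowTail (i + 1) p α)
        + (divisorFun (i + 1) (p ^ h.factorization p) : ℝ) *
          primePowTail j p (h.factorization p + 1)) := by
  set γ := h.factorization p with hγ
  have hp0 : (p : ℝ) ≠ 0 := by exact_mod_cast hp.ne_zero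
  have hdvd : ∀ n, p ^ n ∣ h ↔ n ≤ γ := fun n =>
    hp.pow_dvd_iff_le_factorization hh
  set u := 1 - (p : ℝ)⁻¹ with hu
  set w : ℕ → ℝ := primePowTail i p with hw
  set v : ℕ → ℝ := primePowTail j p with hv
  set c : ℕ → ℝ := fun n => gcdCoeff h (p ^ n) with hc
  have hc0 : c 0 = 1 := by simp [hc, (isMultiplicative_gcdCoeff h).1]
  have hcs : ∀ n, n < γ → c (n + 1) = (p : ℝ) ^ (n + 1) - (p : ℝ) ^ n := by
    intro n hn
    simp only [hc]
    rw [gcdCoeff_prime_pow_succ h hp, if_pos ((hdvd _).2 hn), if_pos ((hdvd _).2 hn.le)]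
    push_cast
    ring
  have hclast : c (γ + 1) = -(p : ℝ) ^ γ := by
    simp only [hc]
    rw [gcdCoeff_prime_pow_succ h hp, if_neg (by rw [hdvd]; omega), if_pos ((hdvd _).2 le_rfl)]
    push_cast
    ring
  have hc2 : ∀ n, γ + 2 ≤ n → c n = 0 := by
    intro n hn
    obtain ⟨m, rfl⟩ : ∃ m, n = m + 1 := ⟨n - 1, by omega⟩
    simp only [hc]
    rw [gcdCoeff_prime_pow_succ h hp, if_neg (by rw [hdvd]; omega),
      if_neg (by rw [hdvd]; omega), sub_self]
  have hval : ∀ n, pairCoeff h i j (p ^ n) = u ^ (i + j) * (c n * w n * v n) := by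
    intro n
    simp only [pairCoeff, ArithmeticFunction.coe_mk]
    rw [multipleDensity_prime_pow i hp, multipleDensity_prime_pow j hp, pow_add]
    ring
  rw [tsum_eq_sum (s := Finset.range (γ + 2)) (fun n hn => by
    rw [hval, hc2 n (by simpa using hn)]; ring)]
  simp only [hval]
  rw [← Finset.mul_sum]
  congr 1
  -- For n ≤ γ this is the partial sum of c(α) w(α) over α ≤ n, as `hz0`, `hzs` and the values of c
  -- show.
  set z : ℕ → ℝ := fun n => u * primePowTail (i + 1) p n * (p : ℝ) ^ n with hz
  have hz0 : z 0 = w 0 := by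
    simp only [hz, pow_zero, mul_one]
    exact primePowTail_zero_mul i hp
  have hzs : ∀ n, z (n + 1) = z n + ((p : ℝ) ^ (n + 1) - (p : ℝ) ^ n) * w (n + 1) := by
    intro n
    have h1 := primePowTail_succ_sub i hp n
    simp only [hz, hw, ← h1, hu]
    field_simp
    ring
  have hzd : ∀ n, z n = (divisorFun (i + 1) (p ^ n) : ℝ) + (p : ℝ) ^ n * w (n + 1) := by
    intro n
    have h1 := primePowTail_succ_sub i hp n
    have h2 := primePowTail_eq_add (i + 1) hp n
    have h3 : u * primePowTail (i + 1) p n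
        = (divisorFun (i + 1) (p ^ n) : ℝ) / (p : ℝ) ^ n + w (n + 1) := by
      simp only [hw, ← h1, hu]
      rw [div_eq_mul_inv (primePowTail _ _ _)]
      linear_combination h2
    simp only [hz, h3]
    field_simp
  -- Abel summation: the increments of v are d_j(p^α) p^(-α), and multiplying them by z(α) cancels
  -- the power of p in z.
  have key : ∀ n, n ≤ γ → ∑ α ∈ Finset.range (n + 1), c α * w α * v α
      = ∑ α ∈ Finset.range (n + 1), u * ((divisorFun j (p ^ α) : ℝ) * primePowTail (i + 1) p α)
        + z n * v (n + 1) := by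
    intro n
    induction n with
    | zero =>
      intro _
      have h1 := primePowTail_eq_add j hp 0
      simp only [zero_add, Finset.sum_range_one, hc0, one_mul, pow_zero, div_one]
        at h1 ⊢
      rw [← hz0]
      simp only [hv, h1, hz]
      simp
      ring
    | succ n ih =>
      intro hn
      rw [Finset.sum_range_succ, ih (by omega), Finset.sum_range_succ _ (n + 1),
        hcs n (by omega)]
      have h1 := primePowTail_eq_add j hp (n + 1)
      have h2 : u * ((divisorFun j (p ^ (n + 1)) : ℝ) * primePowTail (i + 1) p (n + 1))
          = z (n + 1) * ((divisorFun j (p ^ (n + 1)) : ℝ) / (p : ℝ) ^ (n + 1)) := by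
        simp only [hz]
        field_simp
      rw [h2]
      have h3 : (divisorFun j (p ^ (n + 1)) : ℝ) / (p : ℝ) ^ (n + 1)
          = v (n + 1) - v (n + 1 + 1) := by
        simp only [hv]; linarith
      rw [h3, hzs n]
      ring
  -- The last nonzero coefficient, c(γ + 1) = -p^γ, removes the tail part of z(γ) and leaves
  -- d_{i+1}(p^γ) v(γ + 1), the second term of the singular factor.
  rw [Finset.sum_range_succ, key γ le_rfl, hclast, hzd γ, ← Finset.mul_sum]
  ring

theorem one_sub_inv_prime_pos {p : ℕ} (hp : p.Prime) : 0 < 1 - (p : ℝ)⁻¹ := by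
  have : (1 : ℝ) < p := by exact_mod_cast hp.one_lt
  have := inv_lt_one_of_one_lt₀ this
  linarith

theorem one_sub_inv_zpow_identity (i j : ℕ) {u : ℝ} (hu : u ≠ 0) :
    u ^ (i + j) * (u ^ (1 - ((i + 1 : ℕ) : ℤ)) + u ^ (1 - ((j + 1 : ℕ) : ℤ)) - 1)
      = u ^ j + u ^ i - u ^ (i + j) := by
  have h1 : ∀ n : ℕ, u ^ (1 - ((n + 1 : ℕ) : ℤ)) = (u ^ n)⁻¹ := by
    intro n
    rw [show (1 - ((n + 1 : ℕ) : ℤ)) = -(n : ℤ) by push_cast; ring, zpow_neg, zpow_natCast]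
  rw [h1, h1, pow_add]
  field_simp

theorem tsum_pairCoeff_eq_mul_singularFactor (h i j : ℕ) (hh : h ≠ 0) {p : ℕ} (hp : p.Prime) :
    ∑' n : ℕ, pairCoeff h i j (p ^ n)
      = ((1 - (p : ℝ)⁻¹) ^ j + (1 - (p : ℝ)⁻¹) ^ i - (1 - (p : ℝ)⁻¹) ^ (i + j))
        * singularFactor (i + 1) (j + 1) p (h.factorization p) := by
  have hu := one_sub_inv_prime_pos hp
  set u := 1 - (p : ℝ)⁻¹ with hudef
  have hu1 : u ≤ 1 := by
    have : 0 ≤ (p : ℝ)⁻¹ := by positivity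
    linarith
  have hden : 0 < u ^ (1 - ((i + 1 : ℕ) : ℤ)) + u ^ (1 - ((j + 1 : ℕ) : ℤ)) - 1 := by
    have : ∀ n : ℕ, 1 ≤ u ^ (1 - ((n + 1 : ℕ) : ℤ)) := by
      intro n
      rw [show (1 - ((n + 1 : ℕ) : ℤ)) = -(n : ℤ) by push_cast; ring, zpow_neg, zpow_natCast]
      exact (one_le_inv₀ (pow_pos hu n)).2 (pow_le_one₀ hu.le hu1)
    linarith [this i, this j]
  rw [tsum_pairCoeff_prime_pow h i j hh hp, ← one_sub_inv_zpow_identity i j hu.ne', mul_assoc]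
  congr 1
  rw [singularFactor, mul_div_cancel₀ _ hden.ne']
  rfl

theorem tsum_pairCoeff_of_not_dvd (h i j : ℕ) (hh : h ≠ 0) {p : ℕ} (hp : p.Prime)
    (hph : ¬ p ∣ h) :
    ∑' n : ℕ, pairCoeff h i j (p ^ n)
      = (1 - (p : ℝ)⁻¹) ^ j + (1 - (p : ℝ)⁻¹) ^ i - (1 - (p : ℝ)⁻¹) ^ (i + j) := by
  rw [tsum_pairCoeff_prime_pow h i j hh hp, Nat.factorization_eq_zero_of_not_dvd hph]
  have h1 := primePowTail_zero_mul i hp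
  have h2 := primePowTail_eq_add j hp 0
  have h3 := primePowTail_zero_eq i hp
  have h4 := primePowTail_zero_eq j hp
  simp only [zero_add, Finset.sum_range_one, pow_zero, divisorFun_one_right, Nat.cast_one,
    one_mul, div_one] at h1 h2 ⊢
  rw [h1, pow_add]
  set u := 1 - (p : ℝ)⁻¹
  linear_combination (u ^ j) * h3 + u ^ i * h4 - u ^ i * u ^ j * h2

/-- For h = 1 every Euler factor is of the type p ∤ h, so `pairConst 1 i j` is the product C_{k,l},
convergence included. A general h changes only the finitely many factors at p ∣ h, each by its
`singularFactor`. -/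
theorem pairConst_eq (h i j : ℕ) (hh : h ≠ 0) :
    pairConst h i j = singularConst (i + 1) (j + 1) * singularFun (i + 1) (j + 1) h := by
  set P : Nat.Primes → ℝ := fun p =>
    (1 - (p : ℝ)⁻¹) ^ j + (1 - (p : ℝ)⁻¹) ^ i - (1 - (p : ℝ)⁻¹) ^ (i + j) with hP
  have h1 : HasProd P (pairConst 1 i j) := by
    convert hasProd_pairConst one_ne_zero i j using 1
    ext p
    exact (tsum_pairCoeff_of_not_dvd 1 i j one_ne_zero p.2
      (fun hp => p.2.one_lt.ne' (Nat.dvd_one.1 hp))).symm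
  have h2 : singularConst (i + 1) (j + 1) = pairConst 1 i j := by
    rw [← h1.tprod_eq, singularConst]
    refine tprod_congr fun p => ?_
    rw [show i + 1 + (j + 1) - 2 = i + j by omega]
    rfl
  set f : ℕ → ℝ := fun p => if p ∣ h then singularFactor (i + 1) (j + 1) p (h.factorization p)
    else 1 with hf
  have h3 : HasProd (fun p : Nat.Primes => f p) (singularFun (i + 1) (j + 1) h) := by
    have h4 : ∏ p ∈ h.primeFactors.subtype Nat.Prime, f p = singularFun (i + 1) (j + 1) h := by
      rw [Finset.prod_subtype_of_mem f fun p hp => Nat.prime_of_mem_primeFactors hp, singularFun]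
      refine Finset.prod_congr rfl fun p hp => ?_
      simp only [hf]
      rw [if_pos (Nat.dvd_of_mem_primeFactors hp)]
    rw [← h4]
    refine hasProd_prod_of_ne_finset_one fun p hp => ?_
    simp only [hf]
    rw [if_neg]
    intro hd
    exact hp (Finset.mem_subtype.2 (Nat.mem_primeFactors.2 ⟨p.2, hd, hh⟩))
  rw [h2]
  refine (hasProd_pairConst hh i j).unique ?_
  convert h1.mul h3 using 1
  ext p
  by_cases hp : (p : ℕ) ∣ h
  · simp only [hf, if_pos hp]
    exact tsum_pairCoeff_eq_mul_singularFactor h i j hh p.2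
  · simp only [hf, if_neg hp, mul_one]
    exact tsum_pairCoeff_of_not_dvd h i j hh p.2 hp

/-! ### Consequences of an exponent of distribution -/

theorem le_card_divisors_mul_totient (n : ℕ) : n ≤ n.divisors.card * n.totient := by
  rcases Nat.eq_zero_or_pos n with rfl | hn
  · simp
  calc n = ∑ d ∈ n.divisors, d.totient := (Nat.sum_totient n).symm
    _ ≤ ∑ d ∈ n.divisors, n.totient := Finset.sum_le_sum fun d hd =>
        Nat.le_of_dvd (Nat.totient_pos.2 hn) (Nat.totient_dvd_of_dvd (Nat.dvd_of_mem_divisors hd))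
    _ = _ := by rw [Finset.sum_const, smul_eq_mul]

theorem inv_totient_le {n : ℕ} (hn : 0 < n) :
    1 / (n.totient : ℝ) ≤ n.divisors.card / n := by
  have h1 : (0 : ℝ) < n.totient := by exact_mod_cast Nat.totient_pos.2 hn
  have h2 : (0 : ℝ) < n := by exact_mod_cast hn
  rw [div_le_div_iff₀ h1 h2, one_mul]
  exact_mod_cast le_card_divisors_mul_totient n

theorem sum_filter_modEq_congr {f : ℕ → ℝ} {s : Finset ℕ} {q a b : ℕ} (h : a ≡ b [MOD q]) :
    ∑ n ∈ s with n ≡ a [MOD q], f n = ∑ n ∈ s with n ≡ b [MOD q], f n :=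
  Finset.sum_congr (Finset.filter_congr fun _ _ => ⟨fun H => H.trans h, fun H => H.trans h.symm⟩)
    fun _ _ => rfl

/-- An exponent of distribution controls the difference of the sums over any two residue classes
with the same gcd with the modulus. -/
theorem IsExponentOfDistribution.abs_sum_sub_sum_le {j : ℕ} {θ : ℝ}
    (hθ : IsExponentOfDistribution j θ) {h : ℕ} (hh : h ≠ 0) {ε : ℝ} (hε : 0 < ε) :
    ∃ δ : ℝ, 0 < δ ∧ δ ≤ 1 ∧ ∃ C : ℝ, 0 ≤ C ∧ ∀ (x : ℝ) (q a b : ℕ), 1 ≤ x → 1 ≤ q →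
      (q : ℝ) ≤ x ^ (θ - ε) → a.gcd q = b.gcd q → a.gcd q ∣ h →
      |∑ n ∈ Finset.Icc 1 ⌊x⌋₊ with n ≡ a [MOD q], (divisorFun j n : ℝ)
        - ∑ n ∈ Finset.Icc 1 ⌊x⌋₊ with n ≡ b [MOD q], (divisorFun j n : ℝ)|
        ≤ C * (x ^ (1 - δ) * (1 / ((q / a.gcd q).totient : ℝ))) := by
  -- The constants depend on g. Dummy values at g = 0 turn them into functions on ℕ; afterwards only
  -- the finitely many g ∣ h are used, which permits a common δ and C.
  have key : ∀ g : ℕ, ∃ δ : ℝ, 0 < δ ∧ ∃ C : ℝ, 1 ≤ g → ∀ (x : ℝ) (q a : ℕ),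
      1 ≤ x → 1 ≤ q → (q : ℝ) ≤ x ^ (θ - ε) → a.gcd q = g → ¬ a ≡ 0 [MOD q] →
        ‖(∑ n ∈ Finset.Icc 1 ⌊x⌋₊ with n ≡ a [MOD q], (divisorFun j n : ℂ))
            - residueTerm j q g x / (Nat.totient (q / g) : ℂ)‖
          ≤ C * (x ^ (1 - δ) / (Nat.totient (q / g) : ℝ)) := by
    intro g
    by_cases hg : 1 ≤ g
    · obtain ⟨δ, hδ, C, hC⟩ := (hθ g hg).2.2 ε hε
      exact ⟨δ, hδ, C, fun _ => hC⟩
    · exact ⟨1, one_pos, 0, fun h => absurd h hg⟩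
  choose δ hδ C hC using key
  have hne : h.divisors.Nonempty := ⟨1, Nat.one_mem_divisors.2 hh⟩
  set δ₀ := min (h.divisors.inf' hne δ) 1 with hδ₀
  have hδ₀pos : 0 < δ₀ := lt_min ((Finset.lt_inf'_iff hne).2 fun g _ => hδ g) one_pos
  refine ⟨δ₀, hδ₀pos, min_le_right _ _, ∑ g ∈ h.divisors, 2 * |C g|,
    Finset.sum_nonneg fun g _ => by positivity, ?_⟩
  intro x q a b hx hq hqx hab hgh
  have hR : 0 ≤ x ^ (1 - δ₀) * (1 / ((q / a.gcd q).totient : ℝ)) := by positivity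
  have hS : 0 ≤ ∑ g ∈ h.divisors, 2 * |C g| := Finset.sum_nonneg fun g _ => by positivity
  -- The hypothesis excludes the zero class. That class is the only one with gcd q, so then a and b
  -- are congruent and the difference is zero.
  by_cases ha : a ≡ 0 [MOD q]
  · have hb : b ≡ 0 [MOD q] := by
      rw [Nat.modEq_zero_iff_dvd] at ha ⊢
      rw [← Nat.gcd_eq_right_iff_dvd] at ha ⊢
      rw [← hab, ha]
    rw [sum_filter_modEq_congr (ha.trans hb.symm), sub_self, abs_zero]
    positivity
  have hb : ¬ b ≡ 0 [MOD q] := by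
    rw [Nat.modEq_zero_iff_dvd, ← Nat.gcd_eq_right_iff_dvd] at ha ⊢
    rwa [← hab]
  set g := a.gcd q with hg
  have hg1 : 1 ≤ g := Nat.gcd_pos_of_pos_right _ hq
  have e1 := hC g hg1 x q a hx hq hqx hg.symm ha
  have e2 := hC g hg1 x q b hx hq hqx hab.symm hb
  have hgd : g ∈ h.divisors := Nat.mem_divisors.2 ⟨hgh, hh⟩
  have hδg : δ₀ ≤ δ g := (min_le_left _ _).trans (Finset.inf'_le _ hgd)
  have hCg : 2 * |C g| ≤ ∑ g ∈ h.divisors, 2 * |C g| :=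
    Finset.single_le_sum (f := fun g => 2 * |C g|) (fun g _ => by positivity) hgd
  have hcast : ((∑ n ∈ Finset.Icc 1 ⌊x⌋₊ with n ≡ a [MOD q], (divisorFun j n : ℝ)
        - ∑ n ∈ Finset.Icc 1 ⌊x⌋₊ with n ≡ b [MOD q], (divisorFun j n : ℝ) : ℝ) : ℂ)
      = ((∑ n ∈ Finset.Icc 1 ⌊x⌋₊ with n ≡ a [MOD q], (divisorFun j n : ℂ))
            - residueTerm j q g x / (Nat.totient (q / g) : ℂ))
        - ((∑ n ∈ Finset.Icc 1 ⌊x⌋₊ with n ≡ b [MOD q], (divisorFun j n : ℂ))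
            - residueTerm j q g x / (Nat.totient (q / g) : ℂ)) := by
    push_cast
    ring
  rw [← Real.norm_eq_abs, ← Complex.norm_real, hcast]
  refine (norm_sub_le _ _).trans ((add_le_add e1 e2).trans ?_)
  have hxδ : x ^ (1 - δ g) ≤ x ^ (1 - δ₀) := by
    gcongr
  calc C g * (x ^ (1 - δ g) / ((q / g).totient : ℝ)) + C g * (x ^ (1 - δ g) / ((q / g).totient : ℝ))
      = 2 * C g * (x ^ (1 - δ g) * (1 / ((q / g).totient : ℝ))) := by ring
    _ ≤ 2 * |C g| * (x ^ (1 - δ₀) * (1 / ((q / g).totient : ℝ))) := by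
        gcongr
        exact le_abs_self _
    _ ≤ _ := by gcongr

theorem card_Icc_filter_modEq_le (y : ℝ) (hy : 0 ≤ y) {q : ℕ} (hq : 0 < q) (a : ℕ) :
    (((Finset.Icc 1 ⌊y⌋₊).filter fun n => n ≡ a [MOD q]).card : ℝ) ≤ y / q + 1 := by
  have h1 := Nat.Ioc_filter_modEq_card 0 ⌊y⌋₊ hq a
  have h2 : Finset.Ioc 0 ⌊y⌋₊ = Finset.Icc 1 ⌊y⌋₊ := by
    ext n; simp [Nat.lt_iff_add_one_le]
  rw [h2] at h1
  set N := ((Finset.Icc 1 ⌊y⌋₊).filter fun n => n ≡ a [MOD q]).card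
  have hq' : (0 : ℚ) < q := by exact_mod_cast hq
  have h3 : ((N : ℤ) : ℚ) ≤ (⌊y⌋₊ : ℚ) / q + 1 := by
    rw [h1]
    push_cast
    apply max_le
    · have e1 := Int.floor_le (((⌊y⌋₊ : ℚ) - a) / q)
      have e2 := Int.lt_floor_add_one (((0 : ℚ) - a) / q)
      have e3 : ((⌊y⌋₊ : ℚ) - a) / q = (⌊y⌋₊ : ℚ) / q + ((0 : ℚ) - a) / q := by ring
      linarith
    · positivity
  have h4 : (N : ℝ) ≤ (⌊y⌋₊ : ℝ) / q + 1 := by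
    have := (Rat.cast_le (K := ℝ)).2 h3
    push_cast at this
    exact this
  refine h4.trans ?_
  gcongr
  exact Nat.floor_le hy

/-- A pointwise bound times the number of terms, for the lengths too short for the distribution
hypothesis. -/
theorem sum_filter_modEq_divisorFun_le (j : ℕ) {η : ℝ} (hη : 0 < η) :
    ∃ C : ℝ, 1 ≤ C ∧ ∀ (Y y : ℝ) (q a : ℕ), 0 ≤ y → y ≤ Y → 1 ≤ q →
      ∑ n ∈ Finset.Icc 1 ⌊y⌋₊ with n ≡ a [MOD q], (divisorFun j n : ℝ)
        ≤ C * Y ^ η * (y / q + 1) := by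
  obtain ⟨C, hC, h⟩ := divisorFun_le_rpow j hη
  refine ⟨C, hC, fun Y y q a hy hyY hq => ?_⟩
  have hY : 0 ≤ Y := hy.trans hyY
  calc _ ≤ ∑ n ∈ Finset.Icc 1 ⌊y⌋₊ with n ≡ a [MOD q], C * Y ^ η := by
        refine Finset.sum_le_sum fun n hn => ?_
        have hn' := (Finset.mem_filter.1 hn).1
        have h1 := natCast_le_of_mem_Icc_floor hn'
        refine (h n (Finset.mem_Icc.1 hn').1).trans ?_
        have : (n : ℝ) ≤ Y := h1.2.trans hyY
        gcongr
    _ = (((Finset.Icc 1 ⌊y⌋₊).filter fun n => n ≡ a [MOD q]).card : ℝ) * (C * Y ^ η) := by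
        rw [Finset.sum_const, nsmul_eq_mul]
    _ ≤ (y / q + 1) * (C * Y ^ η) := by
        gcongr
        exact card_Icc_filter_modEq_le y hy hq a
    _ = _ := by ring

/-- Distribution in residue classes with a bound that is uniform in the length `y ≤ Y`. -/
theorem IsExponentOfDistribution.abs_sum_sub_sum_le_of_le {j : ℕ} {θ β : ℝ}
    (hθ : IsExponentOfDistribution j θ) (hβ0 : 0 < β) (hβ : β < θ) {h : ℕ} (hh : h ≠ 0) :
    ∃ δ : ℝ, 0 < δ ∧ δ ≤ 1 ∧ ∃ C : ℝ, 0 ≤ C ∧ ∀ (Y y : ℝ) (q a b : ℕ), 1 ≤ Y → 0 ≤ y → y ≤ Y →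
      1 ≤ q → (q : ℝ) ≤ Y ^ β → a.gcd q = b.gcd q → a.gcd q ∣ h →
      |∑ n ∈ Finset.Icc 1 ⌊y⌋₊ with n ≡ a [MOD q], (divisorFun j n : ℝ)
        - ∑ n ∈ Finset.Icc 1 ⌊y⌋₊ with n ≡ b [MOD q], (divisorFun j n : ℝ)|
        ≤ C * (Y ^ (1 - δ) / q) := by
  have hθ1 : θ ≤ 1 := (hθ 1 le_rfl).2.1
  obtain ⟨δ₁, hδ₁, hδ₁1, C₁, hC₁, H⟩ := hθ.abs_sum_sub_sum_le hh (ε := (θ - β) / 2) (by linarith)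
  -- The midpoint of β and θ. If q ≤ y^σ the hypothesis applies at y. Otherwise y < 1 or y^σ < q ≤
  -- Y^β, so in either case y ≤ Y^ρ with ρ = β/σ < 1, and the trivial bound saves a power of Y.
  set σ : ℝ := θ - (θ - β) / 2 with hσ
  have hβσ : β < σ := by rw [hσ]; linarith
  have hσ1 : σ < 1 := by rw [hσ]; linarith
  have hσ0 : 0 < σ := hβ0.trans hβσ
  set ρ : ℝ := β / σ with hρ
  have hρ1 : ρ < 1 := (div_lt_one hσ0).2 hβσ
  have hρ0 : 0 < ρ := div_pos hβ0 hσ0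
  have hβρ : β ≤ ρ := by
    rw [hρ, le_div_iff₀ hσ0]
    nlinarith
  obtain ⟨C₂, hC₂, H2⟩ := sum_filter_modEq_divisorFun_le j (η := (1 - ρ) / 2) (by linarith)
  obtain ⟨D, hD, H3⟩ := card_divisors_le_rpow (ε := δ₁ / 2) (by linarith)
  -- Half of δ₁ pays for replacing 1/φ(q/g) by a multiple of 1/q; half of 1 - ρ pays for the
  -- pointwise bound in the short range.
  set δ := min (δ₁ / 2) ((1 - ρ) / 2) with hδ
  have hδ0 : 0 < δ := lt_min (by linarith) (by linarith)
  have hδ1 : δ ≤ 1 := (min_le_left _ _).trans (by linarith)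
  refine ⟨δ, hδ0, hδ1, C₁ * (D * h) + 4 * C₂, by positivity, ?_⟩
  intro Y y q a b hY hy hyY hq hqY hab hgh
  have hY0 : 0 < Y := by linarith
  have hq1 : (1 : ℝ) ≤ q := by exact_mod_cast hq
  have hq0 : (0 : ℝ) < q := by linarith
  by_cases hcase : 1 ≤ y ∧ (q : ℝ) ≤ y ^ σ
  · obtain ⟨hy1, hqy⟩ := hcase
    refine (H y q a b hy1 hq hqy hab hgh).trans ?_
    set g := a.gcd q with hg
    have hgq : g ∣ q := Nat.gcd_dvd_right _ _
    have hg0 : 0 < g := Nat.gcd_pos_of_pos_right _ hq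
    have hs0 : 0 < q / g := Nat.div_pos (Nat.le_of_dvd hq hgq) hg0
    have hgle : (g : ℝ) ≤ h := by exact_mod_cast Nat.le_of_dvd (Nat.pos_of_ne_zero hh) hgh
    have hqY1 : (q : ℝ) ≤ Y := by
      refine hqY.trans ?_
      calc Y ^ β ≤ Y ^ (1 : ℝ) := by
            gcongr
            · linarith
        _ = Y := Real.rpow_one Y
    have h1 : 1 / ((q / g).totient : ℝ) ≤ D * Y ^ (δ₁ / 2) * (h / q) := by
      have hsq : ((q / g : ℕ) : ℝ) ≤ q := by exact_mod_cast Nat.div_le_self q g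
      have hdiv : ((q / g : ℕ) : ℝ) = q / g := by
        rw [Nat.cast_div hgq (by positivity)]
      calc _ ≤ ((q / g).divisors.card : ℝ) / (q / g : ℕ) := inv_totient_le hs0
        _ ≤ (D * ((q / g : ℕ) : ℝ) ^ (δ₁ / 2)) / (q / g : ℕ) := by
            gcongr
            exact H3 _ hs0
        _ ≤ (D * Y ^ (δ₁ / 2)) / (q / g : ℕ) := by
            have := hsq.trans hqY1
            gcongr
        _ = (D * Y ^ (δ₁ / 2)) * (g / q) := by
            rw [hdiv]
            field_simp
        _ ≤ _ := by gcongr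
    calc C₁ * (y ^ (1 - δ₁) * (1 / ((q / g).totient : ℝ)))
        ≤ C₁ * (Y ^ (1 - δ₁) * (D * Y ^ (δ₁ / 2) * (h / q))) := by
          have : 0 ≤ 1 - δ₁ := by linarith
          gcongr
      _ = C₁ * (D * h) * (Y ^ (1 - δ₁ / 2) / q) := by
          have : Y ^ (1 - δ₁ / 2) = Y ^ (1 - δ₁) * Y ^ (δ₁ / 2) := by
            rw [← Real.rpow_add hY0]
            ring_nf
          rw [this]
          ring
      _ ≤ (C₁ * (D * h) + 4 * C₂) * (Y ^ (1 - δ) / q) := by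
          have hδle : δ ≤ δ₁ / 2 := min_le_left _ _
          gcongr
          · linarith
  · have hyb : y ≤ Y ^ ρ := by
      by_cases hy1 : 1 ≤ y
      · have hlt : y ^ σ < q := by
          by_contra hcon
          exact hcase ⟨hy1, not_lt.1 hcon⟩
        have : y ^ σ ≤ Y ^ β := hlt.le.trans hqY
        have h2 : (y ^ σ) ^ σ⁻¹ ≤ (Y ^ β) ^ σ⁻¹ := by gcongr
        rwa [← Real.rpow_mul hy, mul_inv_cancel₀ hσ0.ne', Real.rpow_one, ← Real.rpow_mul hY0.le]
          at h2
      · exact (not_le.1 hy1).le.trans (Real.one_le_rpow hY hρ0.le)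
    have hb1 : y / q + 1 ≤ 2 * (Y ^ ρ / q) := by
      have e1 : y / q ≤ Y ^ ρ / q := by gcongr
      have e2 : 1 ≤ Y ^ ρ / q := by
        rw [le_div_iff₀ hq0, one_mul]
        refine hqY.trans ?_
        gcongr
      linarith
    have hb2 : ∀ c : ℕ, 0 ≤ ∑ n ∈ Finset.Icc 1 ⌊y⌋₊ with n ≡ c [MOD q], (divisorFun j n : ℝ) ∧
        ∑ n ∈ Finset.Icc 1 ⌊y⌋₊ with n ≡ c [MOD q], (divisorFun j n : ℝ)
          ≤ 2 * C₂ * (Y ^ (1 - δ) / q) := by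
      intro c
      refine ⟨Finset.sum_nonneg fun n _ => by positivity, (H2 Y y q c hy hyY hq).trans ?_⟩
      have hδle : δ ≤ (1 - ρ) / 2 := min_le_right _ _
      calc C₂ * Y ^ ((1 - ρ) / 2) * (y / q + 1) ≤ C₂ * Y ^ ((1 - ρ) / 2) * (2 * (Y ^ ρ / q)) := by
            gcongr
        _ = 2 * C₂ * (Y ^ (1 - (1 - ρ) / 2) / q) := by
            have : Y ^ (1 - (1 - ρ) / 2) = Y ^ ((1 - ρ) / 2) * Y ^ ρ := by
              rw [← Real.rpow_add hY0]
              ring_nf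
            rw [this]
            ring
        _ ≤ _ := by
            gcongr
    have ha := hb2 a
    have hb := hb2 b
    have hpos : 0 ≤ C₁ * (D * h) * (Y ^ (1 - δ) / q) := by positivity
    have hpos2 : 0 ≤ Y ^ (1 - δ) / q := by positivity
    rw [abs_le]
    constructor <;> nlinarith

theorem exists_mul_modEq {e q b : ℕ} (hq : 0 < q) (h : e.gcd q ∣ b) :
    ∃ d, e * d ≡ b [MOD q] := by
  obtain ⟨t, rfl⟩ := h
  have hq' : (q : ℤ) ≠ 0 := by exact_mod_cast hq.ne'
  refine ⟨((e.gcdA q * t) % q).toNat, ?_⟩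
  rw [← Int.natCast_modEq_iff]
  push_cast
  rw [Int.toNat_of_nonneg (Int.emod_nonneg _ hq')]
  have h1 : (e : ℤ) * ((e.gcdA q * t) % q) ≡ e * (e.gcdA q * t) [ZMOD q] :=
    Int.ModEq.mul_left _ (Int.mod_modEq _ _)
  refine h1.trans ?_
  rw [Nat.gcd_eq_gcd_ab]
  refine (Int.modEq_iff_dvd.2 ⟨e.gcdB q * t, ?_⟩)
  ring

theorem mul_modEq_iff {e q d d₀ b : ℕ} (hq : 0 < q) (hd₀ : e * d₀ ≡ b [MOD q]) :
    e * d ≡ b [MOD q] ↔ d ≡ d₀ [MOD q / e.gcd q] := by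
  constructor
  · intro h
    have := Nat.ModEq.cancel_left_div_gcd hq (h.trans hd₀.symm)
    rwa [Nat.gcd_comm] at this
  · intro h
    refine Nat.ModEq.trans ?_ hd₀
    have h1 := h.mul_left' (e.gcd q)
    rw [Nat.mul_div_cancel' (Nat.gcd_dvd_right e q)] at h1
    have h2 := h1.mul_left (e / e.gcd q)
    rwa [← mul_assoc, ← mul_assoc, Nat.div_mul_cancel (Nat.gcd_dvd_left e q)] at h2

theorem gcd_eq_mul_gcd_of_mul_modEq {e q d₀ b : ℕ} (hq : 0 < q) (hd₀ : e * d₀ ≡ b [MOD q]) :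
    b.gcd q = e.gcd q * d₀.gcd (q / e.gcd q) := by
  have hr : 0 < e.gcd q := Nat.gcd_pos_of_pos_right _ hq
  have h2 : Nat.Coprime (e / e.gcd q) (q / e.gcd q) := Nat.coprime_div_gcd_div_gcd hr
  rw [← hd₀.gcd_eq]
  calc (e * d₀).gcd q
      = (e.gcd q * (e / e.gcd q * d₀)).gcd (e.gcd q * (q / e.gcd q)) := by
        rw [← mul_assoc, Nat.mul_div_cancel' (Nat.gcd_dvd_left e q),
          Nat.mul_div_cancel' (Nat.gcd_dvd_right e q)]
    _ = _ := by rw [Nat.gcd_mul_left, Nat.Coprime.gcd_mul_left_cancel _ h2]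

/-- Distribution of `d_j(m / e)`, for `m` a multiple of `e` in a residue class. -/
theorem IsExponentOfDistribution.abs_sum_mul_sub_sum_mul_le {j : ℕ} {θ β : ℝ}
    (hθ : IsExponentOfDistribution j θ) (hβ0 : 0 < β) (hβ : β < θ) {h : ℕ} (hh : h ≠ 0) :
    ∃ δ : ℝ, 0 < δ ∧ δ ≤ 1 ∧ ∃ C : ℝ, 0 ≤ C ∧ ∀ (Y y : ℝ) (e q a b : ℕ), 1 ≤ Y → 0 ≤ y → y ≤ Y →
      1 ≤ q → (q : ℝ) ≤ Y ^ β → a.gcd q = b.gcd q → a.gcd q ∣ h →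
      |∑ d ∈ Finset.Icc 1 ⌊y⌋₊ with e * d ≡ a [MOD q], (divisorFun j d : ℝ)
        - ∑ d ∈ Finset.Icc 1 ⌊y⌋₊ with e * d ≡ b [MOD q], (divisorFun j d : ℝ)|
        ≤ C * (Y ^ (1 - δ) / q) := by
  obtain ⟨δ, hδ, hδ1, C, hC, H⟩ := hθ.abs_sum_sub_sum_le_of_le hβ0 hβ hh
  refine ⟨δ, hδ, hδ1, C * h, by positivity, ?_⟩
  intro Y y e q a b hY hy hyY hq hqY hab hgh
  have hr0 : 0 < e.gcd q := Nat.gcd_pos_of_pos_right _ hq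
  have hrq : e.gcd q ∣ q := Nat.gcd_dvd_right e q
  -- If (e, q) does not divide a, it does not divide b either, and both sums are empty. Otherwise
  -- the congruences become classes modulo q/(e, q) that again share their gcd with the modulus; the
  -- smaller modulus costs a factor (e, q) ≤ h.
  by_cases hra : e.gcd q ∣ a
  · have hrg : e.gcd q ∣ a.gcd q := Nat.dvd_gcd hra hrq
    have hrb : e.gcd q ∣ b := by
      rw [hab] at hrg
      exact hrg.trans (Nat.gcd_dvd_left _ _)
    obtain ⟨a', ha'⟩ := exists_mul_modEq hq hra
    obtain ⟨b', hb'⟩ := exists_mul_modEq hq hrb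
    have e1 := gcd_eq_mul_gcd_of_mul_modEq hq ha'
    have e2 := gcd_eq_mul_gcd_of_mul_modEq hq hb'
    simp only [mul_modEq_iff hq ha', mul_modEq_iff hq hb']
    have hs : 1 ≤ q / e.gcd q := Nat.div_pos (Nat.le_of_dvd hq hrq) hr0
    have hsq : ((q / e.gcd q : ℕ) : ℝ) ≤ q := by exact_mod_cast Nat.div_le_self q _
    have hgcd : a'.gcd (q / e.gcd q) = b'.gcd (q / e.gcd q) :=
      Nat.eq_of_mul_eq_mul_left hr0 (by rw [← e1, ← e2, hab])
    refine (H Y y (q / e.gcd q) a' b' hY hy hyY hs (hsq.trans hqY) hgcd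
      ((Dvd.intro_left _ e1.symm).trans hgh)).trans ?_
    have hrh : (e.gcd q : ℝ) ≤ h := by
      exact_mod_cast Nat.le_of_dvd (Nat.pos_of_ne_zero hh) (hrg.trans hgh)
    rw [Nat.cast_div hrq (by positivity)]
    have hq0 : (0 : ℝ) < q := by exact_mod_cast hq
    calc C * (Y ^ (1 - δ) / (q / (e.gcd q : ℝ))) = C * (e.gcd q : ℝ) * (Y ^ (1 - δ) / q) := by
          field_simp
      _ ≤ _ := by gcongr
  · have hrb : ¬ e.gcd q ∣ b := by
      intro hrb
      have : e.gcd q ∣ b.gcd q := Nat.dvd_gcd hrb hrq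
      rw [← hab] at this
      exact hra (this.trans (Nat.gcd_dvd_left _ _))
    have hzero : ∀ c : ℕ, ¬ e.gcd q ∣ c →
        ∑ d ∈ Finset.Icc 1 ⌊y⌋₊ with e * d ≡ c [MOD q], (divisorFun j d : ℝ) = 0 := by
      intro c hc
      rw [Finset.filter_false_of_mem, Finset.sum_empty]
      intro d _ hd
      exact hc ((hd.dvd_iff hrq).1 ((Nat.gcd_dvd_left e q).mul_right d))
    rw [hzero a hra, hzero b hrb, sub_self, abs_zero]
    positivity

/-! ### The partial divisor function in residue classes -/

/-- Turns a side condition linking a divisor to m into a new left endpoint. The final alternative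
locates that endpoint: either it has not moved, or it violates P, which bounds it from above in the
applications. -/
theorem filter_Ioc_eq_of_upward_closed {P : ℕ → Prop} [DecidablePred P]
    (hP : ∀ m n, 1 ≤ m → m ≤ n → P m → P n) {u X : ℕ} (hu : u ≤ X) :
    ∃ u', u' ≤ X ∧ (Finset.Ioc u X).filter P = Finset.Ioc u' X ∧ (u' = u ∨ ¬ P u') := by
  by_cases h : ∃ m, m ∈ Finset.Ioc u X ∧ P m
  · have hex : ∃ m, u < m ∧ P m := by
      obtain ⟨m, hm, hPm⟩ := h
      exact ⟨m, (Finset.mem_Ioc.1 hm).1, hPm⟩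
    classical
    have hs := Nat.find_spec hex
    refine ⟨Nat.find hex - 1, ?_, ?_, ?_⟩
    · obtain ⟨m, hm, hPm⟩ := h
      rw [Finset.mem_Ioc] at hm
      have := Nat.find_min' hex ⟨hm.1, hPm⟩
      omega
    · ext m
      simp only [Finset.mem_filter, Finset.mem_Ioc]
      constructor
      · rintro ⟨⟨h1, h2⟩, h3⟩
        have := Nat.find_min' hex ⟨h1, h3⟩
        omega
      · rintro ⟨h1, h2⟩
        exact ⟨⟨by omega, h2⟩, hP (Nat.find hex) m (by omega) (by omega) hs.2⟩
    · by_cases hu' : Nat.find hex - 1 = u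
      · exact Or.inl hu'
      · have := Nat.find_min hex (m := Nat.find hex - 1) (by omega)
        exact Or.inr fun hPu => this ⟨by omega, hPu⟩
  · refine ⟨X, le_rfl, ?_, ?_⟩
    · rw [Finset.Ioc_self, Finset.filter_eq_empty_iff]
      intro m hm hPm
      exact h ⟨m, hm, hPm⟩
    · rcases hu.eq_or_lt with h1 | h1
      · exact Or.inl h1.symm
      · exact Or.inr fun hX => h ⟨X, Finset.mem_Ioc.2 ⟨h1, le_rfl⟩, hX⟩

-- The divisors d > m^A are exactly the m/e with m^A e < m. In this form the missing part runs over
-- a long variable m/e, to which the distribution of d_j applies for each fixed e.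
open Classical in
theorem partialDivisorFun_eq_sub (j m : ℕ) (A : ℝ) :
    (partialDivisorFun (j + 1) m A : ℝ) = divisorFun (j + 1) m
      - ∑ e ∈ m.divisors.filter (fun e : ℕ => (m : ℝ) ^ A * e < m), (divisorFun j (m / e) : ℝ) := by
  have h1 : (divisorFun (j + 1) m : ℝ) = ∑ d ∈ m.divisors, (divisorFun j d : ℝ) := by
    rw [divisorFun_succ_divisors]
    push_cast
    rfl
  have h2 : ∑ e ∈ m.divisors.filter (fun e : ℕ => (m : ℝ) ^ A * e < m), (divisorFun j (m / e) : ℝ)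
      = ∑ d ∈ m.divisors.filter (fun d : ℕ => ¬ (d : ℝ) ≤ (m : ℝ) ^ A), (divisorFun j d : ℝ) := by
    rw [Finset.sum_filter, Finset.sum_filter,
      ← Nat.sum_div_divisors m (fun d => if ¬ (d : ℝ) ≤ (m : ℝ) ^ A then (divisorFun j d : ℝ) else 0)]
    refine Finset.sum_congr rfl fun e he => ?_
    have he0 : (0 : ℝ) < e := by exact_mod_cast Nat.pos_of_mem_divisors he
    have hiff : (m : ℝ) ^ A * e < m ↔ ¬ ((m / e : ℕ) : ℝ) ≤ (m : ℝ) ^ A := by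
      rw [Nat.cast_div (Nat.dvd_of_mem_divisors he) he0.ne', not_le, lt_div_iff₀ he0]
    simp only [hiff]
  rw [h1, h2, partialDivisorFun, Nat.add_sub_cancel]
  push_cast
  rw [← Finset.sum_filter_add_sum_filter_not m.divisors (fun d : ℕ => (d : ℝ) ≤ (m : ℝ) ^ A)]
  ring

theorem rpow_mul_lt_upward_closed {A : ℝ} (hA1 : A ≤ 1) (e : ℕ) (m n : ℕ)
    (hm : 1 ≤ m) (hmn : m ≤ n) (h : (m : ℝ) ^ A * e < m) : (n : ℝ) ^ A * e < n := by
  have hm0 : (0 : ℝ) < m := by exact_mod_cast hm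
  have hmn' : (m : ℝ) ≤ n := by exact_mod_cast hmn
  have hn0 : (0 : ℝ) < n := by linarith
  have h1 : (1 : ℝ) ≤ n / m := by rwa [le_div_iff₀ hm0, one_mul]
  have h2 : ((n : ℝ) / m) ^ A ≤ n / m := by
    calc ((n : ℝ) / m) ^ A ≤ ((n : ℝ) / m) ^ (1 : ℝ) := by gcongr
      _ = _ := Real.rpow_one _
  calc (n : ℝ) ^ A * e = ((n : ℝ) / m) ^ A * ((m : ℝ) ^ A * e) := by
        rw [Real.div_rpow hn0.le hm0.le]
        field_simp
    _ < ((n : ℝ) / m) ^ A * m := by gcongr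
    _ ≤ (n / m) * m := by gcongr
    _ = n := by field_simp

theorem sum_Ioc_eq_sub {M : Type*} [AddCommGroup M] (f : ℕ → M) {u X : ℕ} (hu : u ≤ X)
    (P : ℕ → Prop) [DecidablePred P] :
    ∑ m ∈ Finset.Ioc u X with P m, f m
      = ∑ m ∈ Finset.Icc 1 X with P m, f m - ∑ m ∈ Finset.Icc 1 u with P m, f m := by
  have h1 : (Finset.Icc 1 X).filter P
      = (Finset.Icc 1 u).filter P ∪ (Finset.Ioc u X).filter P := by
    rw [← Finset.filter_union]
    congr 1
    ext n
    simp only [Finset.mem_Icc, Finset.mem_union, Finset.mem_Ioc]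
    omega
  have h2 : Disjoint ((Finset.Icc 1 u).filter P) ((Finset.Ioc u X).filter P) := by
    apply Finset.disjoint_filter_filter
    rw [Finset.disjoint_left]
    intro n hn hn'
    simp only [Finset.mem_Icc, Finset.mem_Ioc] at hn hn'
    omega
  rw [h1, Finset.sum_union h2]
  abel

open Classical in
/-- The part of `d_{j+1}(m)` that is missing from `d_{j+1}(m, A)`, summed over a residue class. -/
theorem sum_partialDivisorFun_modEq_eq (j : ℕ) (A : ℝ) (u X q a : ℕ) :
    ∑ m ∈ Finset.Ioc u X with m ≡ a [MOD q], (partialDivisorFun (j + 1) m A : ℝ)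
      = ∑ m ∈ Finset.Ioc u X with m ≡ a [MOD q], (divisorFun (j + 1) m : ℝ)
        - ∑ e ∈ Finset.Icc 1 X,
          ∑ m ∈ (Finset.Ioc u X).filter (fun m : ℕ => (m : ℝ) ^ A * e < m)
            with e ∣ m ∧ m ≡ a [MOD q], (divisorFun j (m / e) : ℝ) := by
  have h1 : ∑ e ∈ Finset.Icc 1 X,
      ∑ m ∈ (Finset.Ioc u X).filter (fun m : ℕ => (m : ℝ) ^ A * e < m)
            with e ∣ m ∧ m ≡ a [MOD q], (divisorFun j (m / e) : ℝ)
      = ∑ m ∈ Finset.Ioc u X with m ≡ a [MOD q],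
        ∑ e ∈ m.divisors.filter (fun e : ℕ => (m : ℝ) ^ A * e < m), (divisorFun j (m / e) : ℝ) := by
    apply Finset.sum_comm'
    intro e m
    simp only [Finset.mem_filter, Finset.mem_Ioc, Finset.mem_Icc, Nat.mem_divisors]
    constructor
    · rintro ⟨⟨h1, h2⟩, ⟨⟨h3, h4⟩, h5⟩, h6, h7⟩
      exact ⟨⟨⟨h6, by omega⟩, h5⟩, ⟨h3, h4⟩, h7⟩
    · rintro ⟨⟨⟨h6, h0⟩, h5⟩, ⟨h3, h4⟩, h7⟩
      have := Nat.le_of_dvd (by omega) h6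
      exact ⟨⟨Nat.pos_of_dvd_of_pos h6 (by omega), by omega⟩, ⟨⟨h3, h4⟩, h5⟩, h6, h7⟩
  rw [h1, ← Finset.sum_sub_distrib]
  exact Finset.sum_congr rfl fun m _ => partialDivisorFun_eq_sub j m A

theorem sum_Ioc_filter_dvd_modEq (f : ℕ → ℝ) {e : ℕ} (he : 1 ≤ e) {u X : ℕ} (hu : u ≤ X) (q a : ℕ) :
    ∑ m ∈ Finset.Ioc u X with e ∣ m ∧ m ≡ a [MOD q], f (m / e)
      = ∑ d ∈ Finset.Icc 1 ⌊(X : ℝ) / e⌋₊ with e * d ≡ a [MOD q], f d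
        - ∑ d ∈ Finset.Icc 1 ⌊(u : ℝ) / e⌋₊ with e * d ≡ a [MOD q], f d := by
  have h1 : ∀ N : ℕ, ∑ m ∈ Finset.Icc 1 N with e ∣ m ∧ m ≡ a [MOD q], f (m / e)
      = ∑ d ∈ Finset.Icc 1 ⌊(N : ℝ) / e⌋₊ with e * d ≡ a [MOD q], f d := by
    intro N
    rw [← Finset.filter_filter, Finset.sum_filter,
      sum_Icc_filter_dvd _ N e he, Nat.floor_div_natCast, Nat.floor_natCast, ← Finset.sum_filter]
    refine Finset.sum_congr rfl fun d _ => ?_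
    rw [Nat.mul_div_cancel_left _ he]
  rw [sum_Ioc_eq_sub _ hu, h1, h1]

/-- Distribution of the partial divisor function in residue classes with a given gcd. -/
theorem exists_abs_sum_partialDivisorFun_sub_le (h j : ℕ) (hh : h ≠ 0) {A B θ θ' : ℝ} (hA0 : 0 < A)
    (hA1 : A ≤ 1) (hθ : IsExponentOfDistribution (j + 1) θ) (hθ' : IsExponentOfDistribution j θ')
    (hB0 : 0 < B) (hB : B < min θ (A * θ')) :
    ∃ δ : ℝ, 0 < δ ∧ δ ≤ 1 ∧ ∃ C : ℝ, 0 ≤ C ∧ ∀ (u X q a b : ℕ), 1 ≤ X → u ≤ X → 1 ≤ q →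
      (q : ℝ) ≤ (X : ℝ) ^ B → a.gcd q = b.gcd q → a.gcd q ∣ h →
      |∑ m ∈ Finset.Ioc u X with m ≡ a [MOD q], (partialDivisorFun (j + 1) m A : ℝ)
        - ∑ m ∈ Finset.Ioc u X with m ≡ b [MOD q], (partialDivisorFun (j + 1) m A : ℝ)|
        ≤ C * ((X : ℝ) ^ (1 - δ) / q) := by
  obtain ⟨hB1, hB2⟩ := lt_min_iff.1 hB
  obtain ⟨δ₁, hδ₁, hδ₁1, C₁, hC₁, H₁⟩ := hθ.abs_sum_sub_sum_le_of_le hB0 hB1 hh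
  have hBA : B / A < θ' := by rwa [div_lt_iff₀' hA0]
  obtain ⟨δ₂, hδ₂, hδ₂1, C₂, hC₂, H₂⟩ :=
    hθ'.abs_sum_mul_sub_sum_mul_le (div_pos hB0 hA0) hBA hh
  -- For each e the error is X^(1 - Aδ₂)/(qe) up to a constant. Half of the saving A δ₂ absorbs the
  -- logarithm from summing 1/e.
  set κ : ℝ := A * δ₂ / 2 with hκ
  have hκ0 : 0 < κ := by positivity
  have hκ1 : κ ≤ 1 := by
    rw [hκ]
    nlinarith
  set δ := min δ₁ κ with hδ
  refine ⟨δ, lt_min hδ₁ hκ0, (min_le_left _ _).trans hδ₁1, 2 * C₁ + 2 * C₂ * κ⁻¹,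
    by positivity, ?_⟩
  intro u X q a b hX hu hq hqX hab hgh
  have hX1 : (1 : ℝ) ≤ X := by exact_mod_cast hX
  have hX0 : (0 : ℝ) < X := by linarith
  have hq0 : (0 : ℝ) < q := by exact_mod_cast hq
  rw [sum_partialDivisorFun_modEq_eq, sum_partialDivisorFun_modEq_eq]
  have huX : (u : ℝ) ≤ X := by exact_mod_cast hu
  have t1 : |∑ m ∈ Finset.Ioc u X with m ≡ a [MOD q], (divisorFun (j + 1) m : ℝ)
      - ∑ m ∈ Finset.Ioc u X with m ≡ b [MOD q], (divisorFun (j + 1) m : ℝ)|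
      ≤ 2 * C₁ * ((X : ℝ) ^ (1 - δ) / q) := by
    have e1 := H₁ X X q a b hX1 hX0.le le_rfl hq hqX hab hgh
    have e2 := H₁ X u q a b hX1 (by positivity) huX hq hqX hab hgh
    rw [Nat.floor_natCast] at e1 e2
    have hle : C₁ * ((X : ℝ) ^ (1 - δ₁) / q) ≤ C₁ * ((X : ℝ) ^ (1 - δ) / q) := by
      have : δ ≤ δ₁ := min_le_left _ _
      gcongr
    rw [sum_Ioc_eq_sub _ hu, sum_Ioc_eq_sub _ hu]
    rw [abs_le] at e1 e2 ⊢
    constructor <;> linarith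
  classical
  have t2 : |∑ e ∈ Finset.Icc 1 X,
          ∑ m ∈ (Finset.Ioc u X).filter (fun m : ℕ => (m : ℝ) ^ A * e < m)
            with e ∣ m ∧ m ≡ a [MOD q], (divisorFun j (m / e) : ℝ)
      - ∑ e ∈ Finset.Icc 1 X,
          ∑ m ∈ (Finset.Ioc u X).filter (fun m : ℕ => (m : ℝ) ^ A * e < m)
            with e ∣ m ∧ m ≡ b [MOD q], (divisorFun j (m / e) : ℝ)|
      ≤ 2 * C₂ * κ⁻¹ * ((X : ℝ) ^ (1 - δ) / q) := by
    rw [← Finset.sum_sub_distrib]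
    calc _ ≤ ∑ e ∈ Finset.Icc 1 X, 2 * C₂ * ((X : ℝ) ^ (1 - A * δ₂) / q) * (1 / (e : ℝ)) := by
          refine (Finset.abs_sum_le_sum_abs _ _).trans (Finset.sum_le_sum fun e he => ?_)
          have he1 := (Finset.mem_Icc.1 he).1
          have he0 : (0 : ℝ) < e := by exact_mod_cast he1
          obtain ⟨u', hu'X, hu', _⟩ := filter_Ioc_eq_of_upward_closed
            (P := fun m : ℕ => (m : ℝ) ^ A * e < m) (rpow_mul_lt_upward_closed hA1 e) hu
          rw [hu']
          -- If the condition fails at X it fails at every smaller m, so this e contributes nothing.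
          -- Otherwise X/e exceeds X^A.
          by_cases hPX : (X : ℝ) ^ A * e < X
          · set Y : ℝ := X / e with hY
            have hYA : (X : ℝ) ^ A ≤ Y := by
              rw [hY, le_div_iff₀ he0]
              exact hPX.le
            have hY1 : 1 ≤ Y := (Real.one_le_rpow hX1 hA0.le).trans hYA
            -- This is where B < A θ' enters: relative to the length Y ≥ X^A, the modulus has
            -- exponent B/A < θ'.
            have hqY : (q : ℝ) ≤ Y ^ (B / A) := by
              calc (q : ℝ) ≤ (X : ℝ) ^ B := hqX
                _ = ((X : ℝ) ^ A) ^ (B / A) := by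
                  rw [← Real.rpow_mul hX0.le, mul_div_cancel₀ _ hA0.ne']
                _ ≤ _ := by gcongr
            have hu'Y : (u' : ℝ) / e ≤ Y := by
              rw [hY]
              have : (u' : ℝ) ≤ X := by exact_mod_cast hu'X
              gcongr
            have e1 := H₂ Y Y e q a b hY1 (by linarith) le_rfl hq hqY hab hgh
            have e2 := H₂ Y (u' / e) e q a b hY1 (by positivity) hu'Y hq hqY hab hgh
            rw [sum_Ioc_filter_dvd_modEq (fun d => (divisorFun j d : ℝ)) he1 hu'X,
              sum_Ioc_filter_dvd_modEq (fun d => (divisorFun j d : ℝ)) he1 hu'X]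
            have hle : C₂ * (Y ^ (1 - δ₂) / q)
                ≤ C₂ * ((X : ℝ) ^ (1 - A * δ₂) / q) * (1 / (e : ℝ)) := by
              have h1 : Y ^ (1 - δ₂) ≤ (X : ℝ) ^ (1 - A * δ₂) * (1 / (e : ℝ)) := by
                calc Y ^ (1 - δ₂) = Y * Y ^ (-δ₂) := by
                      rw [sub_eq_add_neg, Real.rpow_add (by linarith), Real.rpow_one]
                  _ ≤ Y * ((X : ℝ) ^ A) ^ (-δ₂) := by
                      gcongr ?_ * ?_
                      exact Real.rpow_le_rpow_of_nonpos (by positivity) hYA (by linarith)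
                  _ = _ := by
                      rw [← Real.rpow_mul hX0.le, sub_eq_add_neg, Real.rpow_add hX0,
                        Real.rpow_one, hY]
                      ring_nf
              calc C₂ * (Y ^ (1 - δ₂) / q)
                  ≤ C₂ * (((X : ℝ) ^ (1 - A * δ₂) * (1 / (e : ℝ))) / q) := by gcongr
                _ = _ := by ring
            rw [abs_le] at e1 e2 ⊢
            constructor <;> linarith
          · have hempty : Finset.Ioc u' X = ∅ := by
              rw [← hu', Finset.filter_eq_empty_iff]
              intro m hm hPm
              rw [Finset.mem_Ioc] at hm
              exact hPX (rpow_mul_lt_upward_closed hA1 e m X (by omega) hm.2 hPm)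
            rw [hempty]
            simp only [Finset.filter_empty, Finset.sum_empty, sub_self, abs_zero]
            positivity
      _ = 2 * C₂ * ((X : ℝ) ^ (1 - A * δ₂) / q) * ∑ e ∈ Finset.Icc 1 X, 1 / (e : ℝ) := by
          rw [Finset.mul_sum]
      _ ≤ 2 * C₂ * ((X : ℝ) ^ (1 - A * δ₂) / q) * (κ⁻¹ * (X : ℝ) ^ κ) := by
          gcongr
          have h1 := sum_inv_le_one_add_log hX1
          rw [Nat.floor_natCast] at h1
          exact h1.trans (one_add_log_le_rpow hκ0 hκ1 hX1)
      _ = 2 * C₂ * κ⁻¹ * ((X : ℝ) ^ (1 - κ) / q) := by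
          have : (X : ℝ) ^ (1 - κ) = (X : ℝ) ^ (1 - A * δ₂) * (X : ℝ) ^ κ := by
            rw [← Real.rpow_add hX0]
            congr 1
            rw [hκ]
            ring
          rw [this]
          ring
      _ ≤ _ := by
          have : δ ≤ κ := min_le_right _ _
          gcongr
  rw [abs_le] at t1 t2 ⊢
  constructor <;> linarith

/-! ### Means over the classes with a given gcd -/

/-- The sum over a class is close to the mean over the classes with the same gcd. -/
theorem abs_sum_modEq_sub_mean_le {f : ℕ → ℝ} {s : Finset ℕ} {q a : ℕ} (hq : 1 ≤ q) {E : ℝ}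
    (hE : ∀ b : ℕ, a.gcd q = b.gcd q →
      |∑ m ∈ s with m ≡ a [MOD q], f m - ∑ m ∈ s with m ≡ b [MOD q], f m| ≤ E) :
    |∑ m ∈ s with m ≡ a [MOD q], f m
      - (∑ m ∈ s with m.gcd q = a.gcd q, f m) / ((q / a.gcd q).totient : ℝ)| ≤ E := by
  set g := a.gcd q with hg
  have hgq : g ∣ q := Nat.gcd_dvd_right _ _
  set R := (Finset.range q).filter fun b => q.gcd b = g with hR
  have hcard : (q / g).totient = R.card := Nat.totient_div_of_dvd hgq
  have hpos : 0 < (q / g).totient :=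
    Nat.totient_pos.2 (Nat.div_pos (Nat.le_of_dvd hq hgq) (Nat.gcd_pos_of_pos_right _ hq))
  -- The gcd with q is constant on residue classes, so the m with gcd g split into the classes in R,
  -- of which there are φ(q/g).
  have hsum : ∑ m ∈ s with m.gcd q = g, f m = ∑ b ∈ R, ∑ m ∈ s with m ≡ b [MOD q], f m := by
    rw [← Finset.sum_fiberwise_of_maps_to (t := R) (g := fun m => m % q)]
    · refine Finset.sum_congr rfl fun b hb => ?_
      rw [Finset.filter_filter]
      refine Finset.sum_congr (Finset.filter_congr fun m _ => ?_) fun _ _ => rfl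
      simp only [hR, Finset.mem_filter, Finset.mem_range] at hb
      have hbq : b % q = b := Nat.mod_eq_of_lt hb.1
      constructor
      · rintro ⟨_, h2⟩
        rw [Nat.ModEq, h2, hbq]
      · intro h2
        refine ⟨?_, by rw [← hbq]; exact h2⟩
        rw [h2.gcd_eq, Nat.gcd_comm, hb.2]
    · intro m hm
      simp only [hR, Finset.mem_filter, Finset.mem_range] at hm ⊢
      refine ⟨Nat.mod_lt _ hq, ?_⟩
      rw [Nat.gcd_comm, (Nat.mod_modEq m q).gcd_eq, hm.2]
  have hR0 : (0 : ℝ) < R.card := by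
    rw [← hcard]
    exact_mod_cast hpos
  rw [hcard, hsum]
  have hid : ∑ m ∈ s with m ≡ a [MOD q], f m
      - (∑ b ∈ R, ∑ m ∈ s with m ≡ b [MOD q], f m) / (R.card : ℝ)
      = (∑ b ∈ R, (∑ m ∈ s with m ≡ a [MOD q], f m - ∑ m ∈ s with m ≡ b [MOD q], f m))
        / (R.card : ℝ) := by
    rw [Finset.sum_sub_distrib, Finset.sum_const, nsmul_eq_mul]
    field_simp
  rw [hid, abs_div, abs_of_pos hR0, div_le_iff₀ hR0]
  calc _ ≤ ∑ b ∈ R, E := by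
        refine (Finset.abs_sum_le_sum_abs _ _).trans (Finset.sum_le_sum fun b hb => hE b ?_)
        rw [Nat.gcd_comm b q]
        exact ((Finset.mem_filter.1 hb).2).symm
    _ = _ := by rw [Finset.sum_const, nsmul_eq_mul, mul_comm]

theorem abs_floor_sub_le_rpow {t κ : ℝ} (ht : 0 ≤ t) (hκ : 0 ≤ κ) (hκ1 : κ ≤ 1) :
    |(⌊t⌋₊ : ℝ) - t| ≤ t ^ κ := by
  have h1 := Nat.floor_le ht
  have h2 := Nat.lt_floor_add_one t
  rw [abs_sub_comm, abs_of_nonneg (by linarith)]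
  rcases le_or_gt 1 t with h | h
  · have := Real.one_le_rpow h hκ
    linarith
  · rw [Nat.floor_eq_zero.2 h, Nat.cast_zero, sub_zero]
    rcases ht.eq_or_lt with rfl | h0
    · positivity
    · calc t = t ^ (1 : ℝ) := (Real.rpow_one t).symm
        _ ≤ _ := Real.rpow_le_rpow_of_exponent_ge h0 h.le hκ1

/-- Counting integers coprime to `s`. -/
theorem abs_card_coprime_sub_le {s : ℕ} (hs : 0 < s) {z κ : ℝ} (hz : 0 ≤ z) (hκ : 0 ≤ κ)
    (hκ1 : κ ≤ 1) :
    |(((Finset.Icc 1 ⌊z⌋₊).filter fun n => n.Coprime s).card : ℝ) - z * ((s.totient : ℝ) / s)|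
      ≤ z ^ κ * ∑ δ ∈ s.divisors, (δ : ℝ) ^ (-κ) := by
  have h1 : (((Finset.Icc 1 ⌊z⌋₊).filter fun n => n.Coprime s).card : ℝ)
      = ∑ δ ∈ s.divisors, (ArithmeticFunction.moebius δ : ℝ) * (⌊z / δ⌋₊ : ℝ) := by
    have := sum_Icc_filter_coprime (fun _ => (1 : ℝ)) ⌊z⌋₊ hs
    simpa [Nat.floor_div_natCast] using this
  rw [h1, ← sum_moebius_div s hs, Finset.mul_sum, Finset.mul_sum, ← Finset.sum_sub_distrib]
  refine (Finset.abs_sum_le_sum_abs _ _).trans (Finset.sum_le_sum fun δ hδ => ?_)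
  have hδ0 : (0 : ℝ) < δ := by exact_mod_cast Nat.pos_of_mem_divisors hδ
  have h2 : (ArithmeticFunction.moebius δ : ℝ) * (⌊z / δ⌋₊ : ℝ)
      - z * ((ArithmeticFunction.moebius δ : ℝ) / δ)
      = (ArithmeticFunction.moebius δ : ℝ) * ((⌊z / δ⌋₊ : ℝ) - z / δ) := by ring
  rw [h2, abs_mul]
  calc _ ≤ 1 * (z / δ) ^ κ := by
        gcongr
        · exact abs_moebius_cast_le_one δ
        · exact abs_floor_sub_le_rpow (by positivity) hκ hκ1
    _ = _ := by
        rw [one_mul, Real.div_rpow hz hδ0.le, Real.rpow_neg hδ0.le]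
        rfl

/-- Both sides are multiplicative. At a prime power the left side is 1 + 1/φ(p), already given by
the divisors 1 and p. -/
theorem div_totient_le_sum (n : ℕ) :
    (n : ℝ) / n.totient ≤ ∑ δ ∈ n.divisors, 1 / (δ.totient : ℝ) := by
  induction n using Nat.recOnPosPrimePosCoprime with
  | zero => simp
  | one => simp
  | prime_pow p a hp ha =>
    obtain ⟨b, rfl⟩ : ∃ b, a = b + 1 := ⟨a - 1, by omega⟩
    have hp1 : (1 : ℝ) < p := by exact_mod_cast hp.one_lt
    have hp0 : (0 : ℝ) < (p : ℝ) - 1 := by linarith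
    have hsub : ({1, p} : Finset ℕ) ⊆ (p ^ (b + 1)).divisors := by
      intro x hx
      have hne : p ^ (b + 1) ≠ 0 := pow_ne_zero _ hp.ne_zero
      simp only [Finset.mem_insert, Finset.mem_singleton] at hx
      rcases hx with rfl | rfl
      · exact Nat.one_mem_divisors.2 hne
      · exact Nat.mem_divisors.2 ⟨dvd_pow_self _ (by omega), hne⟩
    refine le_trans (le_of_eq ?_)
      (Finset.sum_le_sum_of_subset_of_nonneg hsub fun _ _ _ => by positivity)
    rw [Finset.sum_pair hp.one_lt.ne, Nat.totient_prime_pow_succ hp, Nat.totient_prime hp]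
    push_cast [Nat.cast_sub hp.one_le]
    have : (p : ℝ) ^ b ≠ 0 := by positivity
    rw [pow_succ, mul_div_mul_left _ _ this]
    simp only [Nat.totient_one, Nat.cast_one]
    field_simp
    ring
  | coprime m n hm hn hmn ihm ihn =>
    set F : ArithmeticFunction ℝ := ⟨fun r => 1 / (r.totient : ℝ), by simp⟩ with hF
    have hFm : F.IsMultiplicative := by
      refine ⟨by simp [hF], fun {a b} hab => ?_⟩
      simp only [hF, ArithmeticFunction.coe_mk]
      rw [Nat.totient_mul hab]
      push_cast
      rw [one_div_mul_one_div]
    have hG := hFm.mul (ArithmeticFunction.isMultiplicative_zeta.natCast (R := ℝ))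
    have hG2 := hG.2 hmn
    simp only [ArithmeticFunction.coe_mul_zeta_apply] at hG2
    simp only [hF, ArithmeticFunction.coe_mk] at hG2
    rw [hG2, Nat.totient_mul hmn]
    push_cast
    rw [mul_div_mul_comm]
    gcongr

/-- `∑_{δ ∣ n} δ^(-1/2)`. -/
noncomputable def divisorWeight (n : ℕ) : ℝ := ∑ δ ∈ n.divisors, (δ : ℝ) ^ (-(1 / 2) : ℝ)

theorem divisorWeight_mono {m n : ℕ} (hn : n ≠ 0) (h : m ∣ n) :
    divisorWeight m ≤ divisorWeight n :=
  Finset.sum_le_sum_of_subset_of_nonneg (Nat.divisors_subset_of_dvd hn h)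
    fun _ _ _ => by positivity

theorem divisorWeight_nonneg (n : ℕ) : 0 ≤ divisorWeight n :=
  Finset.sum_nonneg fun _ _ => by positivity

/-- Group the pairs (a, b) by their lcm δ: there are at most τ(δ)² ≪ δ^(1/4) of them, and ab ≥ δ. So
each group contributes ≪ δ^(-1/2). -/
theorem sum_divisors_mul_sum_divisors_le :
    ∃ C : ℝ, 0 ≤ C ∧ ∀ n : ℕ, (∑ δ ∈ n.divisors, (δ : ℝ) ^ (-(3 / 4) : ℝ))
      * (∑ δ ∈ n.divisors, (δ : ℝ) ^ (-(3 / 4) : ℝ)) ≤ C * divisorWeight n := by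
  obtain ⟨D, hD, H⟩ := card_divisors_le_rpow (ε := 1 / 8) (by norm_num)
  refine ⟨D * D, by positivity, fun n => ?_⟩
  rw [Finset.sum_mul_sum, ← Finset.sum_product',
    ← Finset.sum_fiberwise_of_maps_to (t := n.divisors) (g := fun x : ℕ × ℕ => x.1.lcm x.2),
    divisorWeight, Finset.mul_sum]
  · refine Finset.sum_le_sum fun δ hδ => ?_
    have hδpos := Nat.pos_of_mem_divisors hδ
    have hδ0 : (0 : ℝ) < δ := by exact_mod_cast hδpos
    calc _ ≤ ∑ x ∈ (n.divisors ×ˢ n.divisors).filter (fun x : ℕ × ℕ => x.1.lcm x.2 = δ),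
          (δ : ℝ) ^ (-(3 / 4) : ℝ) := by
          refine Finset.sum_le_sum fun x hx => ?_
          simp only [Finset.mem_filter, Finset.mem_product] at hx
          have ha := Nat.pos_of_mem_divisors hx.1.1
          have hb := Nat.pos_of_mem_divisors hx.1.2
          rw [← Real.mul_rpow (by positivity) (by positivity)]
          apply Real.rpow_le_rpow_of_nonpos hδ0 _ (by norm_num)
          have : δ ≤ x.1 * x.2 := by
            rw [← hx.2]
            exact Nat.le_of_dvd (Nat.mul_pos ha hb) (Nat.lcm_dvd_mul _ _)
          exact_mod_cast this
      _ ≤ ∑ x ∈ δ.divisors ×ˢ δ.divisors, (δ : ℝ) ^ (-(3 / 4) : ℝ) := by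
          refine Finset.sum_le_sum_of_subset_of_nonneg ?_ fun _ _ _ => by positivity
          intro x hx
          simp only [Finset.mem_filter, Finset.mem_product] at hx
          simp only [Finset.mem_product, Nat.mem_divisors]
          exact ⟨⟨hx.2 ▸ Nat.dvd_lcm_left _ _, hδpos.ne'⟩,
            ⟨hx.2 ▸ Nat.dvd_lcm_right _ _, hδpos.ne'⟩⟩
      _ = (δ.divisors.card : ℝ) * δ.divisors.card * (δ : ℝ) ^ (-(3 / 4) : ℝ) := by
          rw [Finset.sum_const, Finset.card_product, nsmul_eq_mul]
          push_cast
          ring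
      _ ≤ (D * (δ : ℝ) ^ (1 / 8 : ℝ)) * (D * (δ : ℝ) ^ (1 / 8 : ℝ))
            * (δ : ℝ) ^ (-(3 / 4) : ℝ) := by
          have := H δ hδpos
          gcongr
      _ = D * D * ((δ : ℝ) ^ (1 / 8 : ℝ) * (δ : ℝ) ^ (1 / 8 : ℝ)
            * (δ : ℝ) ^ (-(3 / 4) : ℝ)) := by ring
      _ = _ := by
          rw [← Real.rpow_add hδ0, ← Real.rpow_add hδ0]
          norm_num
  · intro x hx
    simp only [Finset.mem_product, Nat.mem_divisors] at hx ⊢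
    exact ⟨Nat.lcm_dvd hx.1.1 hx.2.1, hx.1.2⟩

/-- The ratio n/φ(n) is itself bounded by a divisor sum of δ^(-3/4), so that two such sums get
multiplied. Keeping 1/φ as a divisor weight over n avoids losing a power of n. -/
theorem exists_sum_divisors_div_totient_le :
    ∃ C : ℝ, 0 ≤ C ∧ ∀ n : ℕ, 0 < n →
      (∑ δ ∈ n.divisors, (δ : ℝ) ^ (-(3 / 4) : ℝ)) / n.totient ≤ C * (divisorWeight n / n) := by
  obtain ⟨C, hC, H⟩ := sum_divisors_mul_sum_divisors_le
  obtain ⟨D, hD, H'⟩ := card_divisors_le_rpow (ε := 1 / 4) (by norm_num)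
  refine ⟨D * C, by positivity, fun n hn => ?_⟩
  have hn0 : (0 : ℝ) < n := by exact_mod_cast hn
  have hφ : (0 : ℝ) < n.totient := by exact_mod_cast Nat.totient_pos.2 hn
  set S := ∑ δ ∈ n.divisors, (δ : ℝ) ^ (-(3 / 4) : ℝ) with hS
  have hS0 : 0 ≤ S := Finset.sum_nonneg fun _ _ => by positivity
  have h1 : (n : ℝ) / n.totient ≤ D * S := by
    refine (div_totient_le_sum n).trans ?_
    rw [hS, Finset.mul_sum]
    refine Finset.sum_le_sum fun δ hδ => ?_
    have hδpos := Nat.pos_of_mem_divisors hδ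
    have hδ0 : (0 : ℝ) < δ := by exact_mod_cast hδpos
    calc _ ≤ (δ.divisors.card : ℝ) / δ := inv_totient_le hδpos
      _ ≤ D * (δ : ℝ) ^ (1 / 4 : ℝ) / δ := by
          gcongr
          exact H' δ hδpos
      _ = D * ((δ : ℝ) ^ (1 / 4 : ℝ) / δ) := by ring
      _ = _ := by
          rw [← Real.rpow_sub_one hδ0.ne']
          norm_num
  calc S / n.totient = (n / n.totient) * S / n := by field_simp
    _ ≤ (D * S) * S / n := by gcongr
    _ = D * (S * S) / n := by ring
    _ ≤ D * (C * divisorWeight n) / n :=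
        div_le_div_of_nonneg_right (mul_le_mul_of_nonneg_left (H n) (by positivity)) hn0.le
    _ = _ := by ring

/-- The density `1_{(d,q) ∣ h} / lcm(d,q)`. -/
noncomputable def pairWeight (h d q : ℕ) : ℝ :=
  (if d.gcd q ∣ h then ((d.gcd q : ℕ) : ℝ) else 0) / (d * q)

theorem pairWeight_nonneg (h d q : ℕ) : 0 ≤ pairWeight h d q := by
  unfold pairWeight
  split_ifs <;> positivity

theorem pairWeight_le {h : ℕ} (hh : h ≠ 0) (d q : ℕ) : pairWeight h d q ≤ h * (1 / d * (1 / q)) := by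
  unfold pairWeight
  rw [one_div_mul_one_div, mul_one_div]
  gcongr
  split_ifs with hd
  · exact_mod_cast Nat.le_of_dvd (Nat.pos_of_ne_zero hh) hd
  · positivity

/-- With r = (d, q) and g = (h, q), the count is empty unless r ∣ g. Otherwise q = r·t·s with g =
r·t, and m = d·t·n with n prime to s. The density φ(s)/s of such n cancels the division by φ(q/g) =
φ(s), leaving N/(dts) = N·r/(dq). -/
theorem exists_abs_card_Icc_sub_le {h : ℕ} (hh : h ≠ 0) :
    ∃ C : ℝ, 0 ≤ C ∧ ∀ N d q : ℕ, 1 ≤ d → 1 ≤ q →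
      |(((Finset.Icc 1 N).filter fun m => d ∣ m ∧ m.gcd q = h.gcd q).card : ℝ)
          / ((q / h.gcd q).totient : ℝ) - N * pairWeight h d q|
        ≤ C * (((N : ℝ) / d) ^ (3 / 4 : ℝ) * (divisorWeight q / q)) := by
  obtain ⟨C, hC, H⟩ := exists_sum_divisors_div_totient_le
  refine ⟨C * h, by positivity, fun N d q hd hq => ?_⟩
  have hd0 : (0 : ℝ) < d := by exact_mod_cast hd
  have hq0 : (0 : ℝ) < q := by exact_mod_cast hq
  set g := h.gcd q with hg
  have hg0 : 0 < g := Nat.gcd_pos_of_pos_right _ hq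
  have hgq : g ∣ q := Nat.gcd_dvd_right _ _
  have hgh : g ∣ h := Nat.gcd_dvd_left _ _
  set r := d.gcd q with hr
  have hr0 : 0 < r := Nat.gcd_pos_of_pos_right _ hq
  have hrq : r ∣ q := Nat.gcd_dvd_right _ _
  have hWq := divisorWeight_nonneg q
  by_cases hrh : r ∣ h
  · have hrg : r ∣ g := Nat.dvd_gcd hrh hrq
    obtain ⟨t, ht⟩ := hrg
    obtain ⟨s, hs⟩ := hgq
    have ht0 : 0 < t := Nat.pos_of_ne_zero (by rintro rfl; omega)
    have hs0 : 0 < s := Nat.pos_of_ne_zero (by rintro rfl; omega)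
    have hqr : q / r = t * s := by
      rw [hs, ht, mul_assoc, Nat.mul_div_cancel_left _ hr0]
    have hqg : q / g = s := by rw [hs, Nat.mul_div_cancel_left _ hg0]
    set z : ℝ := (N : ℝ) / d / t with hz
    have hz0 : 0 ≤ z := by positivity
    have hcount : ((Finset.Icc 1 N).filter fun m => d ∣ m ∧ m.gcd q = g).card
        = ((Finset.Icc 1 ⌊z⌋₊).filter fun n => n.Coprime s).card := by
      have hfl : ⌊z⌋₊ = N / d / t := by
        rw [hz, Nat.floor_div_natCast, Nat.floor_div_natCast, Nat.floor_natCast]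
      rw [Finset.card_eq_sum_ones, ← Finset.filter_filter, Finset.sum_filter,
        sum_Icc_filter_dvd _ N d hd]
      have hcond : ∀ e, (d * e).gcd q = g ↔ e.gcd (q / r) = t := by
        intro e
        rw [gcd_eq_mul_gcd_of_mul_modEq hq (Nat.ModEq.refl (d * e)), ht]
        exact Nat.mul_right_inj hr0.ne'
      simp only [hcond]
      rw [← Finset.sum_filter, sum_Icc_filter_gcd_eq _ _ (by rw [hqr]; exact dvd_mul_right _ _) ht0,
        hqr, Nat.mul_div_cancel_left _ ht0, hfl, Finset.card_eq_sum_ones]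
    rw [hcount, hqg]
    have hφ : (0 : ℝ) < s.totient := by exact_mod_cast Nat.totient_pos.2 hs0
    have hs0' : (0 : ℝ) < s := by exact_mod_cast hs0
    have ht0' : (0 : ℝ) < t := by exact_mod_cast ht0
    have hr0' : (0 : ℝ) < r := by exact_mod_cast hr0
    have hmain := abs_card_coprime_sub_le hs0 hz0 (κ := 3 / 4) (by norm_num) (by norm_num)
    have hw : (N : ℝ) * pairWeight h d q = z * ((s.totient : ℝ) / s) / s.totient := by
      have hqc : (q : ℝ) = r * t * s := by rw [hs, ht]; push_cast; ring
      rw [pairWeight, ← hr, if_pos hrh, hz, hqc]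
      field_simp
    rw [hw, ← sub_div, abs_div, abs_of_pos hφ]
    have hzle : z ≤ N / d := div_le_self (by positivity) (by exact_mod_cast ht0)
    have hsq : s ∣ q := ⟨g, by rw [hs, mul_comm]⟩
    have hgle : (g : ℝ) ≤ h := by exact_mod_cast Nat.le_of_dvd (Nat.pos_of_ne_zero hh) hgh
    have hg0' : (0 : ℝ) < g := by exact_mod_cast hg0
    calc _ ≤ z ^ (3 / 4 : ℝ) * (∑ δ ∈ s.divisors, (δ : ℝ) ^ (-(3 / 4) : ℝ)) / s.totient := by
          gcongr
      _ = z ^ (3 / 4 : ℝ) * ((∑ δ ∈ s.divisors, (δ : ℝ) ^ (-(3 / 4) : ℝ)) / s.totient) := by ring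
      _ ≤ z ^ (3 / 4 : ℝ) * (C * (divisorWeight s / s)) := by
          gcongr
          exact H s hs0
      _ ≤ ((N : ℝ) / d) ^ (3 / 4 : ℝ) * (C * (divisorWeight q / s)) := by
          have := divisorWeight_mono (by omega) hsq
          have := divisorWeight_nonneg s
          gcongr
      _ = ((N : ℝ) / d) ^ (3 / 4 : ℝ) * (C * g * (divisorWeight q / q)) := by
          have hqc : (q : ℝ) = g * s := by rw [hs]; push_cast; ring
          rw [hqc]
          field_simp
      _ ≤ ((N : ℝ) / d) ^ (3 / 4 : ℝ) * (C * h * (divisorWeight q / q)) := by gcongr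
      _ = _ := by ring
  · have hempty : ((Finset.Icc 1 N).filter fun m => d ∣ m ∧ m.gcd q = g) = ∅ := by
      rw [Finset.filter_eq_empty_iff]
      rintro m _ ⟨h1, h2⟩
      apply hrh
      have : r ∣ m.gcd q := Nat.dvd_gcd ((Nat.gcd_dvd_left d q).trans h1) hrq
      rw [h2] at this
      exact this.trans hgh
    rw [hempty, pairWeight, ← hr, if_neg hrh]
    simp only [Finset.card_empty, Nat.cast_zero, zero_div, mul_zero, sub_self, abs_zero]
    positivity

theorem exists_abs_card_Ioc_sub_le {h : ℕ} (hh : h ≠ 0) :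
    ∃ C : ℝ, 0 ≤ C ∧ ∀ u X d q : ℕ, u ≤ X → 1 ≤ d → 1 ≤ q →
      |(((Finset.Ioc u X).filter fun m => d ∣ m ∧ m.gcd q = h.gcd q).card : ℝ)
          / ((q / h.gcd q).totient : ℝ) - (X - u) * pairWeight h d q|
        ≤ C * (((X : ℝ) / d) ^ (3 / 4 : ℝ) * (divisorWeight q / q)) := by
  obtain ⟨C, hC, H⟩ := exists_abs_card_Icc_sub_le hh
  refine ⟨2 * C, by positivity, fun u X d q hu hd hq => ?_⟩
  have h1 := H X d q hd hq
  have h2 := H u d q hd hq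
  have h3 : (((Finset.Ioc u X).filter fun m => d ∣ m ∧ m.gcd q = h.gcd q).card : ℝ)
      = ((Finset.Icc 1 X).filter fun m => d ∣ m ∧ m.gcd q = h.gcd q).card
        - ((Finset.Icc 1 u).filter fun m => d ∣ m ∧ m.gcd q = h.gcd q).card := by
    have := sum_Ioc_eq_sub (fun _ => (1 : ℝ)) hu (fun m => d ∣ m ∧ m.gcd q = h.gcd q)
    simpa using this
  have h4 : C * (((u : ℝ) / d) ^ (3 / 4 : ℝ) * (divisorWeight q / q))
      ≤ C * (((X : ℝ) / d) ^ (3 / 4 : ℝ) * (divisorWeight q / q)) := by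
    have : (u : ℝ) ≤ X := by exact_mod_cast hu
    have := divisorWeight_nonneg q
    gcongr
  rw [h3, sub_div, sub_mul]
  rw [abs_le] at h1 h2 ⊢
  constructor <;> linarith

open Classical in
/-- The mean of `d_{i+1}(m, A)` over the `m` with `(m, q) = (h, q)`. -/
theorem exists_abs_mean_partialDivisorFun_sub_le {h : ℕ} (hh : h ≠ 0) (i : ℕ) {A : ℝ}
    (hA0 : 0 < A) :
    ∃ C : ℝ, 0 ≤ C ∧ ∀ u X q : ℕ, 1 ≤ X → u ≤ X → 1 ≤ q →
      |(∑ m ∈ Finset.Ioc u X with m.gcd q = h.gcd q, (partialDivisorFun (i + 1) m A : ℝ))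
          / ((q / h.gcd q).totient : ℝ)
        - X * ∑ d ∈ Finset.Icc 1 ⌊(X : ℝ) ^ A⌋₊, (divisorFun i d : ℝ) * pairWeight h d q|
      ≤ C * (divisorWeight q / q) * ∑ d ∈ Finset.Icc 1 ⌊(X : ℝ) ^ A⌋₊,
            (divisorFun i d : ℝ) * ((X : ℝ) / d) ^ (3 / 4 : ℝ)
        + ∑ d ∈ Finset.Icc 1 ⌊(X : ℝ) ^ A⌋₊,
            (divisorFun i d : ℝ) * pairWeight h d q * (u + (d : ℝ) ^ (1 / A)) := by
  obtain ⟨C, hC, H⟩ := exists_abs_card_Ioc_sub_le hh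
  refine ⟨C, hC, fun u X q hX hu hq => ?_⟩
  have hX0 : (0 : ℝ) < X := by exact_mod_cast hX
  set φ : ℝ := ((q / h.gcd q).totient : ℝ) with hφ
  have hup : ∀ d m n : ℕ, 1 ≤ m → m ≤ n → (d : ℝ) ≤ (m : ℝ) ^ A → (d : ℝ) ≤ (n : ℝ) ^ A := by
    intro d m n _ hmn hd
    have : (m : ℝ) ≤ n := by exact_mod_cast hmn
    exact hd.trans (by gcongr)
  have hex : ∀ d : ℕ, ∃ v : ℕ, v ≤ X ∧ (Finset.Ioc u X).filter (fun m : ℕ => (d : ℝ) ≤ (m : ℝ) ^ A)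
      = Finset.Ioc v X ∧ (v = u ∨ ¬ (d : ℝ) ≤ (v : ℝ) ^ A) := fun d =>
    filter_Ioc_eq_of_upward_closed (P := fun m : ℕ => (d : ℝ) ≤ (m : ℝ) ^ A) (hup d) hu
  choose v hvX hv hv' using hex
  have hswap : ∑ m ∈ Finset.Ioc u X with m.gcd q = h.gcd q, (partialDivisorFun (i + 1) m A : ℝ)
      = ∑ d ∈ Finset.Icc 1 ⌊(X : ℝ) ^ A⌋₊, (divisorFun i d : ℝ) *
        (((Finset.Ioc (v d) X).filter fun m => d ∣ m ∧ m.gcd q = h.gcd q).card : ℝ) := by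
    calc _ = ∑ m ∈ Finset.Ioc u X with m.gcd q = h.gcd q,
          ∑ d ∈ m.divisors.filter (fun d : ℕ => (d : ℝ) ≤ (m : ℝ) ^ A), (divisorFun i d : ℝ) := by
          refine Finset.sum_congr rfl fun m _ => ?_
          rw [partialDivisorFun, Nat.add_sub_cancel]
          push_cast
          rfl
      _ = ∑ d ∈ Finset.Icc 1 ⌊(X : ℝ) ^ A⌋₊,
          ∑ m ∈ (Finset.Ioc (v d) X).filter (fun m => d ∣ m ∧ m.gcd q = h.gcd q),
            (divisorFun i d : ℝ) := by
          apply Finset.sum_comm'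
          intro m d
          rw [← hv d]
          simp only [Finset.mem_filter, Finset.mem_Ioc, Finset.mem_Icc, Nat.mem_divisors]
          constructor
          · rintro ⟨⟨⟨h1, h2⟩, h3⟩, ⟨h4, h5⟩, h6⟩
            have hd1 : 1 ≤ d := Nat.pos_of_dvd_of_pos h4 (by omega)
            refine ⟨⟨⟨⟨h1, h2⟩, h6⟩, h4, h3⟩, hd1, ?_⟩
            rw [Nat.le_floor_iff' (by omega)]
            exact hup d m X (by omega) h2 h6
          · rintro ⟨⟨⟨⟨h1, h2⟩, h6⟩, h4, h3⟩, hd1, _⟩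
            exact ⟨⟨⟨h1, h2⟩, h3⟩, ⟨h4, by omega⟩, h6⟩
      _ = _ := by
          refine Finset.sum_congr rfl fun d _ => ?_
          rw [Finset.sum_const, nsmul_eq_mul, mul_comm]
  rw [hswap, Finset.sum_div, Finset.mul_sum, ← Finset.sum_sub_distrib, Finset.mul_sum,
    ← Finset.sum_add_distrib]
  refine (Finset.abs_sum_le_sum_abs _ _).trans (Finset.sum_le_sum fun d hd => ?_)
  have hd1 := (Finset.mem_Icc.1 hd).1
  have hd0 : (0 : ℝ) < d := by exact_mod_cast hd1
  have hw := pairWeight_nonneg h d q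
  have hcard := H (v d) X d q (hvX d) hd1 hq
  -- The endpoint is u itself or violates d ≤ v^A; the bound covers both. It measures what is lost
  -- when X - v(d) is replaced by X in the main term.
  have hvle : (v d : ℝ) ≤ u + (d : ℝ) ^ (1 / A) := by
    rcases hv' d with h1 | h1
    · rw [h1]
      have : 0 ≤ (d : ℝ) ^ (1 / A) := by positivity
      linarith
    · have h2 : (v d : ℝ) ^ A ≤ d := (not_le.1 h1).le
      have h3 : ((v d : ℝ) ^ A) ^ (1 / A) ≤ (d : ℝ) ^ (1 / A) := by gcongr
      rw [← Real.rpow_mul (by positivity), mul_one_div_cancel hA0.ne', Real.rpow_one] at h3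
      have : (0 : ℝ) ≤ u := by positivity
      linarith
  set c : ℝ := (((Finset.Ioc (v d) X).filter fun m => d ∣ m ∧ m.gcd q = h.gcd q).card : ℝ)
  have hid : (divisorFun i d : ℝ) * c / φ - X * ((divisorFun i d : ℝ) * pairWeight h d q)
      = (divisorFun i d : ℝ) * ((c / φ - (X - v d) * pairWeight h d q)
        - v d * pairWeight h d q) := by ring
  rw [hid, abs_mul, abs_of_nonneg (by positivity : (0 : ℝ) ≤ divisorFun i d)]
  calc _ ≤ (divisorFun i d : ℝ) * (C * (((X : ℝ) / d) ^ (3 / 4 : ℝ) * (divisorWeight q / q))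
        + (u + (d : ℝ) ^ (1 / A)) * pairWeight h d q) := by
        gcongr
        refine (abs_sub _ _).trans ?_
        rw [abs_of_nonneg (by positivity : 0 ≤ (v d : ℝ) * pairWeight h d q)]
        gcongr
    _ = _ := by ring

/-- After interchanging summations, e ∣ q carries e^(-1/2) and the sum over multiples of e carries
e^(-3/4). The series of e^(-5/4) converges, so the divisor weight costs no logarithm. -/
theorem exists_sum_divisorFun_mul_divisorWeight_le (j : ℕ) :
    ∃ C : ℝ, 0 ≤ C ∧ ∀ Q : ℝ, 1 ≤ Q →
      ∑ q ∈ Finset.Icc 1 ⌊Q⌋₊, (divisorFun j q : ℝ) * (divisorWeight q / q)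
        ≤ C * (1 + Real.log Q) ^ j := by
  obtain ⟨C, hC, H⟩ := multipleSum_le j (η := 1 / 4) (by norm_num)
  have hsum : Summable fun e : ℕ => (e : ℝ) ^ (-(5 / 4) : ℝ) :=
    Real.summable_nat_rpow.2 (by norm_num)
  set S : ℝ := ∑' e : ℕ, (e : ℝ) ^ (-(5 / 4) : ℝ) with hS
  have hS0 : 0 ≤ S := tsum_nonneg fun _ => by positivity
  refine ⟨C * S, by positivity, fun Q hQ => ?_⟩
  have hL := one_le_one_add_log hQ
  calc _ = ∑ e ∈ Finset.Icc 1 ⌊Q⌋₊, (e : ℝ) ^ (-(1 / 2) : ℝ) * multipleSum j Q e := by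
        unfold multipleSum
        simp only [Finset.mul_sum]
        rw [Finset.sum_comm]
        refine Finset.sum_congr rfl fun q hq => ?_
        rw [Finset.mem_Icc] at hq
        unfold divisorWeight
        rw [Finset.sum_div, Finset.mul_sum]
        have hdiv : q.divisors = (Finset.Icc 1 ⌊Q⌋₊).filter fun e => e ∣ q := by
          ext e
          simp only [Nat.mem_divisors, Finset.mem_filter, Finset.mem_Icc]
          constructor
          · rintro ⟨h1, _⟩
            exact ⟨⟨Nat.pos_of_dvd_of_pos h1 hq.1, (Nat.le_of_dvd hq.1 h1).trans hq.2⟩, h1⟩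
          · rintro ⟨_, h1⟩
            exact ⟨h1, by omega⟩
        rw [hdiv, Finset.sum_filter]
        refine Finset.sum_congr rfl fun e _ => ?_
        split_ifs
        · ring
        · simp
    _ ≤ ∑ e ∈ Finset.Icc 1 ⌊Q⌋₊, C * (1 + Real.log Q) ^ j * (e : ℝ) ^ (-(5 / 4) : ℝ) := by
        refine Finset.sum_le_sum fun e he => ?_
        have he1 := (Finset.mem_Icc.1 he).1
        have he0 : (0 : ℝ) < e := by exact_mod_cast he1
        calc _ ≤ (e : ℝ) ^ (-(1 / 2) : ℝ) * (C * (e : ℝ) ^ ((1 / 4 : ℝ) - 1)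
              * (1 + Real.log Q) ^ j) := by
              gcongr
              exact H e he1 Q hQ
          _ = C * (1 + Real.log Q) ^ j * ((e : ℝ) ^ (-(1 / 2) : ℝ) * (e : ℝ) ^ ((1 / 4 : ℝ) - 1)) := by
              ring
          _ = _ := by
              rw [← Real.rpow_add he0]
              norm_num
    _ = C * (1 + Real.log Q) ^ j * ∑ e ∈ Finset.Icc 1 ⌊Q⌋₊, (e : ℝ) ^ (-(5 / 4) : ℝ) := by
        rw [Finset.mul_sum]
    _ ≤ C * (1 + Real.log Q) ^ j * S := by
        gcongr
        exact hsum.sum_le_tsum _ fun _ _ => by positivity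
    _ = _ := by ring

/-! ### Assembling the correlation sum -/

theorem one_add_log_rpow_le {B : ℝ} (hB1 : B ≤ 1) {x : ℝ} (hx : 1 ≤ x) :
    1 + Real.log (x ^ B) ≤ 1 + Real.log x ∧ B * (1 + Real.log x) ≤ 1 + Real.log (x ^ B) := by
  rw [Real.log_rpow (by linarith)]
  have := Real.log_nonneg hx
  constructor <;> nlinarith

/-- `∑_{n ≤ x^B} d_j(n) n^(1/B - 1)` is at most a constant times `x (1 + log x)^(j - 1)`. -/
theorem sum_divisorFun_mul_rpow_inv_le (j : ℕ) {B : ℝ} (hB0 : 0 < B) (hB1 : B ≤ 1) {x : ℝ}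
    (hx : 1 ≤ x) :
    ∑ n ∈ Finset.Icc 1 ⌊x ^ B⌋₊, (divisorFun j n : ℝ) * ((n : ℝ) ^ (1 / B) * (1 / n))
      ≤ B⁻¹ * (x * (1 + Real.log x) ^ ((j : ℤ) - 1)) := by
  have hx0 : 0 < x := by linarith
  have hxB : 1 ≤ x ^ B := Real.one_le_rpow hx hB0.le
  have hBi : 1 ≤ 1 / B := by rwa [le_div_iff₀ hB0, one_mul]
  obtain ⟨hl1, hl2⟩ := one_add_log_rpow_le hB1 hx
  have hL := one_le_one_add_log hx
  have hL' := one_le_one_add_log hxB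
  have hzpow : (1 + Real.log (x ^ B)) ^ ((j : ℤ) - 1) ≤ B⁻¹ * (1 + Real.log x) ^ ((j : ℤ) - 1) := by
    rcases j with _ | j
    · simp only [CharP.cast_eq_zero, zero_sub, zpow_neg, zpow_one]
      rw [← mul_inv]
      exact inv_anti₀ (by positivity) hl2
    · rw [show ((j + 1 : ℕ) : ℤ) - 1 = (j : ℤ) by push_cast; ring, zpow_natCast, zpow_natCast]
      calc _ ≤ 1 * (1 + Real.log x) ^ j := by
            rw [one_mul]
            gcongr
        _ ≤ _ := by
            gcongr
            rwa [← one_div]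
  calc _ ≤ ∑ n ∈ Finset.Icc 1 ⌊x ^ B⌋₊,
        (x ^ B) ^ (1 / B - 1) * ((divisorFun j n : ℝ) * (n : ℝ) ^ ((1 : ℝ) - 1)) := by
        refine Finset.sum_le_sum fun n hn => ?_
        obtain ⟨h1, h2⟩ := natCast_le_of_mem_Icc_floor hn
        have hn0 : (0 : ℝ) < n := by linarith
        -- Since 1/B ≥ 1 the weight is increasing and is replaced by its value at x^B; the average
        -- of d_j then supplies the power j - 1 of the logarithm.
        have h3 : (n : ℝ) ^ (1 / B) * (1 / n) ≤ (x ^ B) ^ (1 / B - 1) := by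
          rw [mul_one_div, ← Real.rpow_sub_one hn0.ne']
          have : 0 ≤ 1 / B - 1 := by linarith
          gcongr
        rw [sub_self, Real.rpow_zero, mul_one, mul_comm ((x ^ B) ^ (1 / B - 1))]
        gcongr
    _ = (x ^ B) ^ (1 / B - 1) * ∑ n ∈ Finset.Icc 1 ⌊x ^ B⌋₊,
          ((divisorFun j n : ℝ) * (n : ℝ) ^ ((1 : ℝ) - 1)) := by rw [Finset.mul_sum]
    _ ≤ (x ^ B) ^ (1 / B - 1) * ((1 : ℝ)⁻¹ * (x ^ B) ^ (1 : ℝ) *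
          (1 + Real.log (x ^ B)) ^ ((j : ℤ) - 1)) := by
        gcongr
        exact sum_divisorFun_mul_rpow_le j one_pos le_rfl hxB
    _ = x * (1 + Real.log (x ^ B)) ^ ((j : ℤ) - 1) := by
        have : (x ^ B) ^ (1 / B - 1) * (x ^ B) ^ (1 : ℝ) = x := by
          rw [← Real.rpow_add (by positivity), sub_add_cancel, ← Real.rpow_mul hx0.le,
            mul_one_div_cancel hB0.ne', Real.rpow_one]
        rw [inv_one, one_mul, ← mul_assoc, this]
    _ ≤ x * (B⁻¹ * (1 + Real.log x) ^ ((j : ℤ) - 1)) := by gcongr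
    _ = _ := by ring

open Classical in
/-- The correlation sum, ordered by the modulus `q`. -/
theorem sum_partialDivisorFun_mul_eq {h : ℕ} (hh : 1 ≤ h) (i j N : ℕ) (A : ℝ) {B : ℝ}
    (hB0 : 0 < B) :
    ∑ n ∈ Finset.Icc 1 N, (partialDivisorFun (i + 1) (n + h) A : ℝ) * partialDivisorFun (j + 1) n B
      = ∑ q ∈ Finset.Icc 1 ⌊(N : ℝ) ^ B⌋₊, (divisorFun j q : ℝ) *
        ∑ m ∈ Finset.Ioc (⌈(q : ℝ) ^ (1 / B)⌉₊ + h - 1) (N + h) with m ≡ h [MOD q],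
          (partialDivisorFun (i + 1) m A : ℝ) := by
  have hqn : ∀ q n : ℕ, (q : ℝ) ≤ (n : ℝ) ^ B ↔ ⌈(q : ℝ) ^ (1 / B)⌉₊ ≤ n := by
    intro q n
    rw [Nat.ceil_le, one_div]
    exact (Real.rpow_inv_le_iff_of_pos (by positivity) (by positivity) hB0).symm
  calc _ = ∑ n ∈ Finset.Icc 1 N, ∑ q ∈ n.divisors.filter (fun q : ℕ => (q : ℝ) ≤ (n : ℝ) ^ B),
        (divisorFun j q : ℝ) * (partialDivisorFun (i + 1) (n + h) A : ℝ) := by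
        refine Finset.sum_congr rfl fun n _ => ?_
        rw [← Finset.sum_mul, mul_comm]
        congr 1
        rw [partialDivisorFun, Nat.add_sub_cancel]
        push_cast
        rfl
    _ = ∑ q ∈ Finset.Icc 1 ⌊(N : ℝ) ^ B⌋₊,
        ∑ n ∈ (Finset.Icc 1 N).filter (fun n : ℕ => q ∣ n ∧ (q : ℝ) ≤ (n : ℝ) ^ B),
        (divisorFun j q : ℝ) * (partialDivisorFun (i + 1) (n + h) A : ℝ) := by
        apply Finset.sum_comm'
        intro n q
        simp only [Finset.mem_filter, Finset.mem_Icc, Nat.mem_divisors]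
        constructor
        · rintro ⟨⟨h1, h2⟩, ⟨h3, h4⟩, h5⟩
          have hq1 : 1 ≤ q := Nat.pos_of_dvd_of_pos h3 h1
          refine ⟨⟨⟨h1, h2⟩, h3, h5⟩, hq1, ?_⟩
          rw [Nat.le_floor_iff' (by omega)]
          have : (n : ℝ) ≤ N := by exact_mod_cast h2
          exact h5.trans (by gcongr)
        · rintro ⟨⟨⟨h1, h2⟩, h3, h5⟩, hq1, _⟩
          exact ⟨⟨h1, h2⟩, ⟨h3, by omega⟩, h5⟩
    _ = _ := by
        refine Finset.sum_congr rfl fun q hq => ?_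
        have hq1 := (Finset.mem_Icc.1 hq).1
        rw [← Finset.mul_sum]
        congr 1
        -- Ensures that the left endpoint is at least h, so that m ↦ m - h is a genuine subtraction
        -- with values n ≥ 1.
        have hceil : 1 ≤ ⌈(q : ℝ) ^ (1 / B)⌉₊ := by
          have : (0 : ℝ) < q := by exact_mod_cast hq1
          exact Nat.ceil_pos.2 (by positivity)
        refine Finset.sum_bij' (fun n _ => n + h) (fun m _ => m - h) ?_ ?_ ?_ ?_ ?_
        · intro n hn
          simp only [Finset.mem_filter, Finset.mem_Icc, Finset.mem_Ioc, hqn] at hn ⊢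
          refine ⟨⟨by omega, by omega⟩, ?_⟩
          have := (Nat.modEq_zero_iff_dvd.2 hn.2.1).add_right h
          simpa using this
        · intro m hm
          simp only [Finset.mem_filter, Finset.mem_Icc, Finset.mem_Ioc, hqn] at hm ⊢
          refine ⟨⟨by omega, by omega⟩, ?_, by omega⟩
          exact (Nat.modEq_iff_dvd' (by omega)).1 hm.2.symm
        · intro n _
          exact Nat.add_sub_cancel n h
        · intro m hm
          simp only [Finset.mem_filter, Finset.mem_Ioc] at hm
          exact Nat.sub_add_cancel (by omega)
        · intro n _
          rfl

-- Three errors arise for each q: passing from the class of h to the mean over classes, which saves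
-- a power of X; the counting error inside the mean; and the truncations q ≤ n^B and d ≤ m^A, which
-- make m start near q^(1/B) or d^(1/A). The truncations cost one logarithm less than the main term
-- because d_j(q) q^(1/B - 1), and likewise d_i(d) d^(1/A - 1), live at the top of their ranges.
set_option maxHeartbeats 1600000 in
theorem exists_abs_sum_sub_pairSum_le {h : ℕ} (hh : 1 ≤ h) (i j : ℕ) {A B θ θ' : ℝ} (hA0 : 0 < A)
    (hA1 : A ≤ 1) (hθ : IsExponentOfDistribution (i + 1) θ) (hθ' : IsExponentOfDistribution i θ')
    (hB0 : 0 < B) (hB : B < min θ (A * θ')) :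
    ∃ C : ℝ, 0 ≤ C ∧ ∀ N : ℕ, 1 ≤ N →
      |∑ n ∈ Finset.Icc 1 N,
          (partialDivisorFun (i + 1) (n + h) A : ℝ) * partialDivisorFun (j + 1) n B
        - ((N + h : ℕ) : ℝ) * pairSum h i j (((N + h : ℕ) : ℝ) ^ A) ((N : ℝ) ^ B)|
      ≤ C * (((N + h : ℕ) : ℝ) * (1 + Real.log ((N + h : ℕ) : ℝ)) ^ (((i + j : ℕ) : ℤ) - 1)) := by
  have hh0 : h ≠ 0 := by omega
  have hB1 : B ≤ 1 := (lt_min_iff.1 hB).1.le.trans (hθ 1 le_rfl).2.1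
  obtain ⟨δ, hδ, hδ1, C₀, hC₀, H₀⟩ :=
    exists_abs_sum_partialDivisorFun_sub_le h i hh0 hA0 hA1 hθ hθ' hB0 hB
  obtain ⟨C₁, hC₁, H₁⟩ := exists_abs_mean_partialDivisorFun_sub_le hh0 i hA0
  obtain ⟨C₂, hC₂, H₂⟩ := exists_sum_divisorFun_mul_divisorWeight_le j
  refine ⟨C₀ * δ⁻¹ + C₁ * C₂ * 4 + h * (B⁻¹ + h + A⁻¹), by positivity, fun N hN => ?_⟩
  set X : ℕ := N + h with hXdef
  have hN1 : (1 : ℝ) ≤ N := by exact_mod_cast hN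
  have hX : 1 ≤ X := by omega
  have hX1 : (1 : ℝ) ≤ X := by exact_mod_cast hX
  have hX0 : (0 : ℝ) < X := by linarith
  have hNX : (N : ℝ) ≤ X := by exact_mod_cast (by omega : N ≤ X)
  set L : ℝ := 1 + Real.log X with hL
  have hL1 : 1 ≤ L := one_le_one_add_log hX1
  have hL0 : 0 < L := by linarith
  have hQ1 : 1 ≤ (N : ℝ) ^ B := Real.one_le_rpow hN1 hB0.le
  have hQX : (N : ℝ) ^ B ≤ (X : ℝ) ^ B := by gcongr
  have hXB1 : 1 ≤ (X : ℝ) ^ B := hQ1.trans hQX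
  have hD1 : 1 ≤ (X : ℝ) ^ A := Real.one_le_rpow hX1 hA0.le
  have hDX : (X : ℝ) ^ A ≤ X := by
    calc (X : ℝ) ^ A ≤ (X : ℝ) ^ (1 : ℝ) := by gcongr
      _ = X := Real.rpow_one _
  have hLQ : 1 + Real.log ((N : ℝ) ^ B) ≤ L := by
    refine le_trans ?_ (one_add_log_rpow_le hB1 hX1).1
    gcongr
  have hLQ1 := one_le_one_add_log hQ1
  have hLD : 1 + Real.log ((X : ℝ) ^ A) ≤ L := (one_add_log_rpow_le hA1 hX1).1
  have hLD1 := one_le_one_add_log hD1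
  -- Integer exponents throughout, since i + j - 1 equals -1 when k = l = 1.
  have hz : ∀ a b : ℕ, L ^ a * L ^ ((b : ℤ) - 1) = L ^ (((a + b : ℕ) : ℤ) - 1) := by
    intro a b
    rw [← zpow_natCast, ← zpow_add₀ hL0.ne']
    congr 1
    push_cast
    ring
  set Z : ℝ := X * L ^ (((i + j : ℕ) : ℤ) - 1) with hZ
  have hzpos : ∀ n : ℤ, 0 < L ^ n := fun n => zpow_pos hL0 n
  have hLZ : L ^ (i + j) = L * L ^ (((i + j : ℕ) : ℤ) - 1) := by
    have := hz 1 (i + j)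
    rw [pow_one] at this
    rw [this, ← zpow_natCast]
    congr 1
    push_cast
    ring
  set sQ := Finset.Icc 1 ⌊(N : ℝ) ^ B⌋₊ with hsQ
  set sD := Finset.Icc 1 ⌊(X : ℝ) ^ A⌋₊ with hsD
  set u : ℕ → ℕ := fun q => ⌈(q : ℝ) ^ (1 / B)⌉₊ + h - 1 with hu
  have hu1 : ∀ q, (u q : ℝ) ≤ (q : ℝ) ^ (1 / B) + h := by
    intro q
    have h1 : (u q : ℝ) + 1 = ⌈(q : ℝ) ^ (1 / B)⌉₊ + h := by
      have : u q + 1 = ⌈(q : ℝ) ^ (1 / B)⌉₊ + h := by simp only [hu]; omega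
      exact_mod_cast this
    have h2 := Nat.ceil_lt_add_one (a := (q : ℝ) ^ (1 / B)) (by positivity)
    linarith
  have hu2 : ∀ q ∈ sQ, u q ≤ X := by
    intro q hq
    obtain ⟨h1, h2⟩ := natCast_le_of_mem_Icc_floor hq
    have h3 : ⌈(q : ℝ) ^ (1 / B)⌉₊ ≤ N := by
      rw [Nat.ceil_le]
      calc (q : ℝ) ^ (1 / B) ≤ ((N : ℝ) ^ B) ^ (1 / B) := by gcongr
        _ = N := by rw [← Real.rpow_mul (by positivity), mul_one_div_cancel hB0.ne', Real.rpow_one]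
    simp only [hu]
    omega
  have hW0 : ∀ q : ℕ, 0 ≤ divisorWeight q / q := fun q =>
    div_nonneg (divisorWeight_nonneg q) (by positivity)
  set E : ℝ := ∑ d ∈ sD, (divisorFun i d : ℝ) * ((X : ℝ) / d) ^ (3 / 4 : ℝ) with hE
  have hE0 : 0 ≤ E := Finset.sum_nonneg fun d _ => by positivity
  -- Extended to all d ≤ X, this is the average bound with κ = 1/4, since (X/d)^(3/4) = X^(3/4) d^(κ
  -- - 1). The logarithm saved here pays for the counting error.
  have hEle : E ≤ 4 * (X * L ^ ((i : ℤ) - 1)) := by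
    have h1 := sum_divisorFun_mul_rpow_le i (κ := 1 / 4) (by norm_num) (by norm_num) hX1
    calc E ≤ ∑ d ∈ Finset.Icc 1 ⌊(X : ℝ)⌋₊, (divisorFun i d : ℝ) * ((X : ℝ) / d) ^ (3 / 4 : ℝ) := by
          refine Finset.sum_le_sum_of_subset_of_nonneg ?_ fun _ _ _ => by positivity
          exact Finset.Icc_subset_Icc le_rfl (Nat.floor_le_floor hDX)
      _ = (X : ℝ) ^ (3 / 4 : ℝ) * ∑ d ∈ Finset.Icc 1 ⌊(X : ℝ)⌋₊,
            (divisorFun i d : ℝ) * (d : ℝ) ^ ((1 / 4 : ℝ) - 1) := by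
          rw [Finset.mul_sum]
          refine Finset.sum_congr rfl fun d _ => ?_
          rw [Real.div_rpow (by positivity) (by positivity), div_eq_mul_inv,
            ← Real.rpow_neg (by positivity)]
          norm_num
          ring
      _ ≤ (X : ℝ) ^ (3 / 4 : ℝ) * ((1 / 4 : ℝ)⁻¹ * (X : ℝ) ^ (1 / 4 : ℝ) * L ^ ((i : ℤ) - 1)) := by
          gcongr
      _ = 4 * (((X : ℝ) ^ (3 / 4 : ℝ) * (X : ℝ) ^ (1 / 4 : ℝ)) * L ^ ((i : ℤ) - 1)) := by
          norm_num
          ring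
      _ = _ := by
          rw [← Real.rpow_add hX0]
          norm_num
  have hpair : (X : ℝ) * pairSum h i j ((X : ℝ) ^ A) ((N : ℝ) ^ B)
      = ∑ q ∈ sQ, (divisorFun j q : ℝ) *
        (X * ∑ d ∈ sD, (divisorFun i d : ℝ) * pairWeight h d q) := by
    unfold pairSum pairWeight
    rw [Finset.sum_comm, Finset.mul_sum]
    refine Finset.sum_congr rfl fun q _ => ?_
    rw [Finset.mul_sum, Finset.mul_sum, Finset.mul_sum]
    refine Finset.sum_congr rfl fun d _ => ?_
    ring
  rw [sum_partialDivisorFun_mul_eq hh i j N A hB0, hpair, ← Finset.sum_sub_distrib]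
  have hterm : ∀ q ∈ sQ, |(divisorFun j q : ℝ) *
      ∑ m ∈ Finset.Ioc (u q) X with m ≡ h [MOD q], (partialDivisorFun (i + 1) m A : ℝ)
      - (divisorFun j q : ℝ) * (X * ∑ d ∈ sD, (divisorFun i d : ℝ) * pairWeight h d q)|
      ≤ C₀ * (X : ℝ) ^ (1 - δ) * ((divisorFun j q : ℝ) / q)
        + C₁ * E * ((divisorFun j q : ℝ) * (divisorWeight q / q))
        + h * ((divisorFun j q : ℝ) * ((q : ℝ) ^ (1 / B) * (1 / q)) * ∑ d ∈ sD, (divisorFun i d : ℝ) / d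
          + h * ((divisorFun j q : ℝ) / q * ∑ d ∈ sD, (divisorFun i d : ℝ) / d)
          + (divisorFun j q : ℝ) / q *
            ∑ d ∈ sD, (divisorFun i d : ℝ) * ((d : ℝ) ^ (1 / A) * (1 / d))) := by
    intro q hq
    obtain ⟨hq1', hq2⟩ := natCast_le_of_mem_Icc_floor hq
    have hq1 := (Finset.mem_Icc.1 hq).1
    have huX := hu2 q hq
    have e1 := abs_sum_modEq_sub_mean_le (f := fun m => (partialDivisorFun (i + 1) m A : ℝ))
      (s := Finset.Ioc (u q) X) (a := h) hq1 (E := C₀ * ((X : ℝ) ^ (1 - δ) / q)) (fun b hb =>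
        H₀ (u q) X q h b hX huX hq1 (hq2.trans hQX) hb (Nat.gcd_dvd_left _ _))
    have e2 := H₁ (u q) X q hX huX hq1
    have e3 : ∑ d ∈ sD, (divisorFun i d : ℝ) * pairWeight h d q * (u q + (d : ℝ) ^ (1 / A))
        ≤ h * ((q : ℝ) ^ (1 / B) * (1 / q) * ∑ d ∈ sD, (divisorFun i d : ℝ) / d
          + h * (1 / q * ∑ d ∈ sD, (divisorFun i d : ℝ) / d)
          + 1 / q * ∑ d ∈ sD, (divisorFun i d : ℝ) * ((d : ℝ) ^ (1 / A) * (1 / d))) := by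
      calc _ ≤ ∑ d ∈ sD, (divisorFun i d : ℝ) * (h * (1 / d * (1 / q)))
            * (((q : ℝ) ^ (1 / B) + h) + (d : ℝ) ^ (1 / A)) := by
            refine Finset.sum_le_sum fun d _ => ?_
            have := pairWeight_nonneg h d q
            gcongr
            · exact pairWeight_le hh0 d q
            · exact hu1 q
        _ = _ := by
            simp only [Finset.mul_sum, ← Finset.sum_add_distrib]
            refine Finset.sum_congr rfl fun d _ => ?_
            ring
    rw [← mul_sub, abs_mul, abs_of_nonneg (by positivity : (0 : ℝ) ≤ divisorFun j q)]
    have e4 : |∑ m ∈ Finset.Ioc (u q) X with m ≡ h [MOD q], (partialDivisorFun (i + 1) m A : ℝ)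
        - X * ∑ d ∈ sD, (divisorFun i d : ℝ) * pairWeight h d q|
        ≤ C₀ * ((X : ℝ) ^ (1 - δ) / q) + (C₁ * (divisorWeight q / q) * E
          + h * ((q : ℝ) ^ (1 / B) * (1 / q) * ∑ d ∈ sD, (divisorFun i d : ℝ) / d
          + h * (1 / q * ∑ d ∈ sD, (divisorFun i d : ℝ) / d)
          + 1 / q * ∑ d ∈ sD, (divisorFun i d : ℝ) * ((d : ℝ) ^ (1 / A) * (1 / d)))) := by
      refine (abs_sub_le _ _ _).trans (add_le_add e1 (e2.trans ?_))
      gcongr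
    calc _ ≤ (divisorFun j q : ℝ) * _ := mul_le_mul_of_nonneg_left e4 (by positivity)
      _ = _ := by ring
  have hDsum : ∑ d ∈ sD, (divisorFun i d : ℝ) / d ≤ L ^ i := by
    refine (sum_divisorFun_div_le i hD1).trans ?_
    gcongr
  have hDsum0 : 0 ≤ ∑ d ∈ sD, (divisorFun i d : ℝ) / d :=
    Finset.sum_nonneg fun _ _ => by positivity
  have hQsum : ∑ q ∈ sQ, (divisorFun j q : ℝ) / q ≤ L ^ j := by
    refine (sum_divisorFun_div_le j hQ1).trans ?_
    gcongr
  have hQsum0 : 0 ≤ ∑ q ∈ sQ, (divisorFun j q : ℝ) / q :=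
    Finset.sum_nonneg fun _ _ => by positivity
  have hDA : ∑ d ∈ sD, (divisorFun i d : ℝ) * ((d : ℝ) ^ (1 / A) * (1 / d))
      ≤ A⁻¹ * (X * L ^ ((i : ℤ) - 1)) := sum_divisorFun_mul_rpow_inv_le i hA0 hA1 hX1
  have hQB : ∑ q ∈ sQ, (divisorFun j q : ℝ) * ((q : ℝ) ^ (1 / B) * (1 / q))
      ≤ B⁻¹ * (X * L ^ ((j : ℤ) - 1)) := by
    refine le_trans ?_ (sum_divisorFun_mul_rpow_inv_le j hB0 hB1 hX1)
    refine Finset.sum_le_sum_of_subset_of_nonneg ?_ fun _ _ _ => by positivity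
    exact Finset.Icc_subset_Icc le_rfl (Nat.floor_le_floor hQX)
  have hQW : ∑ q ∈ sQ, (divisorFun j q : ℝ) * (divisorWeight q / q) ≤ C₂ * L ^ j := by
    refine (H₂ _ hQ1).trans ?_
    gcongr
  -- The saving X^δ is spent on a single logarithm, which suffices even when i + j = 0.
  have ta : C₀ * (X : ℝ) ^ (1 - δ) * ∑ q ∈ sQ, (divisorFun j q : ℝ) / q ≤ C₀ * δ⁻¹ * Z := by
    have h1 : L ^ j ≤ L ^ (i + j) := pow_le_pow_right₀ hL1 (by omega)
    have h2 : L ≤ δ⁻¹ * (X : ℝ) ^ δ := one_add_log_le_rpow hδ hδ1 hX1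
    calc _ ≤ C₀ * (X : ℝ) ^ (1 - δ) * (L * L ^ (((i + j : ℕ) : ℤ) - 1)) := by
          gcongr
          exact hQsum.trans (h1.trans hLZ.le)
      _ ≤ C₀ * (X : ℝ) ^ (1 - δ) * ((δ⁻¹ * (X : ℝ) ^ δ) * L ^ (((i + j : ℕ) : ℤ) - 1)) := by
          gcongr
      _ = C₀ * δ⁻¹ * (((X : ℝ) ^ (1 - δ) * (X : ℝ) ^ δ) * L ^ (((i + j : ℕ) : ℤ) - 1)) := by ring
      _ = _ := by
          rw [← Real.rpow_add hX0, sub_add_cancel, Real.rpow_one]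
  have hQW0 : 0 ≤ ∑ q ∈ sQ, (divisorFun j q : ℝ) * (divisorWeight q / q) :=
    Finset.sum_nonneg fun q _ => mul_nonneg (by positivity) (hW0 q)
  have hDA0 : 0 ≤ ∑ d ∈ sD, (divisorFun i d : ℝ) * ((d : ℝ) ^ (1 / A) * (1 / d)) :=
    Finset.sum_nonneg fun _ _ => by positivity
  have hLj0 : 0 ≤ L ^ j := by positivity
  have hXi0 : 0 ≤ (X : ℝ) * L ^ ((i : ℤ) - 1) := mul_nonneg hX0.le (hzpos _).le
  have hXj0 : 0 ≤ (X : ℝ) * L ^ ((j : ℤ) - 1) := mul_nonneg hX0.le (hzpos _).le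
  have tb : C₁ * E * ∑ q ∈ sQ, (divisorFun j q : ℝ) * (divisorWeight q / q) ≤ C₁ * C₂ * 4 * Z := by
    calc _ ≤ C₁ * (4 * (X * L ^ ((i : ℤ) - 1))) * (C₂ * L ^ j) :=
          mul_le_mul (mul_le_mul_of_nonneg_left hEle hC₁) hQW hQW0
            (mul_nonneg hC₁ (mul_nonneg zero_le_four hXi0))
      _ = C₁ * C₂ * 4 * (X * (L ^ j * L ^ ((i : ℤ) - 1))) := by ring
      _ = _ := by rw [hz j i, add_comm j i]
  have tc1 : (∑ q ∈ sQ, (divisorFun j q : ℝ) * ((q : ℝ) ^ (1 / B) * (1 / q)))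
      * ∑ d ∈ sD, (divisorFun i d : ℝ) / d ≤ B⁻¹ * Z := by
    calc _ ≤ (B⁻¹ * (X * L ^ ((j : ℤ) - 1))) * L ^ i :=
          mul_le_mul hQB hDsum hDsum0 (mul_nonneg (inv_nonneg.2 hB0.le) hXj0)
      _ = B⁻¹ * (X * (L ^ i * L ^ ((j : ℤ) - 1))) := by ring
      _ = _ := by rw [hz i j]
  have tc2 : (∑ q ∈ sQ, (divisorFun j q : ℝ) / q) * ∑ d ∈ sD, (divisorFun i d : ℝ) / d ≤ Z := by
    have h2 : L ≤ X := by
      have := one_add_log_le_rpow one_pos le_rfl hX1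
      rwa [inv_one, one_mul, Real.rpow_one] at this
    calc _ ≤ L ^ j * L ^ i := mul_le_mul hQsum hDsum hDsum0 hLj0
      _ = L * L ^ (((i + j : ℕ) : ℤ) - 1) := by rw [← pow_add, add_comm j i, hLZ]
      _ ≤ _ := mul_le_mul_of_nonneg_right h2 (hzpos _).le
  have tc3 : (∑ q ∈ sQ, (divisorFun j q : ℝ) / q)
      * ∑ d ∈ sD, (divisorFun i d : ℝ) * ((d : ℝ) ^ (1 / A) * (1 / d)) ≤ A⁻¹ * Z := by
    calc _ ≤ L ^ j * (A⁻¹ * (X * L ^ ((i : ℤ) - 1))) := mul_le_mul hQsum hDA hDA0 hLj0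
      _ = A⁻¹ * (X * (L ^ j * L ^ ((i : ℤ) - 1))) := by ring
      _ = _ := by rw [hz j i, add_comm j i]
  refine (Finset.abs_sum_le_sum_abs _ _).trans ((Finset.sum_le_sum hterm).trans ?_)
  simp only [Finset.sum_add_distrib, ← Finset.mul_sum, ← Finset.sum_mul]
  have tc : (h : ℝ) * ((∑ q ∈ sQ, (divisorFun j q : ℝ) * ((q : ℝ) ^ (1 / B) * (1 / q)))
      * ∑ d ∈ sD, (divisorFun i d : ℝ) / d
      + h * ((∑ q ∈ sQ, (divisorFun j q : ℝ) / q) * ∑ d ∈ sD, (divisorFun i d : ℝ) / d)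
      + (∑ q ∈ sQ, (divisorFun j q : ℝ) / q)
        * ∑ d ∈ sD, (divisorFun i d : ℝ) * ((d : ℝ) ^ (1 / A) * (1 / d)))
      ≤ h * (B⁻¹ * Z + h * Z + A⁻¹ * Z) :=
    mul_le_mul_of_nonneg_left (add_le_add (add_le_add tc1
      (mul_le_mul_of_nonneg_left tc2 (Nat.cast_nonneg h))) tc3) (Nat.cast_nonneg h)
  calc _ ≤ C₀ * δ⁻¹ * Z + C₁ * C₂ * 4 * Z + h * (B⁻¹ * Z + h * Z + A⁻¹ * Z) :=
        add_le_add (add_le_add ta tb) tc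
    _ = _ := by ring

theorem exists_abs_sum_sub_main_le {h : ℕ} (hh : 1 ≤ h) (i j : ℕ) {A B θ θ' : ℝ} (hA0 : 0 < A)
    (hA1 : A ≤ 1) (hθ : IsExponentOfDistribution (i + 1) θ) (hθ' : IsExponentOfDistribution i θ')
    (hB0 : 0 < B) (hB : B < min θ (A * θ')) :
    ∃ C : ℝ, 0 ≤ C ∧ ∀ N : ℕ, 1 ≤ N →
      |∑ n ∈ Finset.Icc 1 N,
          (partialDivisorFun (i + 1) (n + h) A : ℝ) * partialDivisorFun (j + 1) n B
        - A ^ i * B ^ j * pairConst h i j / (i.factorial * j.factorial)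
          * (((N + h : ℕ) : ℝ) * Real.log ((N + h : ℕ) : ℝ) ^ i * Real.log N ^ j)|
      ≤ C * (((N + h : ℕ) : ℝ) * (1 + Real.log ((N + h : ℕ) : ℝ)) ^ (((i + j : ℕ) : ℤ) - 1)) := by
  have hB1 : B ≤ 1 := (lt_min_iff.1 hB).1.le.trans (hθ 1 le_rfl).2.1
  obtain ⟨C, hC, H⟩ := exists_abs_sum_sub_pairSum_le hh i j hA0 hA1 hθ hθ' hB0 hB
  obtain ⟨D, hD, H'⟩ := pairSum_asymptotic (h := h) (by omega) i j
  refine ⟨C + D * (i + j), by positivity, fun N hN => ?_⟩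
  have h1 := H N hN
  set X : ℕ := N + h with hXdef
  have hN1 : (1 : ℝ) ≤ N := by exact_mod_cast hN
  have hX1 : (1 : ℝ) ≤ X := by exact_mod_cast (by omega : 1 ≤ X)
  have hX0 : (0 : ℝ) < X := by linarith
  have hNX : (N : ℝ) ≤ X := by exact_mod_cast (by omega : N ≤ X)
  have hQ1 : 1 ≤ (N : ℝ) ^ B := Real.one_le_rpow hN1 hB0.le
  have hD1 : 1 ≤ (X : ℝ) ^ A := Real.one_le_rpow hX1 hA0.le
  have h2 := H' _ _ hD1 hQ1
  set L : ℝ := 1 + Real.log X with hL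
  have hL1 : 1 ≤ L := one_le_one_add_log hX1
  have hL0 : 0 < L := by linarith
  have hLQ : 1 + Real.log ((N : ℝ) ^ B) ≤ L := by
    refine (one_add_log_rpow_le hB1 hN1).1.trans ?_
    rw [hL]
    gcongr
  have hLQ1 := one_le_one_add_log hQ1
  have hLD : 1 + Real.log ((X : ℝ) ^ A) ≤ L := (one_add_log_rpow_le hA1 hX1).1
  have hLD1 := one_le_one_add_log hD1
  have hz : 0 < L ^ (((i + j : ℕ) : ℤ) - 1) := zpow_pos hL0 _
  -- For i = 0 the factor i vanishes and the truncated i - 1 is irrelevant; `t2` treats j likewise.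
  have t1 : i * (1 + Real.log ((X : ℝ) ^ A)) ^ (i - 1) * (1 + Real.log ((N : ℝ) ^ B)) ^ j
      ≤ i * L ^ (((i + j : ℕ) : ℤ) - 1) := by
    rcases i with _ | i
    · simp
    · rw [show (((i + 1 + j : ℕ) : ℤ) - 1) = ((i + j : ℕ) : ℤ) by push_cast; ring, zpow_natCast,
        pow_add, ← mul_assoc, Nat.add_sub_cancel]
      gcongr
  have t2 : j * (1 + Real.log ((X : ℝ) ^ A)) ^ i * (1 + Real.log ((N : ℝ) ^ B)) ^ (j - 1)
      ≤ j * L ^ (((i + j : ℕ) : ℤ) - 1) := by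
    rcases j with _ | j
    · simp
    · rw [show (((i + (j + 1) : ℕ) : ℤ) - 1) = ((i + j : ℕ) : ℤ) by push_cast; ring, zpow_natCast,
        pow_add, ← mul_assoc, Nat.add_sub_cancel]
      gcongr
  have hmain : (X : ℝ) * (pairConst h i j * (Real.log ((X : ℝ) ^ A) ^ i / i.factorial)
        * (Real.log ((N : ℝ) ^ B) ^ j / j.factorial))
      = A ^ i * B ^ j * pairConst h i j / (i.factorial * j.factorial)
          * (X * Real.log X ^ i * Real.log N ^ j) := by
    rw [Real.log_rpow hX0, Real.log_rpow (by linarith), mul_pow, mul_pow]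
    field_simp
  have h3 : |(X : ℝ) * pairSum h i j ((X : ℝ) ^ A) ((N : ℝ) ^ B)
      - A ^ i * B ^ j * pairConst h i j / (i.factorial * j.factorial)
          * (X * Real.log X ^ i * Real.log N ^ j)|
      ≤ D * (i + j) * (X * L ^ (((i + j : ℕ) : ℤ) - 1)) := by
    rw [← hmain, ← mul_sub, abs_mul, abs_of_pos hX0]
    calc _ ≤ (X : ℝ) * (D * (i * L ^ (((i + j : ℕ) : ℤ) - 1) + j * L ^ (((i + j : ℕ) : ℤ) - 1))) := by
          gcongr
          exact h2.trans (by gcongr)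
      _ = _ := by ring
  refine (abs_sub_le _ _ _).trans ((add_le_add h1 h3).trans (le_of_eq ?_))
  ring

/-! ### From the integers N and N + h to real x -/

/-- The hypotheses say that u is v up to relative error O(1/x), a relation stable under products. It
carries ⌊x⌋ + h and its logarithms to x and log x. -/
theorem isBigO_mul_sub_mul {u₁ v₁ u₂ v₂ : ℝ → ℝ}
    (h₁ : (fun x => u₁ x - v₁ x) =O[atTop] fun x => v₁ x * x⁻¹)
    (h₂ : (fun x => u₂ x - v₂ x) =O[atTop] fun x => v₂ x * x⁻¹) :
    (fun x => u₁ x * u₂ x - v₁ x * v₂ x) =O[atTop] fun x => v₁ x * v₂ x * x⁻¹ := by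
  have hinv : (fun x : ℝ => x⁻¹) =O[atTop] fun _ => (1 : ℝ) :=
    tendsto_inv_atTop_zero.isBigO_one ℝ
  have h₃ : u₂ =O[atTop] v₂ := by
    have h4 : (fun x => v₂ x * x⁻¹) =O[atTop] v₂ := by
      simpa using (isBigO_refl v₂ atTop).mul hinv
    have h5 := (h₂.trans h4).add (isBigO_refl v₂ atTop)
    simpa using h5
  have h6 := (h₁.mul h₃).congr_right (g₂ := fun x => v₁ x * v₂ x * x⁻¹) fun x => by ring
  have h7 := ((isBigO_refl v₁ atTop).mul h₂).congr_right (g₂ := fun x => v₁ x * v₂ x * x⁻¹)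
    fun x => by ring
  refine (h6.add h7).congr_left fun x => ?_
  ring

theorem isBigO_pow_sub_pow {u v : ℝ → ℝ}
    (h : (fun x => u x - v x) =O[atTop] fun x => v x * x⁻¹) (n : ℕ) :
    (fun x => u x ^ n - v x ^ n) =O[atTop] fun x => v x ^ n * x⁻¹ := by
  induction n with
  | zero => simpa using isBigO_zero _ _
  | succ n ih => simpa only [pow_succ] using isBigO_mul_sub_mul ih h

theorem isBigO_floor_add_sub (h : ℕ) :
    (fun x : ℝ => ((⌊x⌋₊ + h : ℕ) : ℝ) - x) =O[atTop] fun x => x * x⁻¹ := by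
  refine IsBigO.of_bound (h + 1) ?_
  filter_upwards [eventually_ge_atTop (1 : ℝ)] with x hx
  have h1 := Nat.floor_le (by linarith : 0 ≤ x)
  have h2 := Nat.lt_floor_add_one x
  have h3 : (0 : ℝ) ≤ h := by positivity
  rw [mul_inv_cancel₀ (by linarith), norm_one, mul_one, Real.norm_eq_abs, abs_le]
  push_cast
  constructor <;> linarith

theorem isBigO_log_sub_log {u : ℝ → ℝ} (h : (fun x => u x - x) =O[atTop] fun x => x * x⁻¹) :
    (fun x => Real.log (u x) - Real.log x) =O[atTop] fun x => Real.log x * x⁻¹ := by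
  obtain ⟨C, hC, hb⟩ := h.exists_pos
  refine IsBigO.of_bound (2 * C) ?_
  filter_upwards [hb.bound, eventually_ge_atTop (2 * C + 1),
    Real.tendsto_log_atTop.eventually_ge_atTop 1] with x hx hx2 hlog
  have hx0 : 0 < x := by linarith
  rw [mul_inv_cancel₀ hx0.ne', norm_one, mul_one, Real.norm_eq_abs, abs_le] at hx
  have hu0 : 0 < u x := by linarith
  have hux : x / 2 ≤ u x := by linarith
  rw [Real.norm_eq_abs, norm_mul, Real.norm_eq_abs, abs_of_nonneg (by linarith : 0 ≤ Real.log x),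
    Real.norm_eq_abs, abs_of_pos (by positivity : 0 < x⁻¹)]
  have h1 : Real.log (u x) - Real.log x ≤ 2 * C * x⁻¹ := by
    rw [← Real.log_div hu0.ne' hx0.ne']
    have := Real.log_le_sub_one_of_pos (div_pos hu0 hx0)
    have h2 : u x / x - 1 = (u x - x) * x⁻¹ := by field_simp
    have h3 : (u x - x) * x⁻¹ ≤ (2 * C) * x⁻¹ := by
      gcongr
      linarith
    linarith
  have h2 : Real.log x - Real.log (u x) ≤ 2 * C * x⁻¹ := by
    rw [← Real.log_div hx0.ne' hu0.ne']
    have := Real.log_le_sub_one_of_pos (div_pos hx0 hu0)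
    have h2 : x / u x - 1 = (x - u x) / u x := by field_simp
    have h3 : (x - u x) / u x ≤ C / (x / 2) := by
      gcongr
      linarith
    have h4 : C / (x / 2) = 2 * C * x⁻¹ := by field_simp
    linarith
  have h5 : 2 * C * x⁻¹ ≤ 2 * C * (Real.log x * x⁻¹) := by
    gcongr
    exact le_mul_of_one_le_left (by positivity) hlog
  rw [abs_le]
  constructor <;> linarith

theorem pow_eq_mul_zpow_sub_one {y : ℝ} (hy : y ≠ 0) (m : ℕ) :
    y ^ m = y * y ^ ((m : ℤ) - 1) := by
  rw [zpow_sub_one₀ hy, zpow_natCast]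
  field_simp

theorem isBigO_main_sub_main (h i j : ℕ) :
    (fun x : ℝ => ((⌊x⌋₊ + h : ℕ) : ℝ) * Real.log ((⌊x⌋₊ + h : ℕ) : ℝ) ^ i * Real.log ⌊x⌋₊ ^ j
      - x * Real.log x ^ (i + j)) =O[atTop]
      fun x => x * Real.log x ^ (((i + j : ℕ) : ℤ) - 1) := by
  have h1 := isBigO_floor_add_sub h
  have h2 := isBigO_pow_sub_pow (isBigO_log_sub_log h1) i
  have h3 := isBigO_pow_sub_pow (isBigO_log_sub_log (isBigO_floor_add_sub 0)) j
  have h4 := isBigO_mul_sub_mul (isBigO_mul_sub_mul h1 h2) h3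
  simp only [add_zero] at h4
  refine (h4.congr_left fun x => ?_).trans ?_
  · rw [pow_add]
    ring
  -- Relative error 1/x leaves (log x)^(i+j), which is at most x (log x)^(i+j-1) because log x ≤ x.
  · refine IsBigO.of_bound 1 ?_
    filter_upwards [eventually_ge_atTop (1 : ℝ),
      Real.tendsto_log_atTop.eventually_ge_atTop 1] with x hx hlog
    have hx0 : 0 < x := by linarith
    have hle : Real.log x ≤ x := (Real.log_le_sub_one_of_pos hx0).trans (by linarith)
    have hz : 0 < Real.log x ^ (((i + j : ℕ) : ℤ) - 1) := zpow_pos (by linarith) _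
    have h5 : x * Real.log x ^ i * Real.log x ^ j * x⁻¹
        = Real.log x * Real.log x ^ (((i + j : ℕ) : ℤ) - 1) := by
      rw [← pow_eq_mul_zpow_sub_one (by linarith), pow_add]
      field_simp
    rw [h5, one_mul, Real.norm_eq_abs, Real.norm_eq_abs, abs_of_pos (by positivity),
      abs_of_pos (by positivity)]
    gcongr

/-- 1 + log(⌊x⌋ + h) must be compared with log x from both sides: the upper bound serves m ≥ 1, the
lower one the exponent -1 at m = 0. -/
theorem isBigO_floor_add_mul_zpow {h : ℕ} (hh : 1 ≤ h) (m : ℕ) :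
    (fun x : ℝ => ((⌊x⌋₊ + h : ℕ) : ℝ) * (1 + Real.log ((⌊x⌋₊ + h : ℕ) : ℝ)) ^ ((m : ℤ) - 1))
      =O[atTop] fun x => x * Real.log x ^ ((m : ℤ) - 1) := by
  refine IsBigO.of_bound (2 * 3 ^ m) ?_
  filter_upwards [eventually_ge_atTop (1 : ℝ), eventually_ge_atTop (h : ℝ),
      Real.tendsto_log_atTop.eventually_ge_atTop 1] with x hx hxh hlog
  have hx0 : 0 < x := by linarith
  set X : ℝ := ((⌊x⌋₊ + h : ℕ) : ℝ) with hX
  have hXx : x ≤ X := by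
    have h2 := Nat.lt_floor_add_one x
    have h3 : (1 : ℝ) ≤ h := by exact_mod_cast hh
    rw [hX]
    push_cast
    linarith
  have hX2 : X ≤ 2 * x := by
    have h1 := Nat.floor_le hx0.le
    rw [hX]
    push_cast
    linarith
  have hX0 : 0 < X := by linarith
  have hl1 : Real.log x ≤ 1 + Real.log X := by
    have := Real.log_le_log hx0 hXx
    linarith
  have hl2 : 1 + Real.log X ≤ 3 * Real.log x := by
    have h1 := Real.log_le_log hX0 hX2
    rw [Real.log_mul two_ne_zero hx0.ne'] at h1
    have h2 : Real.log 2 ≤ 1 := by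
      have := Real.log_le_sub_one_of_pos (two_pos (α := ℝ))
      linarith
    linarith
  have hpos : 0 < 1 + Real.log X := by linarith
  have hlog0 : 0 < Real.log x := by linarith
  have hz : (1 + Real.log X) ^ ((m : ℤ) - 1) ≤ 3 ^ m * Real.log x ^ ((m : ℤ) - 1) := by
    rcases m with _ | m
    · simp only [CharP.cast_eq_zero, zero_sub, zpow_neg, zpow_one, pow_zero, one_mul]
      exact inv_anti₀ hlog0 hl1
    · rw [show (((m + 1 : ℕ) : ℤ) - 1) = (m : ℤ) by push_cast; ring, zpow_natCast, zpow_natCast]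
      calc (1 + Real.log X) ^ m ≤ (3 * Real.log x) ^ m := by gcongr
        _ = 3 ^ m * Real.log x ^ m := mul_pow _ _ _
        _ ≤ 3 ^ (m + 1) * Real.log x ^ m := by
          gcongr
          · norm_num
          · omega
  have hz1 : 0 < (1 + Real.log X) ^ ((m : ℤ) - 1) := zpow_pos hpos _
  have hz2 : 0 < Real.log x ^ ((m : ℤ) - 1) := zpow_pos hlog0 _
  rw [Real.norm_eq_abs, Real.norm_eq_abs, abs_of_pos (by positivity), abs_of_pos (by positivity)]
  calc _ ≤ (2 * x) * (3 ^ m * Real.log x ^ ((m : ℤ) - 1)) := by gcongr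
    _ = _ := by ring

theorem theorem2 (h k l : ℕ) (hh : 1 ≤ h) (hk : 1 ≤ k) (hl : 1 ≤ l)
    (A B θ θ' : ℝ) (hA0 : 0 < A) (hA1 : A ≤ 1)
    (hθ : IsExponentOfDistribution k θ) (hθ' : IsExponentOfDistribution (k - 1) θ')
    (hB0 : 0 < B) (hB : B < min θ (A * θ')) :
    (fun x : ℝ =>
        (∑ n ∈ Finset.Icc 1 ⌊x⌋₊,
          (partialDivisorFun k (n + h) A : ℝ) * (partialDivisorFun l n B : ℝ))
        - A ^ (k - 1) * B ^ (l - 1) * singularConst k l * singularFun k l h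
            / (((k - 1).factorial : ℝ) * ((l - 1).factorial : ℝ))
          * (x * Real.log x ^ (k + l - 2)))
      =O[atTop] fun x : ℝ => x * Real.log x ^ ((k : ℤ) + (l : ℤ) - 3) := by
  obtain ⟨i, rfl⟩ : ∃ i, k = i + 1 := ⟨k - 1, by omega⟩
  obtain ⟨j, rfl⟩ : ∃ j, l = j + 1 := ⟨l - 1, by omega⟩
  rw [Nat.add_sub_cancel] at hθ'
  simp only [Nat.add_sub_cancel]
  obtain ⟨C, hC, H⟩ := exists_abs_sum_sub_main_le hh i j hA0 hA1 hθ hθ' hB0 hB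
  rw [show i + 1 + (j + 1) - 2 = i + j by omega,
    show ((i + 1 : ℕ) : ℤ) + ((j + 1 : ℕ) : ℤ) - 3 = ((i + j : ℕ) : ℤ) - 1 by push_cast; ring]
  set c : ℝ := A ^ i * B ^ j * pairConst h i j / (i.factorial * j.factorial) with hc
  have hc' : A ^ i * B ^ j * singularConst (i + 1) (j + 1) * singularFun (i + 1) (j + 1) h
      / ((i.factorial : ℝ) * (j.factorial : ℝ)) = c := by
    rw [hc, pairConst_eq h i j (by omega)]
    ring
  rw [hc']
  have h1 : (fun x : ℝ => (∑ n ∈ Finset.Icc 1 ⌊x⌋₊,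
        (partialDivisorFun (i + 1) (n + h) A : ℝ) * (partialDivisorFun (j + 1) n B : ℝ))
      - c * (((⌊x⌋₊ + h : ℕ) : ℝ) * Real.log ((⌊x⌋₊ + h : ℕ) : ℝ) ^ i * Real.log ⌊x⌋₊ ^ j))
      =O[atTop] fun x => x * Real.log x ^ (((i + j : ℕ) : ℤ) - 1) := by
    refine IsBigO.trans ?_ (isBigO_floor_add_mul_zpow hh (i + j))
    refine IsBigO.of_bound C ?_
    filter_upwards [eventually_ge_atTop (1 : ℝ)] with x hx
    rw [Real.norm_eq_abs, Real.norm_eq_abs]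
    exact (H ⌊x⌋₊ ((Nat.one_le_floor_iff x).2 hx)).trans
      (mul_le_mul_of_nonneg_left (le_abs_self _) hC)
  refine (h1.add ((isBigO_main_sub_main h i j).const_mul_left c)).congr_left fun x => ?_
  ring
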